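/- Let $\mathcal C$ be a closed (compact, connected) Riemann surface of genus $g$, and let $f:\mathcal C\to\mathbb{CP}^1$ be a meromorphic function of degree $d\ge 2$. A point $a\in\mathbb{CP}^1$ is a branch point of $f$ if some point of $f^{-1}(a)$ has multiplicity at least $2$; it is a simple branch point if exactly one point of $f^{-1}(a)$ has multiplicity $2$ and all the others have multiplicity $1$, and a complicated branch point if it is a branch point that is not simple. Consider all holomorphic maps $\nu:\mathcal C\to\mathbb{CP}^2$ that are birational onto their image and satisfy $f=\pi_p\circ\nu$ for some $p\in\mathbb{CP}^2$, where $\pi_p$ is the projection from $p$ to the pencil of lines through $p$, identified with $\mathbb{CP}^1$ (the equality is required outside $\nu^{-1}(p)$). The planarity defect of $f$ is $$\mathrm{pdef}(f)=\min_{\nu}\bigl(\deg \nu(\mathcal C)-\deg f\bigr),$$ where $\deg\nu(\mathcal C)$ is the degree of the plane curve $\nu(\mathcal C)$. Suppose that $f$ has at most one complicated branch point. Then $\mathrm{pdef}(f)=0$ if and only if $h^0(f^*\mathcal O(1))\ge 3$. In particular, under the same assumptions, if $d\ge g+2$, then $\mathrm{pdef}(f)=0$. -/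

import Mathlib

open TopologicalSpace
open scoped Manifold ContDiff

noncomputable section

namespace Planarity

/-! ### Holomorphic maps to projective space -/

/-- Complex projective space `ℂPⁿ`. -/
abbrev CP (n : ℕ) : Type := Projectivization ℂ (Fin (n + 1) → ℂ)

section Maps

variable {C : Type*} [TopologicalSpace C] [ChartedSpace ℂ C]

/-- A map `φ : C → ℂPⁿ` is holomorphic if near every point it is given by homogeneous coordinates
`[s₀ : … : sₙ]` which are holomorphic functions without a common zero. -/
def IsHolomorphic {n : ℕ} (φ : C → CP n) : Prop :=
  ∀ x : C, ∃ (U : Opens C) (_ : x ∈ U) (s : U → (Fin (n + 1) → ℂ)),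
    MDifferentiable 𝓘(ℂ) 𝓘(ℂ, Fin (n + 1) → ℂ) s ∧
      ∀ y : U, ∃ h : s y ≠ 0, φ y = Projectivization.mk ℂ (s y) h

/-! ### Multiplicities, degree and branch points of a meromorphic function -/

/-- The affine coordinate on `ℂP¹` centred at `a`: if `a = [v]` with `v` the chosen representative,
it sends `[w]` to `(v₀ w₁ - v₁ w₀) / (v̄₀ w₀ + v̄₁ w₁)`. It does not depend on the choice of `w`, it
sends `a` to `0`, and it maps the complement of the point orthogonal to `a` biholomorphically onto
`ℂ`; only its behaviour near `a` is used. -/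
def affineCoord (a b : CP 1) : ℂ :=
  (a.rep 0 * b.rep 1 - a.rep 1 * b.rep 0) /
    (star (a.rep 0) * b.rep 0 + star (a.rep 1) * b.rep 1)

/-- The multiplicity (ramification index) of a holomorphic map `f : C → ℂP¹` at `x`: the order of
vanishing at `x` of `f`, read in a chart of `C` at `x` and in the affine coordinate of `ℂP¹`
centred at `f x`. (It is set to `0` if `f` is constant near `x`.) -/
def mult (f : C → CP 1) (x : C) : ℕ :=
  analyticOrderNatAt (fun z : ℂ => affineCoord (f x) (f ((chartAt ℂ x).symm z))) (chartAt ℂ x x)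

/-- The point `∞ = [1 : 0]` of `ℂP¹`. -/
def infinity : CP 1 := Projectivization.mk ℂ ![1, 0] (by simp)

/-- The degree of a meromorphic function: the number of its poles (the points over `∞`), counted
with multiplicity. A constant function has degree `0`. -/
def degree (f : C → CP 1) : ℕ :=
  ∑ᶠ x ∈ f ⁻¹' {infinity}, mult f x

/-- `a` is a branch point of `f`: some point over `a` is ramified. -/
def IsBranchPoint (f : C → CP 1) (a : CP 1) : Prop :=
  ∃ x, f x = a ∧ 2 ≤ mult f x

/-- `a` is a simple branch point of `f`: the profile of the fibre over `a` is `(2, 1, …, 1)`. -/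
def IsSimpleBranchPoint (f : C → CP 1) (a : CP 1) : Prop :=
  ∃ x, f x = a ∧ mult f x = 2 ∧ ∀ y, f y = a → y ≠ x → mult f y = 1

/-- `a` is a complicated branch point of `f`: a branch point which is not simple. -/
def IsComplicatedBranchPoint (f : C → CP 1) (a : CP 1) : Prop :=
  IsBranchPoint f a ∧ ¬ IsSimpleBranchPoint f a

/-! ### Plane models and the planarity defect -/

/-- A holomorphic map `ν : C → ℂPⁿ` is birational onto its image if, off a finite set `S`, it is
injective (even separated from all other points of `C`) and immersive: at each point off `S`, some
quotient of two linear forms in the coordinates of `ν` has non-zero derivative. Thus `ν` restricts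
to an isomorphism from `C \ S` onto the complement of finitely many points in the image. -/
def IsBirationalOntoImage {n : ℕ} (ν : C → CP n) : Prop :=
  ∃ S : Set C, S.Finite ∧ ∀ x, x ∉ S →
    (∀ y, y ≠ x → ν y ≠ ν x) ∧
    ∃ a b : (Fin (n + 1) → ℂ) →ₗ[ℂ] ℂ, b (ν x).rep ≠ 0 ∧
      mfderiv 𝓘(ℂ) 𝓘(ℂ) (fun y : C => a (ν y).rep / b (ν y).rep) x ≠ 0

/-- The degree of a plane algebraic curve `Z` (a set of points of `ℂP²`): the least degree of a
non-zero form vanishing on `Z`. For an irreducible curve this is the degree of its equation. -/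
def planeCurveDegree (Z : Set (CP 2)) : ℕ :=
  sInf {n : ℕ | ∃ F : MvPolynomial (Fin 3) ℂ, F ≠ 0 ∧ F.IsHomogeneous n ∧
    ∀ q ∈ Z, MvPolynomial.eval q.rep F = 0}

/-- `f = π ∘ ν`, where `π` is the projection of `ℂP²` from a point `p` to the pencil of lines
through `p`, identified with `ℂP¹`. Such a projection is induced by a surjective linear map
`T : ℂ³ → ℂ²`, with kernel the line `p`. The equation is required wherever `π` is defined, that is
off `ν ⁻¹ (p)`. -/
def IsProjectionOf (f : C → CP 1) (ν : C → CP 2) : Prop :=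
  ∃ T : (Fin 3 → ℂ) →ₗ[ℂ] (Fin 2 → ℂ), Function.Surjective T ∧
    ∀ (x : C) (h : T (ν x).rep ≠ 0), f x = Projectivization.mk ℂ (T (ν x).rep) h

/-- `ν` is a plane model of `f`: a holomorphic map to `ℂP²`, birational onto its image, such that
`f` is the composition of `ν` with the projection from a point. -/
def IsPlaneModel (f : C → CP 1) (ν : C → CP 2) : Prop :=
  IsHolomorphic ν ∧ IsBirationalOntoImage ν ∧ IsProjectionOf f ν

/-- The planarity defect of `f` equals `n`: the minimum of `deg ν(C) - deg f` over all plane models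
`ν` of `f` exists and is `n`. -/
def HasPlanarityDefect (f : C → CP 1) (n : ℤ) : Prop :=
  IsLeast {m : ℤ | ∃ ν : C → CP 2, IsPlaneModel f ν ∧
    m = (planeCurveDegree (Set.range ν) : ℤ) - (degree f : ℤ)} n

end Maps

/-! ### Global sections of `f^* 𝒪(1)` -/

section Sections

variable {C : Type*} [TopologicalSpace C] [ChartedSpace ℂ C]

/-- The space `H⁰(C, f^* 𝒪(1))`. The fibre of `𝒪(1)` at a point of `ℂP¹`, that is, at a line in
`ℂ²`, is the dual of this line; so a section of `f^* 𝒪(1)` gives a linear form on the line `f x` for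
each `x`. It is holomorphic if its values on all local holomorphic sections of `f^* 𝒪(-1)` are. -/
def globalSections (f : C → CP 1) : Submodule ℂ (∀ x : C, Module.Dual ℂ (f x).submodule) where
  carrier := {σ | ∀ (U : Opens C) (s : U → (Fin 2 → ℂ)),
    MDifferentiable 𝓘(ℂ) 𝓘(ℂ, Fin 2 → ℂ) s → ∀ hs : ∀ y : U, s y ∈ (f y).submodule,
      MDifferentiable 𝓘(ℂ) 𝓘(ℂ) (fun y : U => σ y ⟨s y, hs y⟩)}
  add_mem' := fun ha hb U s h hs => (ha U s h hs).add (hb U s h hs)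
  zero_mem' := fun _ _ _ _ => mdifferentiable_const
  smul_mem' := fun c _ ha U s h hs => (ha U s h hs).const_smul c

/-- The dimension `h⁰(f^* 𝒪(1))`. -/
def h0 (f : C → CP 1) : ℕ∞ := Cardinal.toENat (Module.rank ℂ (globalSections f))

end Sections

/-! ### The genus, as the dimension of the Čech cohomology group `H¹(C, 𝒪)` -/

section Genus

variable (C : Type*) [TopologicalSpace C] [ChartedSpace ℂ C]

/-- An open covering of `C` indexed by the points of `C`, the set with index `x` containing `x`.
Every open covering has a refinement of this form. -/
structure PointedCover where
  /-- the open set with index `x` -/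
  nhd : C → Opens C
  mem_nhd : ∀ x, x ∈ nhd x

/-- `U ≤ V` if `V` refines `U` (with the identity as refinement map). -/
instance : Preorder (PointedCover C) where
  le U V := ∀ x, V.nhd x ≤ U.nhd x
  le_refl _ _ := le_rfl
  le_trans _ _ _ h h' x := (h' x).trans (h x)

instance : Nonempty (PointedCover C) := ⟨⟨fun _ => ⊤, fun _ => trivial⟩⟩

instance : IsDirectedOrder (PointedCover C) :=
  ⟨fun U V => ⟨⟨fun x => U.nhd x ⊓ V.nhd x, fun x => ⟨U.mem_nhd x, V.mem_nhd x⟩⟩,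
    fun _ => inf_le_left, fun _ => inf_le_right⟩⟩

variable {C}

/-- The holomorphic functions on an open set. -/
def holFun (U : Opens C) : Submodule ℂ (U → ℂ) where
  carrier := {g | MDifferentiable 𝓘(ℂ) 𝓘(ℂ) g}
  add_mem' := fun ha hb => MDifferentiable.add ha hb
  zero_mem' := mdifferentiable_const
  smul_mem' := fun c _ ha => MDifferentiable.const_smul c ha

theorem holFun_restrict {U V : Opens C} (h : V ≤ U) {g : U → ℂ} (hg : g ∈ holFun U) :
    (fun y : V => g ⟨y, h y.2⟩) ∈ holFun V :=
  MDifferentiable.comp (I' := 𝓘(ℂ)) hg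
    ((contMDiff_inclusion (n := 1) h).mdifferentiable one_ne_zero)

/-- The Čech 1-cocycles of `𝒪` with respect to a covering: families `g x y ∈ 𝒪(U x ∩ U y)` such that
`g x y + g y z = g x z` on `U x ∩ U y ∩ U z`. -/
def cocycles (U : PointedCover C) :
    Submodule ℂ (∀ x y : C, (U.nhd x ⊓ U.nhd y : Opens C) → ℂ) where
  carrier := {g | (∀ x y, g x y ∈ holFun (U.nhd x ⊓ U.nhd y)) ∧
    ∀ (x y z p : C) (hx : p ∈ U.nhd x) (hy : p ∈ U.nhd y) (hz : p ∈ U.nhd z),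
      g x y ⟨p, hx, hy⟩ + g y z ⟨p, hy, hz⟩ = g x z ⟨p, hx, hz⟩}
  add_mem' := fun {a b} ha hb =>
    ⟨fun x y => Submodule.add_mem _ (ha.1 x y) (hb.1 x y), fun x y z p hx hy hz => by
      simp only [Pi.add_apply, ← ha.2 x y z p hx hy hz, ← hb.2 x y z p hx hy hz]; ring⟩
  zero_mem' := ⟨fun _ _ => Submodule.zero_mem _, fun _ _ _ _ _ _ _ => by simp⟩
  smul_mem' := fun c a ha =>
    ⟨fun x y => Submodule.smul_mem _ c (ha.1 x y), fun x y z p hx hy hz => by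
      simp only [Pi.smul_apply, ← ha.2 x y z p hx hy hz, smul_add]⟩

/-- The Čech 1-coboundaries: the families `(h y - h x) x y` with `h x ∈ 𝒪(U x)`. -/
def coboundaries (U : PointedCover C) :
    Submodule ℂ (∀ x y : C, (U.nhd x ⊓ U.nhd y : Opens C) → ℂ) where
  carrier := {g | ∃ h : ∀ x : C, U.nhd x → ℂ, (∀ x, h x ∈ holFun (U.nhd x)) ∧
    ∀ (x y p : C) (hx : p ∈ U.nhd x) (hy : p ∈ U.nhd y),
      g x y ⟨p, hx, hy⟩ = h y ⟨p, hy⟩ - h x ⟨p, hx⟩}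
  add_mem' := by
    rintro a b ⟨h, hh, ha⟩ ⟨k, hk, hb⟩
    refine ⟨h + k, fun x => Submodule.add_mem _ (hh x) (hk x), fun x y p hx hy => ?_⟩
    simp only [Pi.add_apply, ha x y p hx hy, hb x y p hx hy]; ring
  zero_mem' := ⟨0, fun _ => Submodule.zero_mem _, fun _ _ _ _ _ => by simp⟩
  smul_mem' := by
    rintro c a ⟨h, hh, ha⟩
    refine ⟨c • h, fun x => Submodule.smul_mem _ c (hh x), fun x y p hx hy => ?_⟩
    simp only [Pi.smul_apply, ha x y p hx hy, smul_sub]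

/-- The Čech cohomology group `H¹(U, 𝒪)` of a covering. -/
abbrev coverH1 (U : PointedCover C) : Type _ :=
  cocycles U ⧸ (coboundaries U).comap (cocycles U).subtype

/-- Restriction of cocycles to a refinement. -/
def cocycleRestrict {U V : PointedCover C} (hUV : U ≤ V) : cocycles U →ₗ[ℂ] cocycles V where
  toFun g := ⟨fun x y p => g.1 x y ⟨p, hUV x p.2.1, hUV y p.2.2⟩,
    fun x y => holFun_restrict (inf_le_inf (hUV x) (hUV y)) (g.2.1 x y),
    fun x y z p hx hy hz => g.2.2 x y z p (hUV x hx) (hUV y hy) (hUV z hz)⟩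
  map_add' _ _ := rfl
  map_smul' _ _ := rfl

/-- The map `H¹(U, 𝒪) → H¹(V, 𝒪)` for a refinement `V` of `U`. -/
def coverH1Map (U V : PointedCover C) (hUV : U ≤ V) : coverH1 U →ₗ[ℂ] coverH1 V :=
  Submodule.mapQ _ _ (cocycleRestrict hUV) (by
    rintro g ⟨h, hh, hg⟩
    exact ⟨fun x p => h x ⟨p, hUV x p.2⟩, fun x => holFun_restrict (hUV x) (hh x),
      fun x y p hx hy => hg x y p (hUV x hx) (hUV y hy)⟩)

instance : DirectedSystem (coverH1 (C := C)) (fun U V h => coverH1Map U V h) where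
  map_self _ g := by
    induction g using Submodule.Quotient.induction_on
    rfl
  map_map _ _ _ _ _ g := by
    induction g using Submodule.Quotient.induction_on
    rfl

variable (C)

open Classical in
/-- The Čech cohomology group `H¹(C, 𝒪)` of the sheaf of holomorphic functions: the direct limit of
the groups `H¹(U, 𝒪)` over all open coverings. -/
abbrev H1 : Type _ := Module.DirectLimit (coverH1 (C := C)) coverH1Map

/-- The genus of a closed Riemann surface: the dimension of `H¹(C, 𝒪)`. -/
def genus : ℕ∞ := Cardinal.toENat (Module.rank ℂ (H1 C))

end Genus

end Planarity

end

open Filter Set Topology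
set_option linter.unusedSectionVars false

/-! A plane model of degree `degree f` amounts to a third section of f^*𝒪(1). A general line through
the centre p of the projection meets the curve off p in `degree f` points. So every model has degree
at least `degree f`, and strictly more if p lies on the curve (`degree_add_le_of_form`). Defect zero
therefore puts p off the curve. The three homogeneous coordinates then pull back to sections of
f^*𝒪(1), independent because a curve of degree at least 2 lies on no line (`three_le_h0_of_model`).

Conversely, let s be a section which is not a linear form in the homogeneous coordinates f₀, f₁ of
f, and let ν = [f₀ : f₁ : s]. The centre is off the image, and the characteristic polynomial of s
over the line homogenizes to an equation of degree `degree f` (`exists_form_of_forall_ne`).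
Birationality is where the branching hypothesis enters. Let φ be an affine coordinate of f with the
complicated branch point at infinity, and h the function s in the corresponding trivialization. If
dh vanished at every ramification point at finite distance, then dh/dφ would be holomorphic there,
and over infinity too, because h has no worse poles than φ; by compactness it would be constant and
s a linear form (`exists_eq_linForm`). So dh ≠ 0 at some ramification point x₀ over a simple branch
point. Near x₀ the function h separates the two sheets that meet there, being a local coordinate. It
separates them from the other sheets too: h moves to first order, while φ, and with it h on the
other sheets, moves to second order only (`eventually_separates`). Separation near x₀ spreads to
almost all of C, since the product of h x - h y over the other points y of the fibre of x is
meromorphic in x and not identically zero (`exists_finite_separates`).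

For d ≥ g + 2, simple principal parts on an unramified fibre form a space of dimension d, and their
obstruction to being realized lies in H¹(C, 𝒪), of dimension g. At least two independent ones are
realized, and the constant function is a third section (`three_le_h0_of_genus`). -/

noncomputable section

namespace Planarity

/-! ### Functions on a Riemann surface read in a chart -/

section Local

variable {C : Type*} [TopologicalSpace C] [ChartedSpace ℂ C]

/-- The function `g` read in the preferred chart at `x`. -/
def inChart {E : Type*} (x : C) (g : C → E) : ℂ → E := fun z => g ((chartAt ℂ x).symm z)

/-- `g` is holomorphic near `x`. -/
def HolAt (g : C → ℂ) (x : C) : Prop := AnalyticAt ℂ (inChart x g) (chartAt ℂ x x)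

/-- `g` is meromorphic on `C`. -/
def Mero (g : C → ℂ) : Prop := ∀ x, MeromorphicAt (inChart x g) (chartAt ℂ x x)

theorem inChart_apply_chart {E : Type*} (x : C) (g : C → E) {y : C}
    (hy : y ∈ (chartAt ℂ x).source) : inChart x g (chartAt ℂ x y) = g y := by
  simp [inChart, (chartAt ℂ x).left_inv hy]

@[simp] theorem inChart_apply_self {E : Type*} (x : C) (g : C → E) :
    inChart x g (chartAt ℂ x x) = g x :=
  inChart_apply_chart x g (mem_chart_source ℂ x)

theorem tendsto_chart_symm (x : C) :
    Tendsto (chartAt ℂ x).symm (𝓝 (chartAt ℂ x x)) (𝓝 x) := by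
  have := (chartAt ℂ x).tendsto_symm (mem_chart_source ℂ x)
  exact this

theorem tendsto_chart (x : C) : Tendsto (chartAt ℂ x) (𝓝 x) (𝓝 (chartAt ℂ x x)) :=
  (chartAt ℂ x).continuousAt (mem_chart_source ℂ x)

theorem eventually_mem_source (x : C) : ∀ᶠ y in 𝓝 x, y ∈ (chartAt ℂ x).source :=
  (chartAt ℂ x).open_source.mem_nhds (mem_chart_source ℂ x)

theorem tendsto_chart_ne (x : C) :
    Tendsto (chartAt ℂ x) (𝓝[≠] x) (𝓝[≠] (chartAt ℂ x x)) := by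
  refine tendsto_nhdsWithin_iff.2 ⟨(tendsto_chart x).mono_left nhdsWithin_le_nhds, ?_⟩
  filter_upwards [self_mem_nhdsWithin, nhdsWithin_le_nhds (eventually_mem_source x)] with y hy hs h
  exact hy ((chartAt ℂ x).injOn hs (mem_chart_source ℂ x) h)

theorem tendsto_chart_symm_ne (x : C) :
    Tendsto (chartAt ℂ x).symm (𝓝[≠] (chartAt ℂ x x)) (𝓝[≠] x) := by
  refine tendsto_nhdsWithin_iff.2 ⟨(tendsto_chart_symm x).mono_left nhdsWithin_le_nhds, ?_⟩
  filter_upwards [self_mem_nhdsWithin, nhdsWithin_le_nhds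
    ((chartAt ℂ x).open_target.mem_nhds (mem_chart_target ℂ x))] with z hz ht h
  refine hz ?_
  rw [mem_singleton_iff, ← (chartAt ℂ x).right_inv ht]
  exact congrArg _ h

/-- Charts are modelled on ℂ, so there are no isolated points. This is what lets values be recovered
as limits and statements be made up to finite sets. -/
instance nhdsNE_neBot (x : C) : (𝓝[≠] x).NeBot :=
  (tendsto_chart_symm_ne x).neBot

/-- Properties near `x` can be checked in the chart at `x`. -/
theorem eventually_iff_inChart {x : C} {p : C → Prop} :
    (∀ᶠ y in 𝓝 x, p y) ↔ ∀ᶠ z in 𝓝 (chartAt ℂ x x), p ((chartAt ℂ x).symm z) := by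
  refine ⟨fun h => (tendsto_chart_symm x).eventually h, fun h => ?_⟩
  filter_upwards [(tendsto_chart x).eventually h, eventually_mem_source x] with y hy hs
  rwa [(chartAt ℂ x).left_inv hs] at hy

theorem eventually_ne_iff_inChart {x : C} {p : C → Prop} :
    (∀ᶠ y in 𝓝[≠] x, p y) ↔ ∀ᶠ z in 𝓝[≠] (chartAt ℂ x x), p ((chartAt ℂ x).symm z) := by
  refine ⟨fun h => (tendsto_chart_symm_ne x).eventually h, fun h => ?_⟩
  filter_upwards [(tendsto_chart_ne x).eventually h,
    nhdsWithin_le_nhds (eventually_mem_source x)] with y hy hs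
  rwa [(chartAt ℂ x).left_inv hs] at hy

namespace HolAt

variable {x : C} {g h : C → ℂ}

theorem congr (hg : HolAt g x) (e : g =ᶠ[𝓝 x] h) : HolAt h x :=
  AnalyticAt.congr hg (eventually_iff_inChart.1 e)

theorem const (c : ℂ) : HolAt (fun _ : C => c) x := analyticAt_const

theorem add (hg : HolAt g x) (hh : HolAt h x) : HolAt (fun y => g y + h y) x :=
  AnalyticAt.add hg hh

theorem sub (hg : HolAt g x) (hh : HolAt h x) : HolAt (fun y => g y - h y) x :=
  AnalyticAt.sub hg hh

theorem mul (hg : HolAt g x) (hh : HolAt h x) : HolAt (fun y => g y * h y) x :=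
  AnalyticAt.mul hg hh

theorem div (hg : HolAt g x) (hh : HolAt h x) (h0 : h x ≠ 0) : HolAt (fun y => g y / h y) x :=
  AnalyticAt.div hg hh (by simpa using h0)

theorem pow (hg : HolAt g x) (n : ℕ) : HolAt (fun y => g y ^ n) x := AnalyticAt.pow hg n

theorem sum {ι : Type*} (s : Finset ι) {G : ι → C → ℂ} (hG : ∀ i ∈ s, HolAt (G i) x) :
    HolAt (fun y => ∑ i ∈ s, G i y) x :=
  Finset.analyticAt_fun_sum s hG

theorem continuousAt (hg : HolAt g x) : ContinuousAt g x := by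
  have h1 : Tendsto (inChart x g) (𝓝 (chartAt ℂ x x)) (𝓝 (g x)) := by
    simpa using (AnalyticAt.continuousAt hg).tendsto
  refine (h1.comp (tendsto_chart x)).congr' ?_
  filter_upwards [eventually_mem_source x] with y hy
  exact inChart_apply_chart x g hy

theorem eval_polynomial (hg : HolAt g x) (p : Polynomial ℂ) : HolAt (fun y => p.eval (g y)) x := by
  simp only [Polynomial.eval_eq_sum_range]
  exact sum _ fun i _ => (const _).mul (hg.pow i)

end HolAt

namespace Mero

variable {g h : C → ℂ}

theorem const (c : ℂ) : Mero (fun _ : C => c) := fun _ => MeromorphicAt.const c _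

theorem sub (hg : Mero g) (hh : Mero h) : Mero (fun y => g y - h y) :=
  fun x => MeromorphicAt.sub (hg x) (hh x)

theorem mul (hg : Mero g) (hh : Mero h) : Mero (fun y => g y * h y) :=
  fun x => MeromorphicAt.mul (hg x) (hh x)

theorem pow (hg : Mero g) (n : ℕ) : Mero (fun y => g y ^ n) :=
  fun x => MeromorphicAt.pow (hg x) n

theorem sum {ι : Type*} (s : Finset ι) {G : ι → C → ℂ} (hG : ∀ i ∈ s, Mero (G i)) :
    Mero (fun y => ∑ i ∈ s, G i y) :=
  fun x => MeromorphicAt.fun_sum fun i hi => hG i hi x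

theorem eval_polynomial (hg : Mero g) (p : Polynomial ℂ) : Mero (fun y => p.eval (g y)) := by
  simp only [Polynomial.eval_eq_sum_range]
  exact sum _ fun i _ => (const _).mul (hg.pow i)

end Mero

theorem mero_div_of_local {g : C → ℂ}
    (H : ∀ x, ∃ a b : C → ℂ, HolAt a x ∧ HolAt b x ∧ ∀ᶠ y in 𝓝[≠] x, g y = a y / b y) :
    Mero g := by
  intro x
  obtain ⟨a, b, ha, hb, e⟩ := H x
  refine (MeromorphicAt.div (AnalyticAt.meromorphicAt ha) (AnalyticAt.meromorphicAt hb)).congr ?_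
  filter_upwards [eventually_ne_iff_inChart.1 e] with z hz
  exact hz.symm

/-- On a compact space a property which holds near each point, except possibly at the point, fails
at finitely many points only. -/
theorem finite_of_forall_nhdsNE {X : Type*} [TopologicalSpace X] [CompactSpace X] {p : X → Prop}
    (h : ∀ x, ∀ᶠ y in 𝓝[≠] x, p y) : {x | ¬ p x}.Finite := by
  have h' : ∀ x, {y | y ≠ x → p y} ∈ 𝓝 x := fun x => eventually_nhdsWithin_iff.1 (h x)
  obtain ⟨t, -, ht⟩ := isCompact_univ.elim_nhds_subcover _ fun x _ => h' x
  refine t.finite_toSet.subset fun y hy => ?_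
  obtain ⟨x, hx, hxy⟩ := mem_iUnion₂.1 (ht (mem_univ y))
  by_contra hne
  exact hy (hxy fun e => hne (e ▸ hx))

theorem eventually_nhdsNE_of_finite [T1Space C] {S : Set C} (hS : S.Finite) (x : C) :
    ∀ᶠ y in 𝓝[≠] x, y ∉ S := by
  have : (S \ {x})ᶜ ∈ 𝓝 x := (hS.subset sdiff_subset).isClosed.isOpen_compl.mem_nhds (by simp)
  filter_upwards [nhdsWithin_le_nhds this, self_mem_nhdsWithin] with y hy hne hS
  exact hy ⟨hS, hne⟩

theorem eventually_nhdsNE_nhds [T1Space C] {p : C → Prop} {x : C} (h : ∀ᶠ y in 𝓝[≠] x, p y) :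
    ∀ᶠ y in 𝓝[≠] x, ∀ᶠ w in 𝓝 y, p w := by
  filter_upwards [eventually_eventually_nhdsWithin.2 h, self_mem_nhdsWithin] with y hy hne
  rwa [isOpen_compl_singleton.nhdsWithin_eq hne] at hy

/-- The identity theorem. -/
theorem Mero.finite_or_finite [T1Space C] [CompactSpace C] [ConnectedSpace C] {g : C → ℂ}
    (hg : Mero g) : {x | g x = 0}.Finite ∨ {x | g x ≠ 0}.Finite := by
  set A : Set C := {x | ∀ᶠ y in 𝓝[≠] x, g y = 0}
  have alt : ∀ x, x ∈ A ∨ ∀ᶠ y in 𝓝[≠] x, g y ≠ 0 := fun x =>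
    ((hg x).eventually_eq_zero_or_eventually_ne_zero).imp
      (fun h => eventually_ne_iff_inChart.2 h) (fun h => eventually_ne_iff_inChart.2 h)
  -- A meromorphic function is a total function here, with arbitrary values at its poles. Membership
  -- in `A` therefore ignores the value at the point itself, and the two cases of the conclusion are
  -- stated up to finite sets.
  have hA : IsClopen A := by
    constructor
    · rw [← isOpen_compl_iff, isOpen_iff_mem_nhds]
      intro x hx
      have h := eventually_nhdsNE_nhds ((alt x).resolve_left hx)
      rw [eventually_nhdsWithin_iff] at h
      filter_upwards [h] with y hy hyA
      by_cases e : y = x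
      · exact hx (e ▸ hyA)
      · obtain ⟨w, hw1, hw2⟩ := ((hy e).filter_mono nhdsWithin_le_nhds |>.and hyA).exists
        exact hw1 hw2
    · rw [isOpen_iff_mem_nhds]
      intro x hx
      have h := eventually_nhdsNE_nhds hx
      rw [eventually_nhdsWithin_iff] at h
      filter_upwards [h] with y hy
      by_cases e : y = x
      · exact e ▸ hx
      · exact (hy e).filter_mono nhdsWithin_le_nhds
  rcases isClopen_iff.1 hA with h | h
  · left
    refine (finite_of_forall_nhdsNE (p := fun x => g x ≠ 0) fun x =>
      (alt x).resolve_left (by simp [h])).subset fun x hx => by simpa using hx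
  · right
    exact finite_of_forall_nhdsNE (p := fun x => g x = 0) fun x => by
      have : x ∈ A := by simp [h]
      exact this

theorem Mero.finite_ne_of_frequently [T1Space C] [CompactSpace C] [ConnectedSpace C] {g : C → ℂ}
    (hg : Mero g) {x : C} (h : ∃ᶠ y in 𝓝[≠] x, g y = 0) : {x | g x ≠ 0}.Finite := by
  refine hg.finite_or_finite.resolve_left fun hf => h ?_
  exact eventually_nhdsNE_of_finite hf x

theorem Mero.finite_eq_of_frequently [T1Space C] [CompactSpace C] [ConnectedSpace C] {g : C → ℂ}
    (hg : Mero g) {x : C} (h : ∃ᶠ y in 𝓝[≠] x, g y ≠ 0) : {x | g x = 0}.Finite := by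
  refine hg.finite_or_finite.resolve_right fun hf => h ?_
  exact eventually_nhdsNE_of_finite hf x

end Local

/-! ### Change of charts, and removable singularities on a compact surface. -/

section Manifold

variable {C : Type*} [TopologicalSpace C] [ChartedSpace ℂ C] [IsManifold 𝓘(ℂ) ω C]

theorem isManifold_one : IsManifold 𝓘(ℂ) 1 C := IsManifold.of_le (n := ω) le_top

/-- Complex differentiability on a neighbourhood is analyticity. This bridge makes holomorphy
independent of the chart and links the definitions in terms of `MDifferentiable` to power series. -/
theorem holAt_iff {g : C → ℂ} {x : C} :
    HolAt g x ↔ ∀ᶠ y in 𝓝 x, MDifferentiableAt 𝓘(ℂ) 𝓘(ℂ) g y := by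
  have : IsManifold 𝓘(ℂ) 1 C := isManifold_one
  constructor
  · intro h
    have h1 := Complex.analyticAt_iff_eventually_differentiableAt.1 h
    filter_upwards [(tendsto_chart x).eventually h1, eventually_mem_source x] with y hy hs
    have h2 : MDifferentiableAt 𝓘(ℂ) 𝓘(ℂ) (inChart x g ∘ chartAt ℂ x) y :=
      MDifferentiableAt.comp y hy.mdifferentiableAt
        (mdifferentiableAt_atlas (chart_mem_atlas ℂ x) hs)
    refine h2.congr_of_eventuallyEq ?_
    filter_upwards [(chartAt ℂ x).open_source.mem_nhds hs] with w hw
    exact (inChart_apply_chart x g hw).symm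
  · intro h
    refine Complex.analyticAt_iff_eventually_differentiableAt.2 ?_
    filter_upwards [(tendsto_chart_symm x).eventually h,
      (chartAt ℂ x).open_target.mem_nhds (mem_chart_target ℂ x)] with z hz ht
    exact mdifferentiableAt_iff_differentiableAt.1 (MDifferentiableAt.comp z hz
      (mdifferentiableAt_atlas_symm (chart_mem_atlas ℂ x) ht))

theorem HolAt.mdifferentiableAt {g : C → ℂ} {x : C} (h : HolAt g x) :
    MDifferentiableAt 𝓘(ℂ) 𝓘(ℂ) g x := (holAt_iff.1 h).self_of_nhds

theorem mdifferentiableAt_subtype_iff {E : Type*} [NormedAddCommGroup E] [NormedSpace ℂ E]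
    {U : Opens C} {g : C → E} {x : U} :
    MDifferentiableAt 𝓘(ℂ) 𝓘(ℂ, E) (fun y : U => g y) x ↔ MDifferentiableAt 𝓘(ℂ) 𝓘(ℂ, E) g x :=
  (differentiableWithinAt_localInvariantProp.liftPropAt_iff_comp_subtype_val _ _).symm

theorem mdifferentiable_subtype_iff {U : Opens C} {g : C → ℂ} :
    MDifferentiable 𝓘(ℂ) 𝓘(ℂ) (fun y : U => g y) ↔ ∀ x ∈ U, HolAt g x := by
  constructor
  · intro h x hx
    refine holAt_iff.2 ?_
    filter_upwards [U.isOpen.mem_nhds hx] with y hy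
    exact mdifferentiableAt_subtype_iff.1 (h ⟨y, hy⟩)
  · intro h x
    exact mdifferentiableAt_subtype_iff.2 (h x x.2).mdifferentiableAt

/-- The transition from the chart at `y` to the chart at `x`. -/
def transition (x y : C) : ℂ → ℂ := fun z => chartAt ℂ x ((chartAt ℂ y).symm z)

theorem analyticAt_transition {x y : C} (hy : y ∈ (chartAt ℂ x).source) :
    AnalyticAt ℂ (transition x y) (chartAt ℂ y y) := by
  have : IsManifold 𝓘(ℂ) 1 C := isManifold_one
  refine (holAt_iff (g := fun w => chartAt ℂ x w) (x := y)).2 ?_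
  filter_upwards [(chartAt ℂ x).open_source.mem_nhds hy] with w hw
  exact mdifferentiableAt_atlas (chart_mem_atlas ℂ x) hw

/-- The reverse transition is a differentiable left inverse, so the chain rule makes the product of
the two derivatives 1. -/
theorem deriv_transition_ne_zero {x y : C} (hy : y ∈ (chartAt ℂ x).source) :
    deriv (transition x y) (chartAt ℂ y y) ≠ 0 := by
  have : IsManifold 𝓘(ℂ) 1 C := isManifold_one
  intro h0
  have hx : chartAt ℂ x y ∈ (chartAt ℂ x).target := (chartAt ℂ x).map_source hy
  set σ : ℂ → ℂ := fun z => chartAt ℂ y ((chartAt ℂ x).symm z)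
  have hσ : DifferentiableAt ℂ σ (chartAt ℂ x y) := by
    refine mdifferentiableAt_iff_differentiableAt.1 ?_
    refine MDifferentiableAt.comp (I' := 𝓘(ℂ)) _ (mdifferentiableAt_atlas (chart_mem_atlas ℂ y) ?_)
      (mdifferentiableAt_atlas_symm (chart_mem_atlas ℂ x) hx)
    rw [(chartAt ℂ x).left_inv hy]
    exact mem_chart_source ℂ y
  have e : transition x y (chartAt ℂ y y) = chartAt ℂ x y := by
    simp [transition, (chartAt ℂ y).left_inv (mem_chart_source ℂ y)]
  have h1 : HasDerivAt (σ ∘ transition x y) (deriv σ (chartAt ℂ x y) * 0) (chartAt ℂ y y) := by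
    refine HasDerivAt.comp _ ?_ ?_
    · rw [e]; exact hσ.hasDerivAt
    · rw [← h0]; exact (analyticAt_transition hy).differentiableAt.hasDerivAt
  have h2 : HasDerivAt (σ ∘ transition x y) 1 (chartAt ℂ y y) := by
    refine (hasDerivAt_id _).congr_of_eventuallyEq ?_
    filter_upwards [(tendsto_chart_symm y).eventually ((chartAt ℂ x).open_source.mem_nhds hy),
      (chartAt ℂ y).open_target.mem_nhds (mem_chart_target ℂ y)] with z hz ht
    simp only [σ, transition, Function.comp, id]
    rw [(chartAt ℂ x).left_inv hz, (chartAt ℂ y).right_inv ht]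
  simpa using h2.unique h1

theorem inChart_eventuallyEq_comp_transition {E : Type*} (g : C → E) {x y : C}
    (hy : y ∈ (chartAt ℂ x).source) :
    inChart y g =ᶠ[𝓝 (chartAt ℂ y y)] inChart x g ∘ transition x y := by
  filter_upwards [(tendsto_chart_symm y).eventually ((chartAt ℂ x).open_source.mem_nhds hy)]
    with z hz
  simp [inChart, transition, (chartAt ℂ x).left_inv hz]

theorem transition_apply_self {x y : C} : transition x y (chartAt ℂ y y) = chartAt ℂ x y := by
  simp [transition, (chartAt ℂ y).left_inv (mem_chart_source ℂ y)]

/-- The derivatives of a function in two charts differ by the derivative of the transition. -/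
theorem deriv_inChart {g : C → ℂ} {x y : C} (hy : y ∈ (chartAt ℂ x).source)
    (hg : DifferentiableAt ℂ (inChart x g) (chartAt ℂ x y)) :
    deriv (inChart y g) (chartAt ℂ y y) =
      deriv (inChart x g) (chartAt ℂ x y) * deriv (transition x y) (chartAt ℂ y y) := by
  rw [(inChart_eventuallyEq_comp_transition g hy).deriv_eq]
  rw [← transition_apply_self (x := x) (y := y)] at hg ⊢
  exact deriv_comp _ hg (analyticAt_transition hy).differentiableAt

/-- A meromorphic function without poles on a compact surface is constant off a finite set. -/
theorem Mero.exists_eq_const [T1Space C] [CompactSpace C] [ConnectedSpace C] {D : C → ℂ}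
    (hD : Mero D) (hlim : ∀ x, ∃ c, Tendsto D (𝓝[≠] x) (𝓝 c)) : ∃ c, {x | D x ≠ c}.Finite := by
  have : IsManifold 𝓘(ℂ) 1 C := isManifold_one
  choose D' hD' using hlim
  have key : ∀ x, HolAt D' x ∧ ∀ᶠ y in 𝓝[≠] x, D y = D' y := by
    intro x
    -- Giving a meromorphic function its limit as value removes the singularity, so `q` is analytic
    -- at the point.
    set q : ℂ → ℂ := Function.update (inChart x D) (chartAt ℂ x x) (D' x)
    have hq : AnalyticAt ℂ q (chartAt ℂ x x) := by
      refine MeromorphicAt.analyticAt ((hD x).update _ _) ?_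
      exact continuousAt_update_same.2 ((hD' x).comp (tendsto_chart_symm_ne x))
    have hqD : ∀ᶠ y in 𝓝[≠] x, D y = q (chartAt ℂ x y) := by
      filter_upwards [(tendsto_chart_ne x).eventually self_mem_nhdsWithin,
        nhdsWithin_le_nhds (eventually_mem_source x)] with y hy hs
      rw [show q (chartAt ℂ x y) = _ from Function.update_of_ne hy _ _, inChart_apply_chart x D hs]
    have hcont : ∀ᶠ y in 𝓝 x, ContinuousAt (fun w => q (chartAt ℂ x w)) y := by
      filter_upwards [(tendsto_chart x).eventually hq.eventually_analyticAt,
        eventually_mem_source x] with y hy hs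
      exact ContinuousAt.comp (f := chartAt ℂ x) hy.continuousAt ((chartAt ℂ x).continuousAt hs)
    -- The limits `D'` are chosen point by point. Off `x` both sides are the limit of `D` at `y`, so
    -- they agree there as well.
    have hDq : ∀ᶠ y in 𝓝 x, D' y = q (chartAt ℂ x y) := by
      have h := eventually_nhdsNE_nhds hqD
      rw [eventually_nhdsWithin_iff] at h
      filter_upwards [h, hcont] with y hy hc
      by_cases e : y = x
      · simp [e, q]
      · refine tendsto_nhds_unique (hD' y) ((hc.tendsto.mono_left nhdsWithin_le_nhds).congr' ?_)
        filter_upwards [nhdsWithin_le_nhds (hy e)] with w hw using hw.symm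
    refine ⟨hq.congr ?_, ?_⟩
    · filter_upwards [eventually_iff_inChart.1 hDq,
        (chartAt ℂ x).open_target.mem_nhds (mem_chart_target ℂ x)] with z hz ht
      rw [inChart, hz, (chartAt ℂ x).right_inv ht]
    · filter_upwards [hqD, nhdsWithin_le_nhds hDq] with y h1 h2
      rw [h1, h2]
  obtain ⟨c, hc⟩ := MDifferentiable.exists_eq_const_of_compactSpace
    (I := 𝓘(ℂ)) (f := D') fun x => (key x).1.mdifferentiableAt
  refine ⟨c, finite_of_forall_nhdsNE (p := fun x => D x = c) fun x => ?_⟩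
  filter_upwards [(key x).2] with y hy
  rw [hy, hc]; rfl

end Manifold

end Planarity

end

noncomputable section

namespace Planarity

/-! ### Holomorphic maps to projective space in coordinates -/

section Lifts

variable {C : Type*} [TopologicalSpace C] [ChartedSpace ℂ C] {n : ℕ}

/-- A linear form in the `n + 1` homogeneous coordinates of `ℂPⁿ`. -/
abbrev LinForm (n : ℕ) : Type := (Fin (n + 1) → ℂ) →ₗ[ℂ] ℂ

/-- The quotient of two linear forms along a map to projective space. -/
def quot (a b : LinForm n) (φ : C → CP n) (y : C) : ℂ := a (φ y).rep / b (φ y).rep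

/-- `s` is a holomorphic lift of `φ` near `x` to homogeneous coordinates. -/
def IsLift (φ : C → CP n) (s : C → (Fin (n + 1) → ℂ)) (x : C) : Prop :=
  (∀ a : LinForm n, HolAt (fun y => a (s y)) x) ∧ ∀ᶠ y in 𝓝 x, ∃ c : ℂ, c ≠ 0 ∧
    (φ y).rep = c • s y

theorem exists_rep_eq_smul {φ : CP n} {v : Fin (n + 1) → ℂ} (hv : v ≠ 0)
    (h : φ = Projectivization.mk ℂ v hv) : ∃ c : ℂ, c ≠ 0 ∧ φ.rep = c • v := by
  obtain ⟨a, ha⟩ := Projectivization.exists_smul_eq_mk_rep ℂ v hv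
  exact ⟨a, a.ne_zero, by rw [h, ← ha]; rfl⟩

theorem eq_mk_of_rep_eq_smul {φ : CP n} {v : Fin (n + 1) → ℂ} (hv : v ≠ 0) {c : ℂ}
    (h : φ.rep = c • v) : φ = Projectivization.mk ℂ v hv := by
  rw [← φ.mk_rep]
  exact (Projectivization.mk_eq_mk_iff' ℂ _ _ _ _).2 ⟨c, h.symm⟩

namespace IsLift

variable {φ : C → CP n} {s : C → (Fin (n + 1) → ℂ)} {x : C}

theorem rep_eq (h : IsLift φ s x) : ∃ c : ℂ, c ≠ 0 ∧ (φ x).rep = c • s x := h.2.self_of_nhds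

theorem apply_ne_zero_iff (h : IsLift φ s x) (b : LinForm n) :
    ∀ᶠ y in 𝓝 x, (b (s y) ≠ 0 ↔ b (φ y).rep ≠ 0) := by
  filter_upwards [h.2] with y ⟨c, hc, e⟩
  simp [e, hc]

theorem quot_eq (h : IsLift φ s x) (a b : LinForm n) :
    ∀ᶠ y in 𝓝 x, quot a b φ y = a (s y) / b (s y) := by
  filter_upwards [h.2] with y ⟨c, hc, e⟩
  simp only [quot, e, map_smul, smul_eq_mul]
  rw [mul_div_mul_left _ _ hc]

theorem eventually_apply_ne_zero (h : IsLift φ s x) {b : LinForm n} (hb : b (φ x).rep ≠ 0) :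
    ∀ᶠ y in 𝓝 x, b (φ y).rep ≠ 0 ∧ b (s y) ≠ 0 := by
  have h1 : b (s x) ≠ 0 := (h.apply_ne_zero_iff b).self_of_nhds.2 hb
  filter_upwards [(h.1 b).continuousAt.eventually_ne h1, h.apply_ne_zero_iff b] with y h1 h2
  exact ⟨h2.1 h1, h1⟩

end IsLift

variable [IsManifold 𝓘(ℂ) ω C]

theorem IsHolomorphic.exists_isLift {φ : C → CP n} (hφ : IsHolomorphic φ) (x : C) :
    ∃ s, IsLift φ s x := by
  classical
  obtain ⟨U, hx, s, hs, hm⟩ := hφ x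
  refine ⟨fun y => if h : y ∈ U then s ⟨y, h⟩ else 0, fun a => ?_, ?_⟩
  · refine mdifferentiable_subtype_iff.1 ?_ x hx
    have : (fun y : U => a (if h : (y : C) ∈ U then s ⟨y, h⟩ else 0)) = fun y : U => a (s y) := by
      ext y; simp
    rw [this]
    have ha : MDifferentiable 𝓘(ℂ, Fin (n + 1) → ℂ) 𝓘(ℂ) a :=
      (LinearMap.toContinuousLinearMap a).differentiable.mdifferentiable
    exact ha.comp hs
  · filter_upwards [U.isOpen.mem_nhds hx] with y hy
    obtain ⟨h0, e⟩ := hm ⟨y, hy⟩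
    simpa [show y ∈ U from hy] using exists_rep_eq_smul h0 e

theorem IsHolomorphic.mero_quot {φ : C → CP n} (hφ : IsHolomorphic φ) (a b : LinForm n) :
    Mero (quot a b φ) := by
  refine mero_div_of_local fun x => ?_
  obtain ⟨s, hs⟩ := hφ.exists_isLift x
  exact ⟨_, _, hs.1 a, hs.1 b, nhdsWithin_le_nhds (hs.quot_eq a b)⟩

theorem IsHolomorphic.holAt_quot {φ : C → CP n} (hφ : IsHolomorphic φ) (a : LinForm n)
    {b : LinForm n} {x : C} (hb : b (φ x).rep ≠ 0) : HolAt (quot a b φ) x := by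
  obtain ⟨s, hs⟩ := hφ.exists_isLift x
  refine ((hs.1 a).div (hs.1 b) (hs.eventually_apply_ne_zero hb).self_of_nhds.2).congr ?_
  filter_upwards [hs.quot_eq a b] with y hy using hy.symm

theorem IsHolomorphic.isOpen_ne {φ : C → CP n} (hφ : IsHolomorphic φ) (b : LinForm n) :
    IsOpen {x | b (φ x).rep ≠ 0} := by
  rw [isOpen_iff_mem_nhds]
  intro x hx
  obtain ⟨s, hs⟩ := hφ.exists_isLift x
  filter_upwards [hs.eventually_apply_ne_zero hx] with y hy using hy.1

theorem HolAt.eq_zero_of_eventually {g : C → ℂ} {x : C} (hg : HolAt g x)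
    (h : ∀ᶠ y in 𝓝[≠] x, g y = 0) : g x = 0 :=
  tendsto_nhds_unique (hg.continuousAt.tendsto.mono_left nhdsWithin_le_nhds)
    (tendsto_const_nhds.congr' (h.mono fun _ hy => hy.symm))

theorem HolAt.mvPolynomial_eval {s : C → (Fin (n + 1) → ℂ)} {x : C}
    (hs : ∀ a : LinForm n, HolAt (fun y => a (s y)) x) (F : MvPolynomial (Fin (n + 1)) ℂ) :
    HolAt (fun y => MvPolynomial.eval (s y) F) x := by
  induction F using MvPolynomial.induction_on with
  | C a => simpa using HolAt.const a
  | add p q hp hq => simpa using hp.add hq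
  | mul_X p i hp => simpa using hp.mul (hs (LinearMap.proj i))

theorem eval_smul_of_isHomogeneous {σ : Type*} {F : MvPolynomial σ ℂ} {m : ℕ}
    (hF : F.IsHomogeneous m) (c : ℂ) (v : σ → ℂ) :
    MvPolynomial.eval (c • v) F = c ^ m * MvPolynomial.eval v F := by
  rw [MvPolynomial.eval_eq, MvPolynomial.eval_eq, Finset.mul_sum]
  refine Finset.sum_congr rfl fun d hd => ?_
  have h : ∑ i ∈ d.support, d i = m := by
    rw [← hF.degree_eq_sum_deg_support hd]
  simp only [Pi.smul_apply, smul_eq_mul, mul_pow, Finset.prod_mul_distrib,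
    Finset.prod_pow_eq_pow_sum, h]
  ring

/-- A form which vanishes along `φ` off a finite set vanishes along `φ`. -/
theorem IsHolomorphic.eval_eq_zero [T1Space C] {φ : C → CP n} (hφ : IsHolomorphic φ) {m : ℕ}
    {F : MvPolynomial (Fin (n + 1)) ℂ} (hF : F.IsHomogeneous m)
    (h : {x | MvPolynomial.eval (φ x).rep F ≠ 0}.Finite) (x : C) :
    MvPolynomial.eval (φ x).rep F = 0 := by
  obtain ⟨s, hs⟩ := hφ.exists_isLift x
  have h1 : MvPolynomial.eval (s x) F = 0 := by
    refine (HolAt.mvPolynomial_eval hs.1 F).eq_zero_of_eventually ?_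
    filter_upwards [eventually_nhdsNE_of_finite h x, nhdsWithin_le_nhds hs.2] with y hy ⟨c, hc, e⟩
    simpa [e, eval_smul_of_isHomogeneous hF, hc] using hy
  obtain ⟨c, hc, e⟩ := hs.rep_eq
  rw [e, eval_smul_of_isHomogeneous hF, h1, mul_zero]

/-- A linear form vanishes along `φ` either identically or at finitely many points. -/
theorem IsHolomorphic.finite_or_forall [T1Space C] [CompactSpace C] [ConnectedSpace C]
    {φ : C → CP n} (hφ : IsHolomorphic φ) (b : LinForm n) :
    {x | b (φ x).rep = 0}.Finite ∨ ∀ x, b (φ x).rep = 0 := by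
  -- As 0 / 0 = 0, the quotient of `b` by itself is the indicator of `b ≠ 0`. The identity theorem
  -- for this one function gives the alternative.
  rcases (hφ.mero_quot b b).finite_or_finite with h | h
  · left
    exact h.subset fun x hx => by simp only [mem_ofPred_eq] at hx; simp [quot, hx]
  · right
    intro x
    by_contra hx
    have h1 : ∀ᶠ y in 𝓝[≠] x, b (φ y).rep ≠ 0 :=
      nhdsWithin_le_nhds ((hφ.isOpen_ne b).mem_nhds hx)
    obtain ⟨y, hy1, hy2⟩ := (h1.and (eventually_nhdsNE_of_finite h x)).exists
    exact hy2 (by simp [quot, hy1])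

end Lifts

/-! ### Linear forms in two variables -/

section Binary

/-- The linear form vanishing at `a`. -/
def vanForm (a : CP 1) : LinForm 1 :=
  a.rep 0 • LinearMap.proj 1 - a.rep 1 • LinearMap.proj 0

/-- The linear form `⟨a, ·⟩`, vanishing at the point orthogonal to `a`. -/
def innerForm (a : CP 1) : LinForm 1 :=
  star (a.rep 0) • LinearMap.proj 0 + star (a.rep 1) • LinearMap.proj 1

/-- Two linear forms in two variables without common zero. -/
def NoCommonZero (l₁ l₂ : LinForm 1) : Prop := ∀ w, l₁ w = 0 → l₂ w = 0 → w = 0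

theorem vanForm_apply (a : CP 1) (w : Fin 2 → ℂ) :
    vanForm a w = a.rep 0 * w 1 - a.rep 1 * w 0 := rfl

theorem innerForm_apply (a : CP 1) (w : Fin 2 → ℂ) :
    innerForm a w = star (a.rep 0) * w 0 + star (a.rep 1) * w 1 := rfl

theorem linForm_apply (l : LinForm 1) (w : Fin 2 → ℂ) :
    l w = l ![1, 0] * w 0 + l ![0, 1] * w 1 := by
  have : w = w 0 • ![1, 0] + w 1 • ![0, 1] := by ext i; fin_cases i <;> simp
  conv_lhs => rw [this, map_add, map_smul, map_smul, smul_eq_mul, smul_eq_mul]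
  ring

@[simp] theorem vanForm_self (a : CP 1) : vanForm a a.rep = 0 := by
  rw [vanForm_apply]; ring

theorem innerForm_self_ne_zero (a : CP 1) : innerForm a a.rep ≠ 0 := by
  rw [innerForm_apply]
  intro h
  have h0 : a.rep 0 = 0 ∧ a.rep 1 = 0 := by
    have h1 : (‖a.rep 0‖ ^ 2 + ‖a.rep 1‖ ^ 2 : ℝ) = 0 := by
      have : ((‖a.rep 0‖ ^ 2 + ‖a.rep 1‖ ^ 2 : ℝ) : ℂ) = 0 := by
        rw [← h]; push_cast
        rw [← Complex.conj_mul', ← Complex.conj_mul']; rfl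
      exact_mod_cast this
    have := sq_nonneg ‖a.rep 0‖
    have := sq_nonneg ‖a.rep 1‖
    constructor
    · exact norm_eq_zero.1 (pow_eq_zero_iff two_ne_zero |>.1 (by linarith))
    · exact norm_eq_zero.1 (pow_eq_zero_iff two_ne_zero |>.1 (by linarith))
  exact a.rep_nonzero (by ext i; fin_cases i <;> simp [h0])

theorem rep_zero_or_one (a : CP 1) : a.rep 0 ≠ 0 ∨ a.rep 1 ≠ 0 := by
  by_contra! h
  exact a.rep_nonzero (by ext i; fin_cases i <;> simp [h])

theorem vanForm_ne_zero (a : CP 1) : vanForm a ≠ 0 := by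
  intro h
  have h0 : vanForm a ![1, 0] = 0 := by rw [h]; rfl
  have h1 : vanForm a ![0, 1] = 0 := by rw [h]; rfl
  simp only [vanForm_apply] at h0 h1
  rcases rep_zero_or_one a with h | h
  · exact h (by simpa using h1)
  · exact h (by simpa using h0)

/-- A linear form which vanishes at `a` is a multiple of `vanForm a`. -/
theorem exists_eq_smul_vanForm {l : LinForm 1} {a : CP 1} (h : l a.rep = 0) :
    ∃ c : ℂ, l = c • vanForm a := by
  rw [linForm_apply] at h
  rcases rep_zero_or_one a with h0 | h0
  · refine ⟨l ![0, 1] / a.rep 0, LinearMap.ext fun w => ?_⟩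
    rw [linForm_apply l w, LinearMap.smul_apply, vanForm_apply, smul_eq_mul]
    field_simp
    linear_combination w 0 * h
  · refine ⟨-l ![1, 0] / a.rep 1, LinearMap.ext fun w => ?_⟩
    rw [linForm_apply l w, LinearMap.smul_apply, vanForm_apply, smul_eq_mul]
    field_simp
    linear_combination w 1 * h

theorem eq_of_vanForm_eq_zero {a b : CP 1} (h : vanForm a b.rep = 0) : b = a := by
  rw [vanForm_apply] at h
  rw [← a.mk_rep]
  rcases rep_zero_or_one a with h0 | h0
  · refine eq_mk_of_rep_eq_smul _ (c := b.rep 0 / a.rep 0) ?_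
    ext i; fin_cases i
    · simp [h0]
    · simp; field_simp; linear_combination h
  · refine eq_mk_of_rep_eq_smul _ (c := b.rep 1 / a.rep 1) ?_
    ext i; fin_cases i
    · simp; field_simp; linear_combination -h
    · simp [h0]

theorem eq_of_linForm_eq_zero {l : LinForm 1} (hl : l ≠ 0) {a b : CP 1} (ha : l a.rep = 0)
    (hb : l b.rep = 0) : b = a := by
  obtain ⟨c, rfl⟩ := exists_eq_smul_vanForm ha
  have hc : c ≠ 0 := by rintro rfl; simp at hl
  exact eq_of_vanForm_eq_zero (by simpa [hc] using hb)

theorem noCommonZero_iff {l₁ l₂ : LinForm 1} : NoCommonZero l₁ l₂ ↔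
    ∀ a : CP 1, l₁ a.rep = 0 → l₂ a.rep ≠ 0 := by
  constructor
  · intro h a h1 h2
    exact a.rep_nonzero (h _ h1 h2)
  · intro h w h1 h2
    by_contra hw
    obtain ⟨c, hc, e⟩ := exists_rep_eq_smul hw rfl
    refine h (Projectivization.mk ℂ w hw) ?_ ?_ <;> rw [e, map_smul] <;> simp [h1, h2]

theorem noCommonZero_vanForm_innerForm (a : CP 1) : NoCommonZero (vanForm a) (innerForm a) := by
  rw [noCommonZero_iff]
  intro b h1
  rw [eq_of_vanForm_eq_zero h1]
  exact innerForm_self_ne_zero a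

theorem NoCommonZero.symm {l₁ l₂ : LinForm 1} (h : NoCommonZero l₁ l₂) : NoCommonZero l₂ l₁ :=
  fun w h1 h2 => h w h2 h1

/-- If `l₁` were a multiple of `l₂`, the vector (-l₂(0,1), l₂(1,0)), on which `l₂` vanishes, would
be a common zero. It is then 0, so `l₂` also kills (1,0), which becomes a non-zero common zero. -/
theorem NoCommonZero.sub_smul_ne_zero {l₁ l₂ : LinForm 1} (h : NoCommonZero l₁ l₂) (b : ℂ) :
    l₁ - b • l₂ ≠ 0 := by
  intro e
  have h1 : ∀ w, l₁ w = b * l₂ w := fun w => by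
    have := LinearMap.congr_fun e w
    simpa [sub_eq_zero] using this
  have h2 : ![-(l₂ ![0, 1]), l₂ ![1, 0]] = (0 : Fin 2 → ℂ) := by
    have h3 : l₂ ![-(l₂ ![0, 1]), l₂ ![1, 0]] = 0 := by
      rw [linForm_apply]; simp; ring
    exact h _ (by rw [h1, h3, mul_zero]) h3
  have h4 : l₂ ![1, 0] = 0 := by simpa using congrFun h2 1
  have h3 := h ![1, 0] (by rw [h1, h4, mul_zero]) h4
  simpa using congrFun h3 0

end Binary

end Planarity

end

noncomputable section

namespace Planarity

/-! ### Local behaviour of holomorphic functions of one variable -/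

section Plane

/-- The inverse function theorem in the class `ω`, which makes the local inverse analytic. -/
theorem exists_localHomeo {w : ℂ → ℂ} {z₀ : ℂ} (hw : AnalyticAt ℂ w z₀) (h : deriv w z₀ ≠ 0) :
    ∃ e : OpenPartialHomeomorph ℂ ℂ, (∀ z, e z = w z) ∧ z₀ ∈ e.source ∧
      AnalyticAt ℂ e.symm (w z₀) := by
  have h1 : ContDiffAt ℂ ω w z₀ := hw.contDiffAt
  have h2 : HasFDerivAt w
      ((ContinuousLinearEquiv.unitsEquivAut ℂ (Units.mk0 _ h) : ℂ ≃L[ℂ] ℂ) : ℂ →L[ℂ] ℂ) z₀ :=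
    hw.differentiableAt.hasDerivAt.hasFDerivAt_equiv h
  refine ⟨h1.toOpenPartialHomeomorph w h2 (by simp), fun z => rfl,
    h1.mem_toOpenPartialHomeomorph_source h2 (by simp), ?_⟩
  exact (h1.to_localInverse h2 (by simp)).analyticAt

/-- A holomorphic function with a zero of order `k` is the `k`-th power of a local coordinate. -/
theorem exists_eq_pow {g : ℂ → ℂ} {z₀ : ℂ} {k : ℕ} (hk : k ≠ 0) (hg : AnalyticAt ℂ g z₀)
    (ho : analyticOrderAt g z₀ = k) :
    ∃ w : ℂ → ℂ, AnalyticAt ℂ w z₀ ∧ w z₀ = 0 ∧ deriv w z₀ ≠ 0 ∧ ∀ᶠ z in 𝓝 z₀, g z = w z ^ k := by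
  obtain ⟨u, hu, hu0, e⟩ := hg.analyticOrderAt_eq_natCast.1 ho
  set c := u z₀
  -- A k-th root of the unit `u`. Dividing by `c` moves the base to 1 at `z₀`, inside the slit plane
  -- where the principal power is analytic.
  set r : ℂ → ℂ := fun z => c ^ (k : ℂ)⁻¹ * (u z / c) ^ (k : ℂ)⁻¹
  have hr : AnalyticAt ℂ r z₀ := by
    refine analyticAt_const.mul (AnalyticAt.cpow (hu.div analyticAt_const hu0) analyticAt_const ?_)
    simp [c, div_self hu0]
  have hr0 : r z₀ ≠ 0 := by
    have : r z₀ = c ^ (k : ℂ)⁻¹ := by simp [r, c, div_self hu0]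
    rw [this]
    intro h
    have := Complex.cpow_nat_inv_pow c hk
    rw [h, zero_pow hk] at this
    exact hu0 this.symm
  refine ⟨fun z => (z - z₀) * r z, (analyticAt_id.sub analyticAt_const).mul hr, by simp, ?_, ?_⟩
  · have h1 : HasDerivAt (fun z => (z - z₀) * r z) (1 * r z₀ + (z₀ - z₀) * deriv r z₀) z₀ :=
      ((hasDerivAt_id z₀).sub_const z₀).mul hr.differentiableAt.hasDerivAt
    rw [h1.deriv]
    simpa using hr0
  · filter_upwards [e] with z hz
    simp only [hz, r, mul_pow, Complex.cpow_nat_inv_pow _ hk, smul_eq_mul]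
    rw [mul_div_cancel₀ _ hu0]

theorem ncard_pow_eq {k : ℕ} (hk : k ≠ 0) {b : ℂ} (hb : b ≠ 0) : {z : ℂ | z ^ k = b}.ncard = k := by
  classical
  have h := Complex.isPrimitiveRoot_exp k hk
  have hc := h.card_nthRoots b
  rw [if_pos ⟨b ^ (k : ℂ)⁻¹, Complex.cpow_nat_inv_pow b hk⟩] at hc
  have hs : {z : ℂ | z ^ k = b} = ((Polynomial.nthRoots k b).toFinset : Set ℂ) := by
    ext z
    simp [Polynomial.mem_nthRoots (Nat.pos_of_ne_zero hk)]
  rw [hs, Set.ncard_coe_finset, Multiset.toFinset_card_of_nodup (h.nthRoots_nodup hb), hc]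

/-- Near a zero of order `k` a holomorphic function takes each small non-zero value `k` times. -/
theorem exists_open_ncard {g : ℂ → ℂ} {z₀ : ℂ} {k : ℕ} (hk : k ≠ 0) (hg : AnalyticAt ℂ g z₀)
    (ho : analyticOrderAt g z₀ = k) {N : Set ℂ} (hN : N ∈ 𝓝 z₀) :
    ∃ N' ⊆ N, IsOpen N' ∧ z₀ ∈ N' ∧ ∀ᶠ b in 𝓝[≠] (0 : ℂ), {z | z ∈ N' ∧ g z = b}.ncard = k := by
  obtain ⟨w, hw, hw0, hw', e⟩ := exists_eq_pow hk hg ho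
  obtain ⟨h, hh, hz, -⟩ := exists_localHomeo hw hw'
  have hh0 : h z₀ = 0 := by rw [hh, hw0]
  have h0t : (0 : ℂ) ∈ h.target := hh0 ▸ h.map_source hz
  have hs0 : h.symm 0 = z₀ := by rw [← hh0, h.left_inv hz]
  have hev : ∀ᶠ ζ in 𝓝 (0 : ℂ), ζ ∈ h.target ∧ h.symm ζ ∈ N ∧ g (h.symm ζ) = w (h.symm ζ) ^ k := by
    have h1 : Tendsto h.symm (𝓝 0) (𝓝 z₀) := by
      have := (h.continuousAt_symm h0t).tendsto
      rwa [hs0] at this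
    have h2 : ∀ᶠ ζ in 𝓝 (0 : ℂ), ζ ∈ h.target := h.open_target.mem_nhds h0t
    exact h2.and ((h1.eventually hN).and (h1.eventually e))
  obtain ⟨r, hr, hball⟩ := Metric.eventually_nhds_iff_ball.1 hev
  refine ⟨h.source ∩ h ⁻¹' Metric.ball 0 r, ?_, h.isOpen_inter_preimage Metric.isOpen_ball,
    ⟨hz, by simp [hh0, hr]⟩, ?_⟩
  · rintro z ⟨hzs, hzb⟩
    have := (hball _ hzb).2.1
    rwa [h.left_inv hzs] at this
  · have hsmall : ∀ᶠ b in 𝓝[≠] (0 : ℂ), b ∈ Metric.ball (0 : ℂ) (r ^ k) :=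
      nhdsWithin_le_nhds (Metric.ball_mem_nhds _ (by positivity))
    filter_upwards [hsmall, self_mem_nhdsWithin] with b hb hb0
    have himg : {z | z ∈ h.source ∩ h ⁻¹' Metric.ball 0 r ∧ g z = b} =
        h.symm '' {ζ | ζ ^ k = b} := by
      ext z
      constructor
      · rintro ⟨⟨hzs, hzb⟩, hgz⟩
        refine ⟨h z, ?_, h.left_inv hzs⟩
        have := (hball _ hzb).2.2
        rw [h.left_inv hzs, hgz] at this
        rw [mem_ofPred_eq, hh, this]
      · rintro ⟨ζ, hζ, rfl⟩
        have hζb : ζ ∈ Metric.ball (0 : ℂ) r := by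
          rw [mem_ball_zero_iff] at hb ⊢
          rw [← show ζ ^ k = b from hζ, norm_pow] at hb
          exact lt_of_pow_lt_pow_left₀ k hr.le hb
        obtain ⟨h1, h2, h3⟩ := hball ζ hζb
        refine ⟨⟨h.map_target h1, ?_⟩, ?_⟩
        · rw [mem_preimage, h.right_inv h1]; exact hζb
        · rw [h3, ← hh, h.right_inv h1]; exact hζ
    rw [himg, InjOn.ncard_image, ncard_pow_eq hk hb0]
    intro ζ hζ ξ hξ heq
    have hT : ∀ ζ : ℂ, ζ ^ k = b → ζ ∈ h.target := fun ζ hζ => by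
      refine (hball ζ ?_).1
      rw [mem_ball_zero_iff] at hb ⊢
      rw [← hζ, norm_pow] at hb
      exact lt_of_pow_lt_pow_left₀ k hr.le hb
    exact h.symm.injOn (hT ζ hζ) (hT ξ hξ) heq

end Plane

/-! ### The same on a Riemann surface -/

section Surface

variable {C : Type*} [TopologicalSpace C] [ChartedSpace ℂ C]

/-- The order of vanishing of `g` at `x`. -/
def ordAt (g : C → ℂ) (x : C) : ℕ∞ := analyticOrderAt (inChart x g) (chartAt ℂ x x)

/-- The derivative of `g` at `x` with respect to the preferred chart at `x`. -/
def derivAt (g : C → ℂ) (x : C) : ℂ := deriv (inChart x g) (chartAt ℂ x x)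

theorem ordAt_congr {g h : C → ℂ} {x : C} (e : g =ᶠ[𝓝 x] h) : ordAt g x = ordAt h x :=
  analyticOrderAt_congr (eventually_iff_inChart.1 e)

theorem ordAt_mul {g h : C → ℂ} {x : C} (hg : HolAt g x) (hh : HolAt h x) :
    ordAt (fun y => g y * h y) x = ordAt g x + ordAt h x :=
  analyticOrderAt_mul hg hh

theorem ordAt_eq_zero {g : C → ℂ} {x : C} (hg : HolAt g x) : ordAt g x = 0 ↔ g x ≠ 0 := by
  rw [ordAt, AnalyticAt.analyticOrderAt_eq_zero hg, inChart_apply_self]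

theorem ordAt_eq_top {g : C → ℂ} {x : C} : ordAt g x = ⊤ ↔ ∀ᶠ y in 𝓝 x, g y = 0 := by
  rw [ordAt, analyticOrderAt_eq_top, eventually_iff_inChart (x := x)]; rfl

/-- In characteristic zero differentiation lowers the order of a zero by exactly one. In `ℕ∞` this
includes a locally constant `g`, where both orders are infinite. -/
theorem ordAt_sub {g : C → ℂ} {x : C} (hg : HolAt g x) :
    ordAt (fun y => g y - g x) x =
      analyticOrderAt (deriv (inChart x g)) (chartAt ℂ x x) + 1 := by
  have := AnalyticAt.analyticOrderAt_deriv_add_one hg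
  rw [this, ordAt]
  simp only [inChart_apply_self]
  rfl

theorem ordAt_sub_eq_one {g : C → ℂ} {x : C} (hg : HolAt g x) :
    ordAt (fun y => g y - g x) x = 1 ↔ derivAt g x ≠ 0 := by
  rw [ordAt_sub hg, derivAt, ← AnalyticAt.analyticOrderAt_eq_zero (AnalyticAt.deriv hg)]
  cases analyticOrderAt (deriv (inChart x g)) (chartAt ℂ x x) with
  | top => simp
  | coe n => norm_cast; omega

theorem HolAt.exists_open_ncard {φ : C → ℂ} {x : C} {k : ℕ} (hk : k ≠ 0) (hφ : HolAt φ x)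
    (ho : ordAt (fun y => φ y - φ x) x = k) {N : Set C} (hN : N ∈ 𝓝 x) :
    ∃ N' ⊆ N, IsOpen N' ∧ x ∈ N' ∧
      ∀ᶠ b in 𝓝[≠] (φ x), {y | y ∈ N' ∧ φ y = b}.ncard = k := by
  have hN' : (chartAt ℂ x).target ∩ (chartAt ℂ x).symm ⁻¹' N ∈ 𝓝 (chartAt ℂ x x) :=
    inter_mem ((chartAt ℂ x).open_target.mem_nhds (mem_chart_target ℂ x)) (tendsto_chart_symm x hN)
  obtain ⟨M, hMN, hMo, hxM, hM⟩ := Planarity.exists_open_ncard hk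
    (hφ.sub (HolAt.const (φ x))) ho hN'
  refine ⟨(chartAt ℂ x).source ∩ chartAt ℂ x ⁻¹' M, ?_, (chartAt ℂ x).isOpen_inter_preimage hMo,
    ⟨mem_chart_source ℂ x, hxM⟩, ?_⟩
  · rintro y ⟨hy, hyM⟩
    have := (hMN hyM).2
    rwa [mem_preimage, (chartAt ℂ x).left_inv hy] at this
  · have ht : Tendsto (fun b => b - φ x) (𝓝[≠] (φ x)) (𝓝[≠] 0) := by
      refine tendsto_nhdsWithin_iff.2 ⟨?_, ?_⟩
      · have : Tendsto (fun b => b - φ x) (𝓝 (φ x)) (𝓝 (φ x - φ x)) :=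
          (continuous_id.sub continuous_const).tendsto _
        rw [sub_self] at this
        exact this.mono_left nhdsWithin_le_nhds
      · filter_upwards [self_mem_nhdsWithin] with b hb
        simpa [sub_eq_zero] using hb
    filter_upwards [ht.eventually hM] with b hb
    rw [← hb]
    have : {y | y ∈ (chartAt ℂ x).source ∩ chartAt ℂ x ⁻¹' M ∧ φ y = b} = (chartAt ℂ x).symm ''
        {z | z ∈ M ∧ inChart x (fun y => φ y - φ x) z = b - φ x} := by
      ext y
      constructor
      · rintro ⟨⟨hy, hyM⟩, e⟩
        exact ⟨chartAt ℂ x y, ⟨hyM, by rw [inChart_apply_chart x _ hy, e]⟩,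
          (chartAt ℂ x).left_inv hy⟩
      · rintro ⟨z, ⟨hz, e⟩, rfl⟩
        have hzt := (hMN hz).1
        refine ⟨⟨(chartAt ℂ x).map_target hzt, ?_⟩, by simpa [inChart] using e⟩
        rw [mem_preimage, (chartAt ℂ x).right_inv hzt]; exact hz
    rw [this, InjOn.ncard_image]
    exact (chartAt ℂ x).symm.injOn.mono fun z hz => (hMN hz.1).1

/-- Local inverse of a holomorphic function with non-zero derivative. -/
theorem HolAt.exists_local_inverse {φ : C → ℂ} {x : C} (hφ : HolAt φ x) (hd : derivAt φ x ≠ 0)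
    {N : Set C} (hN : N ∈ 𝓝 x) :
    ∃ N' ⊆ N, IsOpen N' ∧ x ∈ N' ∧ ∃ γ : ℂ → C, γ (φ x) = x ∧
      (∀ᶠ b in 𝓝 (φ x), γ b ∈ N' ∧ ∀ y ∈ N', φ y = b ↔ y = γ b) ∧
      ∀ h : C → ℂ, HolAt h x → AnalyticAt ℂ (fun b => h (γ b)) (φ x) := by
  obtain ⟨e, he, hxe, hea⟩ := exists_localHomeo hφ hd
  rw [inChart_apply_self] at hea
  have hex : e (chartAt ℂ x x) = φ x := by rw [he, inChart_apply_self]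
  have hsx : e.symm (φ x) = chartAt ℂ x x := by rw [← hex, e.left_inv hxe]
  have hN' : e.source ∩ ((chartAt ℂ x).target ∩ (chartAt ℂ x).symm ⁻¹' N) ∈ 𝓝 (chartAt ℂ x x) :=
    inter_mem (e.open_source.mem_nhds hxe)
    (inter_mem ((chartAt ℂ x).open_target.mem_nhds (mem_chart_target ℂ x)) (tendsto_chart_symm x hN))
  obtain ⟨M, hMN, hMo, hxM⟩ := mem_nhds_iff.1 hN'
  refine ⟨(chartAt ℂ x).source ∩ chartAt ℂ x ⁻¹' M, ?_, (chartAt ℂ x).isOpen_inter_preimage hMo,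
    ⟨mem_chart_source ℂ x, hxM⟩, fun b => (chartAt ℂ x).symm (e.symm b), ?_, ?_, ?_⟩
  · rintro y ⟨hy, hyM⟩
    have := (hMN hyM).2.2
    rwa [mem_preimage, (chartAt ℂ x).left_inv hy] at this
  · simp [hsx]
  · have h1 : ∀ᶠ b in 𝓝 (φ x), e.symm b ∈ M :=
      hea.continuousAt.eventually_mem (by rw [hsx]; exact hMo.mem_nhds hxM)
    have h2 : ∀ᶠ b in 𝓝 (φ x), b ∈ e.target :=
      e.open_target.mem_nhds (hex ▸ e.map_source hxe)
    filter_upwards [h1, h2] with b hb hbt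
    have hbt' := (hMN hb).2.1
    refine ⟨⟨(chartAt ℂ x).map_target hbt', ?_⟩, ?_⟩
    · rw [mem_preimage, (chartAt ℂ x).right_inv hbt']; exact hb
    · rintro y ⟨hy, hyM⟩
      have hφy : e (chartAt ℂ x y) = φ y := by rw [he, inChart_apply_chart x _ hy]
      constructor
      · rintro rfl
        rw [← hφy, e.left_inv (hMN hyM).1, (chartAt ℂ x).left_inv hy]
      · intro h
        rw [← hφy, h, (chartAt ℂ x).right_inv hbt', e.right_inv hbt]
  · intro h hh
    refine AnalyticAt.fun_comp (f := e.symm) (g := inChart x h) ?_ hea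
    rw [hsx]; exact hh

end Surface

end Planarity

end

noncomputable section

namespace Planarity

/-! ### Multiplicities in arbitrary coordinates -/

section Mult

variable {C : Type*} [TopologicalSpace C] [ChartedSpace ℂ C] {f : C → CP 1}

/-- `f` does not take its values in a point of `ℂP¹`. -/
def Nonconstant (f : C → CP 1) : Prop := ∀ l : LinForm 1, l ≠ 0 → ∃ x, l (f x).rep ≠ 0

/-- `affineCoord (f x)` is by definition the quotient of `vanForm (f x)` by `innerForm (f x)`, so
multiplicities can be computed with quotients of linear forms. -/
theorem mult_eq_toNat_ordAt (f : C → CP 1) (x : C) :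
    mult f x = (ordAt (quot (vanForm (f x)) (innerForm (f x)) f) x).toNat := rfl

/-- For constant `f` every order of vanishing is ⊤, whose `toNat` is 0, so all terms of the degree
are 0. -/
theorem nonconstant_of_degree_ne_zero (h : degree f ≠ 0) : Nonconstant f := by
  intro l hl
  by_contra! h0
  refine h (finsum_mem_eq_zero_of_forall_eq_zero fun x _ => ?_)
  have : ordAt (quot (vanForm (f x)) (innerForm (f x)) f) x = ⊤ := by
    refine ordAt_eq_top.2 (Eventually.of_forall fun y => ?_)
    have : f y = f x := eq_of_linForm_eq_zero hl (h0 x) (h0 y)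
    rw [quot, this, vanForm_self, zero_div]
  rw [mult_eq_toNat_ordAt, this]; rfl

/-- The set of points where `l₁ / l₂` takes the value `b`. -/
def fib (l₁ l₂ : LinForm 1) (f : C → CP 1) (b : ℂ) : Set C :=
  {x | l₁ (f x).rep = b * l₂ (f x).rep}

theorem NoCommonZero.ne_zero_of_mem_fib {l₁ l₂ : LinForm 1} (h : NoCommonZero l₁ l₂) {b : ℂ} {x : C}
    (hx : x ∈ fib l₁ l₂ f b) : l₂ (f x).rep ≠ 0 := by
  intro h2
  have h1 : l₁ (f x).rep = b * l₂ (f x).rep := hx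
  exact (f x).rep_nonzero (h _ (by rw [h1, h2, mul_zero]) h2)

theorem mem_fib_iff {l₁ l₂ : LinForm 1} {b : ℂ} {x : C} (hx : l₂ (f x).rep ≠ 0) :
    x ∈ fib l₁ l₂ f b ↔ quot l₁ l₂ f x = b := by
  rw [quot, div_eq_iff hx]; rfl

theorem exists_linForm_eq_zero (l : LinForm 1) : ∃ a : CP 1, l a.rep = 0 := by
  by_cases hl : l = 0
  · exact ⟨infinity, by simp [hl]⟩
  have hw : ![-(l ![0, 1]), l ![1, 0]] ≠ (0 : Fin 2 → ℂ) := by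
    intro h
    refine hl (LinearMap.ext fun w => ?_)
    have h0 := congrFun h 0
    have h1 := congrFun h 1
    simp at h0 h1
    rw [linForm_apply, h0, h1]; simp
  obtain ⟨c, -, e⟩ := exists_rep_eq_smul hw rfl
  refine ⟨Projectivization.mk ℂ _ hw, ?_⟩
  rw [e, map_smul, linForm_apply]
  simp; right; ring

/-- The fibres of `l₁ / l₂` are fibres of `f`. -/
theorem NoCommonZero.exists_fib_eq {l₁ l₂ : LinForm 1} (h : NoCommonZero l₁ l₂) (b : ℂ) :
    ∃ a : CP 1, l₁ a.rep = b * l₂ a.rep ∧ ∀ f : C → CP 1, fib l₁ l₂ f b = f ⁻¹' {a} := by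
  obtain ⟨a, ha⟩ := exists_linForm_eq_zero (l₁ - b • l₂)
  have ha' : l₁ a.rep = b * l₂ a.rep := by simpa [sub_eq_zero] using ha
  refine ⟨a, ha', fun f => ?_⟩
  ext x
  constructor
  · intro hx
    exact eq_of_linForm_eq_zero (h.sub_smul_ne_zero b) ha
      (by simpa [sub_eq_zero] using show l₁ (f x).rep = b * l₂ (f x).rep from hx)
  · intro hx
    rw [mem_preimage, mem_singleton_iff] at hx
    rw [fib, mem_ofPred_eq, hx, ha']

variable [IsManifold 𝓘(ℂ) ω C]

/-- Independence of the multiplicity from the affine coordinate: the form l₁ - φ(x) l₂ vanishes at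
`f x`, hence is a non-zero multiple of `vanForm (f x)`, and the two local functions differ by a
unit. -/
theorem ordAt_quot_sub (hf : IsHolomorphic f) {l₁ l₂ : LinForm 1} (h : NoCommonZero l₁ l₂) {x : C}
    (hx : l₂ (f x).rep ≠ 0) :
    ordAt (fun y => quot l₁ l₂ f y - quot l₁ l₂ f x) x =
      ordAt (quot (vanForm (f x)) (innerForm (f x)) f) x := by
  obtain ⟨c, hc⟩ := exists_eq_smul_vanForm (l := l₁ - quot l₁ l₂ f x • l₂) (a := f x) (by
    simp [quot, hx])
  have hc0 : c ≠ 0 := by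
    rintro rfl
    exact h.sub_smul_ne_zero _ (by simpa using hc)
  have hi := innerForm_self_ne_zero (f x)
  have e : (fun y => quot l₁ l₂ f y - quot l₁ l₂ f x) =ᶠ[𝓝 x] fun y =>
      quot (vanForm (f x)) (innerForm (f x)) f y * (c * quot (innerForm (f x)) l₂ f y) := by
    filter_upwards [(hf.isOpen_ne l₂).mem_nhds hx, (hf.isOpen_ne _).mem_nhds hi] with y h1 h2
    have := LinearMap.congr_fun hc (f y).rep
    simp only [LinearMap.sub_apply, LinearMap.smul_apply, smul_eq_mul] at this
    rw [show quot l₁ l₂ f y = l₁ (f y).rep / l₂ (f y).rep from rfl, div_sub' h1,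
      mul_comm _ (quot l₁ l₂ f x), this, quot, quot]
    field_simp
  have h3 : HolAt (fun y => c * quot (innerForm (f x)) l₂ f y) x :=
    (HolAt.const c).mul (hf.holAt_quot _ hx)
  rw [ordAt_congr e, ordAt_mul (hf.holAt_quot _ hi) h3, (ordAt_eq_zero h3).2, add_zero]
  exact mul_ne_zero hc0 (div_ne_zero hi hx)

variable [T1Space C] [CompactSpace C] [ConnectedSpace C]

theorem finite_zeros (hf : IsHolomorphic f) (hn : Nonconstant f) {l : LinForm 1} (hl : l ≠ 0) :
    {x | l (f x).rep = 0}.Finite := by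
  refine (hf.finite_or_forall l).resolve_right fun h => ?_
  obtain ⟨x, hx⟩ := hn l hl
  exact hx (h x)

theorem finite_fib (hf : IsHolomorphic f) (hn : Nonconstant f) {l₁ l₂ : LinForm 1}
    (h : NoCommonZero l₁ l₂) (b : ℂ) : (fib l₁ l₂ f b).Finite := by
  refine (finite_zeros hf hn (h.sub_smul_ne_zero b)).subset fun x hx => ?_
  simpa [sub_eq_zero] using show l₁ (f x).rep = b * l₂ (f x).rep from hx

theorem finite_preimage (hf : IsHolomorphic f) (hn : Nonconstant f) (a : CP 1) :
    (f ⁻¹' {a}).Finite := by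
  refine (finite_zeros hf hn (vanForm_ne_zero a)).subset fun x hx => ?_
  rw [mem_preimage, mem_singleton_iff] at hx
  simp [hx]

/-- An infinite order would make `f` locally constant, against the finiteness of its fibres. So the
order is finite and `toNat` loses nothing. -/
theorem natCast_mult (hf : IsHolomorphic f) (hn : Nonconstant f) {l₁ l₂ : LinForm 1}
    (h : NoCommonZero l₁ l₂) {x : C} (hx : l₂ (f x).rep ≠ 0) :
    (mult f x : ℕ∞) = ordAt (fun y => quot l₁ l₂ f y - quot l₁ l₂ f x) x := by
  rw [ordAt_quot_sub hf h hx, mult_eq_toNat_ordAt]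
  refine ENat.natCast_toNat fun ht => ?_
  have h1 := ordAt_eq_top.1 ht
  have h2 : ∀ᶠ y in 𝓝 x, vanForm (f x) (f y).rep = 0 := by
    filter_upwards [h1, (hf.isOpen_ne _).mem_nhds (innerForm_self_ne_zero (f x))] with y h1 h2
    exact (div_eq_zero_iff.1 h1).resolve_right h2
  obtain ⟨y, hy1, hy2⟩ := ((h2.filter_mono nhdsWithin_le_nhds).and (eventually_nhdsNE_of_finite
    (finite_zeros hf hn (vanForm_ne_zero (f x))) x)).exists
  exact hy2 hy1

theorem natCast_mult_eq_deriv (hf : IsHolomorphic f) (hn : Nonconstant f) {l₁ l₂ : LinForm 1}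
    (h : NoCommonZero l₁ l₂) {x : C} (hx : l₂ (f x).rep ≠ 0) :
    (mult f x : ℕ∞) =
      analyticOrderAt (deriv (inChart x (quot l₁ l₂ f))) (chartAt ℂ x x) + 1 := by
  rw [natCast_mult hf hn h hx, ordAt_sub (hf.holAt_quot _ hx)]

theorem mult_ne_zero (hf : IsHolomorphic f) (hn : Nonconstant f) (x : C) : mult f x ≠ 0 := by
  intro h0
  have := natCast_mult_eq_deriv hf hn (noCommonZero_vanForm_innerForm (f x))
    (innerForm_self_ne_zero (f x))
  rw [h0, Nat.cast_zero] at this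
  exact one_ne_zero (add_eq_zero.1 this.symm).2

theorem mult_eq_one_iff (hf : IsHolomorphic f) (hn : Nonconstant f) {l₁ l₂ : LinForm 1}
    (h : NoCommonZero l₁ l₂) {x : C} (hx : l₂ (f x).rep ≠ 0) :
    mult f x = 1 ↔ derivAt (quot l₁ l₂ f) x ≠ 0 := by
  rw [← ordAt_sub_eq_one (hf.holAt_quot _ hx), ← natCast_mult hf hn h hx]
  norm_cast

/-- In one fixed chart around `x` ramification is the vanishing of the derivative of an affine
coordinate, an analytic function that is not identically zero. Its zeros are isolated, and
compactness leaves finitely many. -/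
theorem finite_ramified (hf : IsHolomorphic f) (hn : Nonconstant f) :
    {x | ¬ mult f x = 1}.Finite := by
  refine finite_of_forall_nhdsNE fun x => ?_
  set φ := quot (vanForm (f x)) (innerForm (f x)) f
  have hi := innerForm_self_ne_zero (f x)
  have hφ : AnalyticAt ℂ (inChart x φ) (chartAt ℂ x x) := hf.holAt_quot _ hi
  have hd : ∀ᶠ z in 𝓝[≠] (chartAt ℂ x x), deriv (inChart x φ) z ≠ 0 := by
    refine hφ.deriv.eventually_eq_zero_or_eventually_ne_zero.resolve_left fun h0 => ?_
    have := natCast_mult_eq_deriv hf hn (noCommonZero_vanForm_innerForm (f x)) hi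
    rw [analyticOrderAt_eq_top.2 h0] at this
    simp at this
  filter_upwards [(tendsto_chart_ne x).eventually hd,
    nhdsWithin_le_nhds ((tendsto_chart x).eventually hφ.eventually_analyticAt),
    nhdsWithin_le_nhds (eventually_mem_source x),
    nhdsWithin_le_nhds ((hf.isOpen_ne _).mem_nhds hi)] with y h1 h2 h3 h4
  rw [mult_eq_one_iff hf hn (noCommonZero_vanForm_innerForm (f x)) h4, derivAt,
    deriv_inChart h3 h2.differentiableAt]
  exact mul_ne_zero h1 (deriv_transition_ne_zero h3)

end Mult

/-! ### Fibres and the degree -/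

section Fibres

variable {C : Type*} [TopologicalSpace C] [ChartedSpace ℂ C] [IsManifold 𝓘(ℂ) ω C]
  [T2Space C] [CompactSpace C] {f : C → CP 1}

/-- Fibres over points near `b` are close to the fibre over `b`. -/
theorem eventually_fib_subset (hf : IsHolomorphic f) {l₁ l₂ : LinForm 1} {b : ℂ} {O : Set C}
    (hO : IsOpen O) (h : fib l₁ l₂ f b ⊆ O) : ∀ᶠ b' in 𝓝 b, fib l₁ l₂ f b' ⊆ O := by
  -- In a local lift, not lying on the fibre is the condition l₁ - b l₂ ≠ 0, open in (b, x) jointly.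
  -- Compactness of `C` makes the neighbourhood of `b` uniform in `x`.
  have key : ∀ᶠ b' in 𝓝 b, ∀ x ∈ (univ : Set C), x ∈ fib l₁ l₂ f b' → x ∈ O := by
    refine isCompact_univ.eventually_forall_of_forall_eventually fun x _ => ?_
    by_cases hx : x ∈ O
    · have : ∀ᶠ z in 𝓝 (b, x), z.2 ∈ O := continuousAt_snd.eventually_mem (hO.mem_nhds hx)
      filter_upwards [this] with z hz _ using hz
    · obtain ⟨s, hs⟩ := hf.exists_isLift x
      have h0 : l₁ (s x) - b * l₂ (s x) ≠ 0 := by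
        intro h0
        obtain ⟨c, hc, e⟩ := hs.rep_eq
        refine hx (h ?_)
        rw [fib, mem_ofPred_eq, e, map_smul, map_smul, sub_eq_zero.1 h0, smul_eq_mul, smul_eq_mul]
        ring
      have hc : ContinuousAt (fun z : ℂ × C => l₁ (s z.2) - z.1 * l₂ (s z.2)) (b, x) := by
        refine ContinuousAt.sub ?_ (ContinuousAt.mul continuousAt_fst ?_)
        · exact ContinuousAt.comp (f := Prod.snd) (x := (b, x)) (hs.1 l₁).continuousAt
            continuousAt_snd
        · exact ContinuousAt.comp (f := Prod.snd) (x := (b, x)) (hs.1 l₂).continuousAt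
            continuousAt_snd
      have h2 : ∀ᶠ z in 𝓝 (b, x), ∃ c : ℂ, c ≠ 0 ∧ (f z.2).rep = c • s z.2 :=
        (continuous_snd.tendsto (b, x)).eventually hs.2
      filter_upwards [hc.eventually_ne h0, h2] with z hz ⟨c, hc, e⟩ hzf
      exfalso
      rw [fib, mem_ofPred_eq, e, map_smul, map_smul, smul_eq_mul, smul_eq_mul] at hzf
      refine hz (mul_left_cancel₀ hc ?_)
      rw [mul_sub, hzf]; ring
  filter_upwards [key] with b' hb x hx using hb x (mem_univ x) hx

variable [ConnectedSpace C]

/-- Conservation of number: in disjoint neighbourhoods of the points `x` of the fibre, each nearby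
value is taken `mult f x` times, and by compactness nearby fibres have no points elsewhere. -/
theorem eventually_ncard_fib (hf : IsHolomorphic f) (hn : Nonconstant f) {l₁ l₂ : LinForm 1}
    (h : NoCommonZero l₁ l₂) (b : ℂ) :
    ∀ᶠ b' in 𝓝[≠] b, (fib l₁ l₂ f b').ncard = ∑ᶠ x ∈ fib l₁ l₂ f b, mult f x := by
  have hF := finite_fib hf hn h b
  obtain ⟨U, hU, hUd⟩ := hF.t2_separation
  have hloc : ∀ x ∈ fib l₁ l₂ f b, ∃ N' ⊆ U x ∩ {x | l₂ (f x).rep ≠ 0}, IsOpen N' ∧ x ∈ N' ∧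
      ∀ᶠ b' in 𝓝[≠] b, {y | y ∈ N' ∧ quot l₁ l₂ f y = b'}.ncard = mult f x := by
    intro x hx
    have hx2 := h.ne_zero_of_mem_fib hx
    have := (hf.holAt_quot l₁ hx2).exists_open_ncard (mult_ne_zero hf hn x)
      (natCast_mult hf hn h hx2).symm
      (inter_mem ((hU x).2.mem_nhds (hU x).1) ((hf.isOpen_ne l₂).mem_nhds hx2))
    rwa [(mem_fib_iff hx2).1 hx] at this
  choose! N hNU hNo hxN hN using hloc
  have hsub := eventually_fib_subset hf (isOpen_biUnion hNo)
    (fun x hx => mem_biUnion hx (hxN x hx) : fib l₁ l₂ f b ⊆ ⋃ x ∈ fib l₁ l₂ f b, N x)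
  have hall : ∀ᶠ b' in 𝓝[≠] b, ∀ x ∈ fib l₁ l₂ f b,
      {y | y ∈ N x ∧ quot l₁ l₂ f y = b'}.ncard = mult f x :=
    (eventually_all_finite hF).2 hN
  filter_upwards [nhdsWithin_le_nhds hsub, hall] with b' h1 h2
  have e : fib l₁ l₂ f b' = ⋃ x ∈ fib l₁ l₂ f b, {y | y ∈ N x ∧ quot l₁ l₂ f y = b'} := by
    ext y
    simp only [mem_iUnion, mem_ofPred_eq, exists_prop]
    constructor
    · intro hy
      obtain ⟨x, hx, hyx⟩ := mem_iUnion₂.1 (h1 hy)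
      exact ⟨x, hx, hyx, (mem_fib_iff (hNU x hx hyx).2).1 hy⟩
    · rintro ⟨x, hx, hyx, hy⟩
      exact (mem_fib_iff (hNU x hx hyx).2).2 hy
  have hfin := finite_fib hf hn h b'
  rw [e, hF.ncard_biUnion ?_ ?_]
  · exact finsum_mem_congr rfl fun x hx => h2 x hx
  · intro x hx
    refine hfin.subset ?_
    rw [e]
    exact subset_biUnion_of_mem (u := fun x => {y | y ∈ N x ∧ quot l₁ l₂ f y = b'}) hx
  · intro x hx y hy hxy
    exact (hUd hx hy hxy).mono (fun z hz => (hNU x hx hz.1).1) (fun z hz => (hNU y hy hz.1).1)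

/-- All but finitely many fibres consist of `degree f` unramified points. -/
theorem exists_finite_degree (hf : IsHolomorphic f) (hn : Nonconstant f) :
    ∃ B : Set (CP 1), B.Finite ∧ ∀ a ∉ B, (f ⁻¹' {a}).ncard = degree f ∧
      ∀ x, f x = a → mult f x = 1 := by
  set l₁ : LinForm 1 := LinearMap.proj 1
  set l₂ : LinForm 1 := LinearMap.proj 0
  have h : NoCommonZero l₁ l₂ := by
    intro w h1 h2
    ext i; fin_cases i
    · exact h2
    · exact h1
  set B₀ : Set ℂ := quot l₁ l₂ f '' ({x | ¬ mult f x = 1} ∩ {x | l₂ (f x).rep ≠ 0})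
  have hB₀ : B₀.Finite := ((finite_ramified hf hn).inter_of_left _).image _
  have hmult : ∀ b ∉ B₀, ∀ x ∈ fib l₁ l₂ f b, mult f x = 1 := by
    intro b hb x hx
    by_contra hm
    have h2 := h.ne_zero_of_mem_fib hx
    exact hb ⟨x, ⟨hm, h2⟩, (mem_fib_iff h2).1 hx⟩
  have hsum : ∀ b ∉ B₀, ∑ᶠ x ∈ fib l₁ l₂ f b, mult f x = (fib l₁ l₂ f b).ncard := by
    intro b hb
    rw [← finsum_one]
    exact finsum_mem_congr rfl (hmult b hb)
  -- The number of points is locally constant off the branch values, and the complement of a finite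
  -- set in ℂ is connected.
  have hconst : ∀ b ∉ B₀, ∀ b' ∉ B₀, (fib l₁ l₂ f b).ncard = (fib l₁ l₂ f b').ncard := by
    intro b hb b' hb'
    have hconn : IsPreconnected (B₀ᶜ) :=
      (hB₀.countable.isPathConnected_compl_of_one_lt_rank (by simp)).isConnected.isPreconnected
    refine hconn.constant (f := fun b => (fib l₁ l₂ f b).ncard) ?_ hb hb'
    intro b hb
    refine ContinuousAt.continuousWithinAt ?_
    have h1 := eventually_ncard_fib hf hn h b
    rw [hsum b hb, eventually_nhdsWithin_iff] at h1
    refine (continuousAt_const (y := (fib l₁ l₂ f b).ncard)).congr ?_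
    filter_upwards [h1] with c hc
    by_cases e : c = b
    · rw [e]
    · exact (hc e).symm
  have h0 : fib l₁ l₂ f 0 = f ⁻¹' {infinity} := by
    obtain ⟨a, ha, he⟩ := h.exists_fib_eq (C := C) 0
    rw [he]
    have : a = infinity := by
      refine eq_mk_of_rep_eq_smul _ (c := a.rep 0) ?_
      ext i; fin_cases i
      · simp
      · simpa [l₁] using ha
    rw [this]
  -- The value 0 may itself be a branch value. A nearby unramified fibre has as many points as the
  -- fibre over 0 with multiplicities.
  have hdeg : ∀ b ∉ B₀, (fib l₁ l₂ f b).ncard = degree f := by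
    intro b hb
    obtain ⟨b', h1, h2⟩ := ((eventually_ncard_fib hf hn h 0).and
      (show ∀ᶠ y in 𝓝[≠] (0 : ℂ), y ∉ B₀ from by
        have : (B₀ \ {0})ᶜ ∈ 𝓝 (0 : ℂ) :=
          (hB₀.subset sdiff_subset).isClosed.isOpen_compl.mem_nhds (by simp)
        filter_upwards [nhdsWithin_le_nhds this, self_mem_nhdsWithin] with y hy hne hS
        exact hy ⟨hS, hne⟩)).exists
    rw [hconst b hb b' h2, h1, h0]; rfl
  have hp : (![0, 1] : Fin 2 → ℂ) ≠ 0 := fun h => by simpa using congrFun h 1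
  refine ⟨{Projectivization.mk ℂ ![0, 1] hp} ∪ f '' {x | ¬ mult f x = 1},
    (finite_singleton _).union ((finite_ramified hf hn).image _), fun a ha => ?_⟩
  rw [mem_union, not_or] at ha
  have ha0 : l₂ a.rep ≠ 0 := by
    intro h0
    refine ha.1 (eq_mk_of_rep_eq_smul hp (c := a.rep 1) ?_)
    ext i; fin_cases i
    · simpa [l₂] using h0
    · simp
  set b := l₁ a.rep / l₂ a.rep
  have hfib : fib l₁ l₂ f b = f ⁻¹' {a} := by
    obtain ⟨a', ha', he⟩ := h.exists_fib_eq (C := C) b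
    rw [he, eq_of_linForm_eq_zero (h.sub_smul_ne_zero b) (a := a) (b := a') ?_ ?_]
    · simp [b, ha0]
    · simp [ha']
  have hm : ∀ x, f x = a → mult f x = 1 := by
    intro x hx
    by_contra hm
    exact ha.2 ⟨x, hm, hx⟩
  have hb : b ∉ B₀ := by
    rintro ⟨x, ⟨hx, h2⟩, e⟩
    have : x ∈ f ⁻¹' {a} := hfib ▸ (mem_fib_iff h2).2 e
    exact hx (hm x this)
  exact ⟨by rw [← hfib, hdeg b hb], hm⟩

theorem exists_finite_degree_fib (hf : IsHolomorphic f) (hn : Nonconstant f) {l₁ l₂ : LinForm 1}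
    (h : NoCommonZero l₁ l₂) :
    ∃ B : Set ℂ, B.Finite ∧ ∀ b ∉ B, (fib l₁ l₂ f b).ncard = degree f ∧
      ∀ x ∈ fib l₁ l₂ f b, mult f x = 1 := by
  obtain ⟨B, hB, hBd⟩ := exists_finite_degree hf hn
  choose a ha hfib using fun b => h.exists_fib_eq (C := C) b
  have hinj : Function.Injective a := by
    intro b b' e
    have h1 := ha b
    rw [e, ha b'] at h1
    have h2 : l₂ (a b').rep ≠ 0 := fun h2 =>
      (a b').rep_nonzero (h _ (by rw [ha b', h2, mul_zero]) h2)
    exact (mul_right_cancel₀ h2 h1).symm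
  refine ⟨a ⁻¹' B, hB.preimage hinj.injOn, fun b hb => ?_⟩
  rw [hfib]
  exact ⟨(hBd _ hb).1, fun x hx => (hBd _ hb).2 x hx⟩

end Fibres

end Planarity

end

noncomputable section

namespace Planarity

/-! ### Entire functions of polynomial growth -/

section Entire

/-- An entire function of polynomial growth is a polynomial. -/
theorem exists_polynomial_of_growth (N : ℕ) : ∀ (g : ℂ → ℂ) (K : ℝ), Differentiable ℂ g →
    (∀ z, ‖g z‖ ≤ K * (1 + ‖z‖) ^ N) →
    ∃ p : Polynomial ℂ, p.natDegree ≤ N ∧ ∀ z, g z = p.eval z := by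
  induction N with
  | zero =>
    intro g K hg hK
    obtain ⟨c, hc⟩ := hg.exists_const_forall_eq_of_bounded (by
      refine isBounded_iff_forall_norm_le.2 ⟨K, ?_⟩
      rintro _ ⟨z, rfl⟩
      simpa using hK z)
    exact ⟨Polynomial.C c, by simp, fun z => by simp [hc]⟩
  | succ N ih =>
    intro g K hg hK
    have hK0 : 0 ≤ K := by have := (norm_nonneg _).trans (hK 0); simpa using this
    -- Induction on the growth: (g z - g 0) / z is entire again, and its growth exponent is smaller
    -- by one.
    have hd : Differentiable ℂ (dslope g 0) := by
      have := (Complex.differentiableOn_dslope (f := g) (c := 0) univ_mem).2 hg.differentiableOn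
      exact differentiableOn_univ.1 this
    obtain ⟨M, hM⟩ := (isCompact_closedBall (0 : ℂ) 1).exists_bound_of_continuousOn
      hd.continuous.continuousOn
    have hM0 : 0 ≤ M := (norm_nonneg _).trans (hM 0 (by simp))
    obtain ⟨p, hp, hpg⟩ := ih (dslope g 0) (M + (2 * K + ‖g 0‖)) hd fun z => by
      have h1 : (1 : ℝ) ≤ (1 + ‖z‖) ^ N := one_le_pow₀ (by linarith [norm_nonneg z])
      by_cases hz : ‖z‖ ≤ 1
      · calc ‖dslope g 0 z‖ ≤ M := hM z (by simpa using hz)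
          _ ≤ (M + (2 * K + ‖g 0‖)) * 1 := by linarith [norm_nonneg (g 0)]
          _ ≤ _ := by gcongr
      · push Not at hz
        have hz0 : z ≠ 0 := by rintro rfl; simp at hz; linarith
        have e : dslope g 0 z = z⁻¹ * (g z - g 0) := by
          rw [dslope_of_ne _ hz0, slope_def_field, sub_zero]; field_simp
        have hz' : 0 < ‖z‖ := by linarith
        calc ‖dslope g 0 z‖ = ‖z‖⁻¹ * ‖g z - g 0‖ := by rw [e, norm_mul, norm_inv]
          _ ≤ ‖z‖⁻¹ * (K * (1 + ‖z‖) ^ (N + 1) + ‖g 0‖) := by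
            gcongr
            exact (norm_sub_le _ _).trans (by linarith [hK z])
          _ = K * (‖z‖⁻¹ * (1 + ‖z‖)) * (1 + ‖z‖) ^ N + ‖z‖⁻¹ * ‖g 0‖ := by ring
          _ ≤ K * 2 * (1 + ‖z‖) ^ N + 1 * ‖g 0‖ := by
            have h2 : ‖z‖⁻¹ * (1 + ‖z‖) ≤ 2 := by
              rw [inv_mul_le_iff₀ hz']; linarith
            have h3 : ‖z‖⁻¹ ≤ 1 := inv_le_one_of_one_le₀ hz.le
            gcongr
          _ ≤ _ := by nlinarith [norm_nonneg (g 0)]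
    refine ⟨Polynomial.C (g 0) + Polynomial.X * p, ?_, fun z => ?_⟩
    · refine (Polynomial.natDegree_add_le _ _).trans (max_le (by simp) ?_)
      refine Polynomial.natDegree_mul_le.trans ?_
      have := Polynomial.natDegree_X_le (R := ℂ)
      omega
    · have := sub_smul_dslope g 0 z
      simp only [sub_zero, smul_eq_mul] at this
      simp only [Polynomial.eval_add, Polynomial.eval_C, Polynomial.eval_mul, Polynomial.eval_X,
        ← hpg, this]
      ring

/-- The same for a function which is holomorphic off a finite set. -/
theorem exists_polynomial_of_growth_off_finite {N : ℕ} {g : ℂ → ℂ} {K : ℝ} {B : Set ℂ}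
    (hB : B.Finite) (hg : ∀ z ∉ B, DifferentiableAt ℂ g z)
    (hK : ∀ z ∉ B, ‖g z‖ ≤ K * (1 + ‖z‖) ^ N) :
    ∃ p : Polynomial ℂ, p.natDegree ≤ N ∧ ∀ z ∉ B, g z = p.eval z := by
  have hB' : ∀ c : ℂ, ∀ᶠ z in 𝓝 c, z ≠ c → z ∉ B := by
    intro c
    have : (B \ {c})ᶜ ∈ 𝓝 c :=
      (hB.subset sdiff_subset).isClosed.isOpen_compl.mem_nhds (by simp)
    filter_upwards [this] with z hz hne hzB using hz ⟨hzB, hne⟩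
  have hcont : Continuous fun z : ℂ => K * (1 + ‖z‖) ^ N := by fun_prop
  -- The bound keeps `g` bounded near each exceptional point, so Riemann's theorem extends it to an
  -- entire `G`, and the bound survives in the limit.
  set G : ℂ → ℂ := fun z => limUnder (𝓝[≠] z) g
  have hG : ∀ z ∉ B, G z = g z := fun z hz =>
    ((hg z hz).continuousAt.tendsto.mono_left nhdsWithin_le_nhds).limUnder_eq
  have hGd : Differentiable ℂ G := by
    intro c
    by_cases hc : c ∈ B
    · have h1 : ∀ᶠ z in 𝓝 c, K * (1 + ‖z‖) ^ N < K * (1 + ‖c‖) ^ N + 1 :=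
        hcont.continuousAt.eventually_lt continuousAt_const (by simp)
      obtain ⟨s, hs, hso, hcs⟩ := eventually_nhds_iff.1 ((hB' c).and h1)
      have hsc : s ∈ 𝓝 c := hso.mem_nhds hcs
      have h2 := Complex.differentiableOn_update_limUnder_of_bddAbove (f := g) hsc
        (fun z hz => (hg z ((hs z hz.1).1 hz.2)).differentiableWithinAt) (by
          refine ⟨K * (1 + ‖c‖) ^ N + 1, ?_⟩
          rintro _ ⟨z, hz, rfl⟩
          exact (hK z ((hs z hz.1).1 hz.2)).trans (hs z hz.1).2.le)
      refine (h2.differentiableAt hsc).congr_of_eventuallyEq ?_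
      filter_upwards [hsc] with z hz
      by_cases e : z = c
      · rw [e, Function.update_self]
      · rw [Function.update_of_ne e, hG z ((hs z hz).1 e)]
    · refine (hg c hc).congr_of_eventuallyEq ?_
      filter_upwards [hB.isClosed.isOpen_compl.mem_nhds hc] with z hz using hG z hz
  have hGK : ∀ z, ‖G z‖ ≤ K * (1 + ‖z‖) ^ N := by
    intro c
    refine le_of_tendsto_of_tendsto (b := 𝓝[≠] c)
      (hGd.continuous.norm.continuousAt.tendsto.mono_left nhdsWithin_le_nhds)
      (hcont.continuousAt.tendsto.mono_left nhdsWithin_le_nhds) ?_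
    filter_upwards [nhdsWithin_le_nhds (hB' c), self_mem_nhdsWithin] with z hz hne
    rw [hG z (hz hne)]
    exact hK z (hz hne)
  obtain ⟨p, hp, hpG⟩ := exists_polynomial_of_growth N G K hGd hGK
  exact ⟨p, hp, fun z hz => by rw [← hpG, hG z hz]⟩

open Polynomial in
theorem analyticAt_coeff_prod {ι : Type*} (s : Finset ι) {g : ι → ℂ → ℂ} {b : ℂ}
    (hg : ∀ i ∈ s, AnalyticAt ℂ (g i) b) (k : ℕ) :
    AnalyticAt ℂ (fun b => (∏ i ∈ s, (X - C (g i b))).coeff k) b := by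
  classical
  induction s using Finset.induction_on generalizing k with
  | empty => simpa using analyticAt_const
  | insert i s hi ih =>
    have ih' := fun k => ih (fun j hj => hg j (Finset.mem_insert_of_mem hj)) k
    simp only [Finset.prod_insert hi, sub_mul, coeff_sub, coeff_C_mul]
    refine AnalyticAt.sub ?_ ((hg i (Finset.mem_insert_self i s)).mul (ih' k))
    cases k with
    | zero => simpa using analyticAt_const
    | succ k => simpa only [coeff_X_mul] using ih' k

open Polynomial in
theorem norm_coeff_prod_le {ι : Type*} (s : Finset ι) {g : ι → ℂ} {R : ℝ}
    (hg : ∀ i ∈ s, ‖g i‖ ≤ R) (k : ℕ) :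
    ‖(∏ i ∈ s, (X - C (g i))).coeff k‖ ≤ R ^ (s.card - k) * s.card.choose k := by
  have hm : (∏ i ∈ s, (X - C (g i))).Monic := monic_prod_of_monic _ _ fun i _ => monic_X_sub_C _
  have hd : (∏ i ∈ s, (X - C (g i))).natDegree = s.card := by
    rw [natDegree_prod_of_monic _ _ fun i _ => monic_X_sub_C _]; simp
  have := coeff_le_of_roots_le (f := RingHom.id ℂ) (B := R) k hm (IsAlgClosed.splits _) (by
    intro z hz
    rw [Polynomial.map_id] at hz
    have h0 := (mem_roots'.1 hz).2
    rw [IsRoot, eval_prod] at h0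
    obtain ⟨i, hi, h⟩ := Finset.prod_eq_zero_iff.1 h0
    rw [eval_sub, eval_X, eval_C, sub_eq_zero] at h
    exact h ▸ hg i hi)
  rwa [Polynomial.map_id, hd] at this

end Entire

/-! ### The characteristic polynomial of a function over the line -/

section CharPoly

variable {C : Type*} [TopologicalSpace C] [ChartedSpace ℂ C] [IsManifold 𝓘(ℂ) ω C]
  [T2Space C] [CompactSpace C] [ConnectedSpace C] {f : C → CP 1}

open Polynomial in
/-- The monic polynomial whose roots are the values of `h` on the fibre over `b`. -/
def fibPoly (l₁ l₂ : LinForm 1) (f : C → CP 1) (h : C → ℂ) (b : ℂ) : ℂ[X] :=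
  ∏ᶠ x ∈ fib l₁ l₂ f b, (X - Polynomial.C (h x))

open Polynomial in
-- Over an unramified value the fibre consists of analytic branches γ. The coefficients are
-- symmetric functions of the values h ∘ γ.
theorem analyticAt_coeff_fibPoly (hf : IsHolomorphic f) (hn : Nonconstant f) {l₁ l₂ : LinForm 1}
    (hl : NoCommonZero l₁ l₂) {h : C → ℂ} {b : ℂ} (hm : ∀ x ∈ fib l₁ l₂ f b, mult f x = 1)
    (hh : ∀ x ∈ fib l₁ l₂ f b, HolAt h x) (k : ℕ) :
    AnalyticAt ℂ (fun b => (fibPoly l₁ l₂ f h b).coeff k) b := by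
  have hF := finite_fib hf hn hl b
  obtain ⟨U, hU, hUd⟩ := hF.t2_separation
  have hloc : ∀ x ∈ fib l₁ l₂ f b, ∃ N' ⊆ U x ∩ {x | l₂ (f x).rep ≠ 0}, IsOpen N' ∧ x ∈ N' ∧
      ∃ γ : ℂ → C, γ b = x ∧
      (∀ᶠ b' in 𝓝 b, γ b' ∈ N' ∧ ∀ y ∈ N', quot l₁ l₂ f y = b' ↔ y = γ b') ∧
      ∀ h : C → ℂ, HolAt h x → AnalyticAt ℂ (fun b => h (γ b)) b := by
    intro x hx
    have hx2 := hl.ne_zero_of_mem_fib hx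
    have := (hf.holAt_quot l₁ hx2).exists_local_inverse
      ((mult_eq_one_iff hf hn hl hx2).1 (hm x hx))
      (inter_mem ((hU x).2.mem_nhds (hU x).1) ((hf.isOpen_ne l₂).mem_nhds hx2))
    rwa [(mem_fib_iff hx2).1 hx] at this
  choose! N hNU hNo hxN γ hγb hγ hγa using hloc
  have hsub := eventually_fib_subset hf (isOpen_biUnion hNo)
    (fun x hx => mem_biUnion hx (hxN x hx) : fib l₁ l₂ f b ⊆ ⋃ x ∈ fib l₁ l₂ f b, N x)
  have hall := (eventually_all_finite hF).2 hγ
  refine (analyticAt_coeff_prod hF.toFinset (g := fun x b => h (γ x b)) (b := b) (fun x hx => ?_)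
    k).congr ?_
  · have hx' := hF.mem_toFinset.1 hx
    exact hγa x hx' h (hh x hx')
  · filter_upwards [hsub, hall] with b' h1 h2
    have e : fib l₁ l₂ f b' = (fun x => γ x b') '' fib l₁ l₂ f b := by
      ext y
      constructor
      · intro hy
        obtain ⟨x, hx, hyx⟩ := mem_iUnion₂.1 (h1 hy)
        exact ⟨x, hx, (((h2 x hx).2 y hyx).1 ((mem_fib_iff (hNU x hx hyx).2).1 hy)).symm⟩
      · rintro ⟨x, hx, rfl⟩
        have h3 := (h2 x hx).1
        exact (mem_fib_iff (hNU x hx h3).2).2 (((h2 x hx).2 _ h3).2 rfl)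
    have hinj : InjOn (fun x => γ x b') (fib l₁ l₂ f b) := by
      intro x hx y hy hxy
      by_contra hne
      refine (hUd hx hy hne).le_bot ⟨(hNU x hx (h2 x hx).1).1, ?_⟩
      rw [show γ x b' = γ y b' from hxy]
      exact (hNU y hy (h2 y hy).1).1
    rw [fibPoly, e, finprod_mem_image hinj, finprod_mem_eq_finite_toFinset_prod _ hF]

open Polynomial in
/-- The coefficients of the characteristic polynomial of `h` are polynomials in `b`, with degrees
bounded in terms of the growth of `h`. -/
theorem exists_charPoly (hf : IsHolomorphic f) (hn : Nonconstant f) {l₁ l₂ : LinForm 1}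
    (hl : NoCommonZero l₁ l₂) {h : C → ℂ} {B : Set ℂ} (hB : B.Finite) {d N : ℕ} {K : ℝ}
    (hd : ∀ b ∉ B, (fib l₁ l₂ f b).ncard = d) (hm : ∀ b ∉ B, ∀ x ∈ fib l₁ l₂ f b, mult f x = 1)
    (hh : ∀ b ∉ B, ∀ x ∈ fib l₁ l₂ f b, HolAt h x)
    (hK : ∀ b ∉ B, ∀ x ∈ fib l₁ l₂ f b, ‖h x‖ ≤ K * (1 + ‖b‖) ^ N) :
    ∃ E : ℕ → ℂ[X], E d = 1 ∧ (∀ k, (E k).natDegree ≤ N * (d - k)) ∧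
      ∀ b ∉ B, fibPoly l₁ l₂ f h b = ∑ k ∈ Finset.range (d + 1), Polynomial.C ((E k).eval b) * X ^ k := by
  have hprod : ∀ b, fibPoly l₁ l₂ f h b =
      ∏ x ∈ (finite_fib hf hn hl b).toFinset, (X - Polynomial.C (h x)) := fun b =>
    finprod_mem_eq_finite_toFinset_prod _ _
  have hcard : ∀ b ∉ B, (finite_fib hf hn hl b).toFinset.card = d := fun b hb => by
    rw [← ncard_eq_toFinset_card _ (finite_fib hf hn hl b), hd b hb]
  have hcoeff : ∀ k, ∃ p : ℂ[X], p.natDegree ≤ N * (d - k) ∧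
      ∀ b ∉ B, (fibPoly l₁ l₂ f h b).coeff k = p.eval b := by
    intro k
    -- The k-th coefficient is, up to sign, an elementary symmetric function of degree d - k in
    -- values of growth N.
    refine exists_polynomial_of_growth_off_finite (K := K ^ (d - k) * d.choose k) hB
      (fun b hb => (analyticAt_coeff_fibPoly hf hn hl (hm b hb) (hh b hb) k).differentiableAt)
      fun b hb => ?_
    rw [hprod]
    refine (norm_coeff_prod_le _ (fun x hx => hK b hb x ((finite_fib hf hn hl b).mem_toFinset.1 hx))
      k).trans (le_of_eq ?_)
    rw [hcard b hb, mul_pow, ← pow_mul]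
    ring
  choose E hE hEc using hcoeff
  have hmonic : ∀ b, (fibPoly l₁ l₂ f h b).Monic := fun b => by
    rw [hprod]; exact monic_prod_of_monic _ _ fun i _ => monic_X_sub_C _
  have hdeg : ∀ b ∉ B, (fibPoly l₁ l₂ f h b).natDegree = d := fun b hb => by
    rw [hprod, natDegree_prod_of_monic _ _ fun i _ => monic_X_sub_C _]
    simp [hcard b hb]
  -- The top coefficient is known to be 1 off `B` only; replacing `E d` by the constant 1 makes this
  -- an identity of polynomials.
  refine ⟨Function.update E d 1, by simp, fun k => ?_, fun b hb => ?_⟩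
  · by_cases hk : k = d
    · simp [hk]
    · rw [Function.update_of_ne hk]; exact hE k
  · conv_lhs => rw [(fibPoly l₁ l₂ f h b).as_sum_range_C_mul_X_pow, hdeg b hb]
    refine Finset.sum_congr rfl fun k _ => ?_
    by_cases hk : k = d
    · rw [hk, Function.update_self, eval_one, ← hdeg b hb, (hmonic b).coeff_natDegree]
    · rw [Function.update_of_ne hk, hEc k b hb]

end CharPoly

end Planarity

end

noncomputable section

namespace Planarity

/-! ### Forms -/

section Forms

open MvPolynomial

variable {n : ℕ}

/-- A linear form as a polynomial. -/
def linPoly (a : LinForm n) : MvPolynomial (Fin (n + 1)) ℂ :=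
  ∑ i, C (a (Pi.single i 1)) * X i

theorem eval_linPoly (a : LinForm n) (v : Fin (n + 1) → ℂ) : eval v (linPoly a) = a v := by
  simp only [linPoly, map_sum, map_mul, eval_C, eval_X]
  conv_rhs => rw [pi_eq_sum_univ' v, map_sum]
  refine Finset.sum_congr rfl fun i _ => ?_
  rw [map_smul, smul_eq_mul, mul_comm]

theorem isHomogeneous_linPoly (a : LinForm n) : (linPoly a).IsHomogeneous 1 :=
  IsHomogeneous.sum _ _ _ fun i _ => isHomogeneous_C_mul_X _ i

/-- Homogenization of a polynomial relation, with homogeneous coordinates `L₁, L₂, W`. -/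
theorem exists_form {E : ℕ → Polynomial ℂ} {d M : ℕ}
    (hE : ∀ k ≤ d, k + (E k).natDegree ≤ M) (hE0 : E d ≠ 0) (L₁ L₂ W : LinForm n)
    (hsurj : ∀ a b c, ∃ v, L₁ v = a ∧ L₂ v = b ∧ W v = c) :
    ∃ F : MvPolynomial (Fin (n + 1)) ℂ, F ≠ 0 ∧ F.IsHomogeneous M ∧ ∀ v, L₂ v ≠ 0 →
      eval v F = L₂ v ^ M *
        ∑ k ∈ Finset.range (d + 1), (E k).eval (L₁ v / L₂ v) * (W v / L₂ v) ^ k := by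
  set F : MvPolynomial (Fin (n + 1)) ℂ := ∑ k ∈ Finset.range (d + 1),
    ∑ j ∈ Finset.range ((E k).natDegree + 1),
      C ((E k).coeff j) * (linPoly L₁ ^ j * linPoly L₂ ^ (M - k - j) * linPoly W ^ k)
  have hF : ∀ v, L₂ v ≠ 0 → eval v F = L₂ v ^ M *
      ∑ k ∈ Finset.range (d + 1), (E k).eval (L₁ v / L₂ v) * (W v / L₂ v) ^ k := by
    intro v hv
    simp only [F, map_sum, map_mul, map_pow, eval_C, eval_linPoly, Finset.mul_sum,
      Polynomial.eval_eq_sum_range, Finset.sum_mul]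
    refine Finset.sum_congr rfl fun k hk => Finset.sum_congr rfl fun j hj => ?_
    have h1 := hE k (Nat.lt_succ_iff.1 (Finset.mem_range.1 hk))
    have h2 := Nat.lt_succ_iff.1 (Finset.mem_range.1 hj)
    have e : L₂ v ^ M = L₂ v ^ (M - k - j) * L₂ v ^ j * L₂ v ^ k := by
      rw [← pow_add, ← pow_add]; congr 1; omega
    rw [e, div_pow, div_pow]
    field_simp
  refine ⟨F, ?_, ?_, hF⟩
  -- For non-vanishing it is enough to find one point: fix the first coordinate at a non-zero of the
  -- leading coefficient `E d`, then move the last coordinate off the finitely many roots.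
  · obtain ⟨a, ha⟩ := Polynomial.exists_eval_ne_zero_of_natDegree_lt_card (E d) hE0
      (by simpa using Cardinal.natCast_lt_aleph0.trans_le (Cardinal.aleph0_le_mk ℂ))
    set p : Polynomial ℂ := ∑ k ∈ Finset.range (d + 1),
      Polynomial.C ((E k).eval a) * Polynomial.X ^ k
    have hp : p ≠ 0 := by
      intro h0
      have : p.coeff d = (E d).eval a := by
        simp only [p, Polynomial.finsetSum_coeff, Polynomial.coeff_C_mul_X_pow]
        simp
      rw [h0, Polynomial.coeff_zero] at this
      exact ha this.symm
    obtain ⟨w, hw⟩ := Polynomial.exists_eval_ne_zero_of_natDegree_lt_card p hp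
      (by simpa using Cardinal.natCast_lt_aleph0.trans_le (Cardinal.aleph0_le_mk ℂ))
    obtain ⟨v, h1, h2, h3⟩ := hsurj a 1 w
    intro h0
    have := hF v (by rw [h2]; exact one_ne_zero)
    rw [h0, h1, h2, h3] at this
    simp only [map_zero, one_pow, div_one, one_mul] at this
    refine hw ?_
    rw [this]
    simp [p, Polynomial.eval_finsetSum]
  · refine IsHomogeneous.sum _ _ _ fun k hk => IsHomogeneous.sum _ _ _ fun j hj => ?_
    have h1 := hE k (Nat.lt_succ_iff.1 (Finset.mem_range.1 hk))
    have h2 := Nat.lt_succ_iff.1 (Finset.mem_range.1 hj)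
    have := (((isHomogeneous_linPoly L₁).pow j).mul
      ((isHomogeneous_linPoly L₂).pow (M - k - j))).mul ((isHomogeneous_linPoly W).pow k)
    have e : 1 * j + 1 * (M - k - j) + 1 * k = M := by omega
    rw [e] at this
    exact this.C_mul _

theorem coeff_prod_sum_of_natDegree_le {ι : Type*} (s : Finset ι) (p : ι → Polynomial ℂ)
    (d : ι → ℕ) (h : ∀ i ∈ s, (p i).natDegree ≤ d i) :
    (∏ i ∈ s, p i).coeff (∑ i ∈ s, d i) = ∏ i ∈ s, (p i).coeff (d i) := by
  classical
  induction s using Finset.induction_on with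
  | empty => simp
  | insert i s hi ih =>
    have h' : ∀ j ∈ s, (p j).natDegree ≤ d j := fun j hj => h j (Finset.mem_insert_of_mem hj)
    rw [Finset.prod_insert hi, Finset.sum_insert hi, Finset.prod_insert hi,
      Polynomial.coeff_mul_add_eq_of_natDegree_le (h i (Finset.mem_insert_self i s))
        ((Polynomial.natDegree_prod_le _ _).trans (Finset.sum_le_sum h')), ih h']

/-- The restriction of a form to a parametrized line. -/
theorem exists_restrict {F : MvPolynomial (Fin (n + 1)) ℂ} {m : ℕ} (hF : F.IsHomogeneous m)
    (u k : Fin (n + 1) → ℂ) : ∃ P : Polynomial ℂ, P.natDegree ≤ m ∧ P.coeff m = eval k F ∧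
      ∀ y, P.eval y = eval (u + y • k) F := by
  set l : Fin (n + 1) → Polynomial ℂ := fun i => Polynomial.C (k i) * Polynomial.X +
    Polynomial.C (u i)
  have hl : ∀ i, (l i).natDegree ≤ 1 := fun i => Polynomial.natDegree_linear_le
  have hl1 : ∀ i, (l i).coeff 1 = k i := fun i => by simp [l, Polynomial.coeff_C]
  have hsum : ∀ s ∈ F.support, ∑ i ∈ s.support, s i = m := fun s hs => by
    rw [← hF.degree_eq_sum_deg_support hs]
  have hterm : ∀ s ∈ F.support, ((∏ i ∈ s.support, l i ^ s i).natDegree ≤ m ∧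
      (∏ i ∈ s.support, l i ^ s i).coeff m = ∏ i ∈ s.support, k i ^ s i) := by
    intro s hs
    have hd : ∀ i ∈ s.support, (l i ^ s i).natDegree ≤ s i := fun i _ => by
      simpa using Polynomial.natDegree_pow_le_of_le (s i) (hl i)
    constructor
    · rw [← hsum s hs]
      exact (Polynomial.natDegree_prod_le _ _).trans (Finset.sum_le_sum hd)
    · rw [← hsum s hs, coeff_prod_sum_of_natDegree_le _ _ _ hd]
      refine Finset.prod_congr rfl fun i _ => ?_
      have := Polynomial.coeff_pow_of_natDegree_le (m := s i) (hl i)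
      rwa [mul_one, hl1] at this
  refine ⟨∑ s ∈ F.support, Polynomial.C (F.coeff s) * ∏ i ∈ s.support, l i ^ s i, ?_, ?_, ?_⟩
  · refine Polynomial.natDegree_sum_le_of_forall_le _ _ fun s hs => ?_
    exact (Polynomial.natDegree_C_mul_le _ _).trans (hterm s hs).1
  · rw [Polynomial.finsetSum_coeff, eval_eq]
    refine Finset.sum_congr rfl fun s hs => ?_
    rw [Polynomial.coeff_C_mul, (hterm s hs).2]
  · intro y
    rw [Polynomial.eval_finsetSum, eval_eq]
    refine Finset.sum_congr rfl fun s _ => ?_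
    simp only [l, Polynomial.eval_mul, Polynomial.eval_C, Polynomial.eval_prod,
      Polynomial.eval_pow, Polynomial.eval_add, Polynomial.eval_X, Pi.add_apply, Pi.smul_apply,
      smul_eq_mul]
    congr 1
    refine Finset.prod_congr rfl fun i _ => ?_
    ring

end Forms

/-! ### Plane models -/

section Models

variable {C : Type*} [TopologicalSpace C] [ChartedSpace ℂ C] {f : C → CP 1} {ν : C → CP 2}

theorem exists_rep_eq_of_projection {T : (Fin 3 → ℂ) →ₗ[ℂ] (Fin 2 → ℂ)}
    (hT : ∀ (x : C) (h : T (ν x).rep ≠ 0), f x = Projectivization.mk ℂ (T (ν x).rep) h) {x : C}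
    (hx : T (ν x).rep ≠ 0) : ∃ c : ℂ, c ≠ 0 ∧ (f x).rep = c • T (ν x).rep :=
  exists_rep_eq_smul hx (hT x hx)

/-- A surjection `ℂ³ → ℂ²` in coordinates. -/
theorem exists_kernel_vector {T : (Fin 3 → ℂ) →ₗ[ℂ] (Fin 2 → ℂ)} (hT : Function.Surjective T) :
    ∃ (k : Fin 3 → ℂ) (R : (Fin 2 → ℂ) →ₗ[ℂ] (Fin 3 → ℂ)) (W : LinForm 2), k ≠ 0 ∧ T k = 0 ∧
      W k = 1 ∧ (∀ w, T (R w) = w) ∧ ∀ v, T v = 0 → ∃ c : ℂ, v = c • k := by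
  have hker : Module.finrank ℂ (LinearMap.ker T) = 1 := by
    have h1 := LinearMap.finrank_range_add_finrank_ker T
    rw [LinearMap.range_eq_top.2 hT, finrank_top] at h1
    simp at h1
    omega
  obtain ⟨⟨k, hk⟩, hk0, hk1⟩ := finrank_eq_one_iff'.1 hker
  obtain ⟨R, hR⟩ := T.exists_rightInverse_of_surjective (LinearMap.range_eq_top.2 hT)
  have hk' : k ≠ 0 := fun h => hk0 (Subtype.ext h)
  obtain ⟨i, hi⟩ := Function.ne_iff.1 hk'
  refine ⟨k, R, (k i)⁻¹ • LinearMap.proj i, hk', hk, ?_, fun w => LinearMap.congr_fun hR w,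
    fun v hv => ?_⟩
  · simpa using inv_mul_cancel₀ hi
  · obtain ⟨c, hc⟩ := hk1 ⟨v, hv⟩
    exact ⟨c, (congrArg Subtype.val hc).symm⟩

variable [IsManifold 𝓘(ℂ) ω C] [T2Space C] [CompactSpace C] [ConnectedSpace C]

theorem infinite_of_riemannSurface : Infinite C := by
  by_contra h
  rw [not_infinite_iff_finite] at h
  obtain ⟨x⟩ := (inferInstance : Nonempty C)
  have := eventually_nhdsNE_of_finite (C := C) (finite_univ) x
  obtain ⟨y, hy⟩ := this.exists
  exact hy (mem_univ y)

/-- Otherwise T ∘ ν vanishes identically. Then ν is constant, equal to the kernel line, and not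
generically injective. -/
theorem finite_center (hν : IsHolomorphic ν) (hb : IsBirationalOntoImage ν)
    {T : (Fin 3 → ℂ) →ₗ[ℂ] (Fin 2 → ℂ)} (hT : Function.Surjective T) :
    {x | T (ν x).rep = 0}.Finite := by
  by_contra hinf
  have h0 : ∀ i : Fin 2, ∀ x, T (ν x).rep i = 0 := by
    intro i
    refine (hν.finite_or_forall (LinearMap.proj i ∘ₗ T)).resolve_left fun h => hinf ?_
    exact h.subset fun x hx => by simp [show T (ν x).rep = 0 from hx]
  obtain ⟨k, R, W, hk, -, -, -, hk1⟩ := exists_kernel_vector hT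
  have hconst : ∀ x y, ν y = ν x := by
    have : ∀ x, ν x = Projectivization.mk ℂ k hk := fun x => by
      obtain ⟨c, hc⟩ := hk1 (ν x).rep (funext fun i => h0 i x)
      exact eq_mk_of_rep_eq_smul hk hc
    intro x y
    rw [this, this x]
  obtain ⟨S, hS, hSx⟩ := hb
  have := infinite_of_riemannSurface (C := C)
  obtain ⟨x, hx⟩ := hS.infinite_compl.nonempty
  obtain ⟨y, hy⟩ := exists_ne x
  exact (hSx x hx).1 y hy (hconst x y)

/-- A form vanishing along a plane model has degree at least `degree f`, and even greater if the
center of the projection lies on the curve. -/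
theorem degree_add_le_of_form (hf : IsHolomorphic f) (hn : Nonconstant f) (hν : IsHolomorphic ν)
    (hb : IsBirationalOntoImage ν) {T : (Fin 3 → ℂ) →ₗ[ℂ] (Fin 2 → ℂ)}
    (hT : Function.Surjective T)
    (hTf : ∀ (x : C) (h : T (ν x).rep ≠ 0), f x = Projectivization.mk ℂ (T (ν x).rep) h)
    {F : MvPolynomial (Fin 3) ℂ} {m : ℕ} (hF0 : F ≠ 0) (hF : F.IsHomogeneous m)
    (hFν : ∀ x, MvPolynomial.eval (ν x).rep F = 0) :
    degree f ≤ m ∧ ∀ x, T (ν x).rep = 0 → degree f + 1 ≤ m := by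
  obtain ⟨k, R, W, hk, hTk, -, hR, hk1⟩ := exists_kernel_vector hT
  obtain ⟨B, hB, hBd⟩ := exists_finite_degree hf hn
  have hZ := finite_center hν hb hT
  obtain ⟨S, hS, hSx⟩ := hb
  set Bad : Set (CP 1) := B ∪ f '' (S ∪ {x | T (ν x).rep = 0})
  have hBad : Bad.Finite := hB.union ((hS.union hZ).image f)
  -- Some line through the centre avoids the bad points and is not contained in the zeros of `F`.
  -- Otherwise `F` times the equations `G` of the finitely many bad lines would vanish on all of ℂ³.
  have hkey : ∃ a ∉ Bad, ∃ y : ℂ, MvPolynomial.eval (R a.rep + y • k) F ≠ 0 := by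
    by_contra! hall
    classical
    set G : MvPolynomial (Fin 3) ℂ :=
      -- Inserting `infinity` guarantees a factor, so `G` vanishes on the kernel of `T` even when
      -- `Bad` is empty.
      ∏ a ∈ insert infinity hBad.toFinset, linPoly (n := 2) (vanForm a ∘ₗ T)
    have hG : G ≠ 0 := by
      refine Finset.prod_ne_zero_iff.2 fun a _ h => vanForm_ne_zero a (LinearMap.ext fun w => ?_)
      have := eval_linPoly (n := 2) (vanForm a ∘ₗ T) (R w)
      rw [h, map_zero, LinearMap.comp_apply, hR] at this
      exact this.symm
    refine mul_ne_zero hF0 hG (MvPolynomial.funext fun v => ?_)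
    rw [map_mul, map_zero, mul_eq_zero]
    have hzero : ∀ a ∈ insert infinity hBad.toFinset, vanForm a (T v) = 0 →
        MvPolynomial.eval v G = 0 := fun a ha h => by
      rw [MvPolynomial.eval_prod]
      exact Finset.prod_eq_zero ha (by rw [eval_linPoly]; exact h)
    by_cases hv : T v = 0
    · exact Or.inr (hzero infinity (Finset.mem_insert_self _ _) (by rw [hv, map_zero]))
    · set a := Projectivization.mk ℂ (T v) hv
      obtain ⟨c, hc, e⟩ : ∃ c : ℂ, c ≠ 0 ∧ a.rep = c • T v := exists_rep_eq_smul hv rfl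
      have e' : T v = c⁻¹ • a.rep := by rw [e, smul_smul, inv_mul_cancel₀ hc, one_smul]
      by_cases haB : a ∈ Bad
      · exact Or.inr (hzero a (Finset.mem_insert_of_mem (hBad.mem_toFinset.2 haB))
          (by rw [e', map_smul, vanForm_self, smul_zero]))
      · left
        obtain ⟨y, hy⟩ := hk1 (c • v - R a.rep) (by rw [map_sub, hR, map_smul, e, sub_self])
        have e2 : v = c⁻¹ • (R a.rep + y • k) := by
          rw [← hy, add_sub_cancel, smul_smul, inv_mul_cancel₀ hc, one_smul]
        rw [e2, eval_smul_of_isHomogeneous hF, hall a haB y, mul_zero]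
  obtain ⟨a, ha, y₀, hy₀⟩ := hkey
  obtain ⟨P, hPd, hPm, hP⟩ := exists_restrict hF (R a.rep) k
  have hP0 : P ≠ 0 := by rintro rfl; exact hy₀ (by rw [← hP]; simp)
  rw [mem_union, not_or] at ha
  -- ν sends the fibre over `a` into the chosen line minus the centre. The affine parameters of the
  -- image points are roots of `P`, and they are distinct because the fibre avoids `S`.
  have hpt : ∀ x ∈ f ⁻¹' {a}, ∃ y : ℂ, P.eval y = 0 ∧ ∃ c : ℂ, c ≠ 0 ∧
      (ν x).rep = c • (R a.rep + y • k) := by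
    intro x hx
    have hxT : T (ν x).rep ≠ 0 := fun h => ha.2 ⟨x, Or.inr h, hx⟩
    obtain ⟨c, hc, e⟩ := exists_rep_eq_of_projection hTf hxT
    rw [show f x = a from hx] at e
    obtain ⟨y, hy⟩ := hk1 (c • (ν x).rep - R a.rep) (by rw [map_sub, hR, map_smul, e, sub_self])
    have e2 : (ν x).rep = c⁻¹ • (R a.rep + y • k) := by
      rw [← hy, add_sub_cancel, smul_smul, inv_mul_cancel₀ hc, one_smul]
    refine ⟨y, ?_, c⁻¹, inv_ne_zero hc, e2⟩
    have := hFν x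
    rw [e2, eval_smul_of_isHomogeneous hF] at this
    rw [hP]
    exact (mul_eq_zero.1 this).resolve_left (pow_ne_zero _ (inv_ne_zero hc))
  choose! y hy c hc hyc using hpt
  have hfin := finite_preimage hf hn a
  have hinj : InjOn y (f ⁻¹' {a}) := by
    intro x hx x' hx' e
    by_contra hne
    have hxS : x ∉ S := fun h => ha.2 ⟨x, Or.inl h, hx⟩
    refine (hSx x hxS).1 x' (Ne.symm hne) ?_
    rw [← (ν x).mk_rep]
    refine eq_mk_of_rep_eq_smul _ (c := c x' * (c x)⁻¹) ?_
    rw [hyc x' hx', hyc x hx, e, smul_smul, mul_assoc, inv_mul_cancel₀ (hc x hx), mul_one]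
  have hdeg : degree f ≤ P.natDegree := by
    classical
    rw [← (hBd a ha.1).1, ncard_eq_toFinset_card _ hfin, ← Finset.card_image_of_injOn
      (f := y) (by simpa using hinj)]
    refine Polynomial.card_le_degree_of_subset_roots fun z hz => ?_
    obtain ⟨x, hx, rfl⟩ := Finset.mem_image.1 hz
    exact (Polynomial.mem_roots hP0).2 (hy x (hfin.mem_toFinset.1 hx))
  refine ⟨hdeg.trans hPd, fun x hx => ?_⟩
  have hkF : MvPolynomial.eval k F = 0 := by
    obtain ⟨c, e⟩ := hk1 _ hx
    have := hFν x
    have hc : c ≠ 0 := by rintro rfl; exact (ν x).rep_nonzero (by rw [e, zero_smul])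
    rw [e, eval_smul_of_isHomogeneous hF] at this
    exact (mul_eq_zero.1 this).resolve_left (pow_ne_zero _ hc)
  -- The coefficient of degree `m` of `P` is the value of `F` at the centre `k`. It vanishes when
  -- the curve passes through the centre, which costs one root.
  have : P.natDegree ≠ m := by
    intro h
    rw [hkF, ← h] at hPm
    exact hP0 (Polynomial.leadingCoeff_eq_zero.1 hPm)
  omega

end Models

end Planarity

end

noncomputable section

namespace Planarity

/-! ### Equations of plane models -/

section Bounds

variable {C : Type*} [TopologicalSpace C] [ChartedSpace ℂ C]

theorem exists_bound_of_local [CompactSpace C] {H : C → ℝ}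
    (h : ∀ x, ∃ K, ∀ᶠ y in 𝓝[≠] x, H y ≤ K) : ∃ K, ∀ y, H y ≤ K := by
  choose K hK using h
  have h' : ∀ x, {y | H y ≤ max (K x) (H x)} ∈ 𝓝 x := by
    intro x
    filter_upwards [eventually_nhdsWithin_iff.1 (hK x)] with y hy
    by_cases e : y = x
    · rw [e]; exact le_max_right _ _
    · exact (hy e).trans (le_max_left _ _)
  obtain ⟨t, -, ht⟩ := isCompact_univ.elim_nhds_subcover _ fun x _ => h' x
  obtain ⟨M, hM⟩ := (t.finite_toSet.image fun x => max (K x) (H x)).bddAbove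
  refine ⟨M, fun y => ?_⟩
  obtain ⟨x, hx, hxy⟩ := mem_iUnion₂.1 (ht (mem_univ y))
  exact hxy.trans (hM ⟨x, hx, rfl⟩)

theorem HolAt.exists_bound {g : C → ℂ} {x : C} (hg : HolAt g x) :
    ∃ K, ∀ᶠ y in 𝓝[≠] x, ‖g y‖ ≤ K := by
  refine ⟨‖g x‖ + 1, nhdsWithin_le_nhds ?_⟩
  filter_upwards [hg.continuousAt.norm.eventually_lt continuousAt_const
    (show ‖g x‖ < ‖g x‖ + 1 by linarith)] with y hy using hy.le

/-- A sufficiently high power of a function vanishing at `x` kills a pole at `x`. -/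
theorem Mero.exists_pow_bound {g ψ : C → ℂ} {x : C} (hg : Mero g) (hψ : HolAt ψ x) (h0 : ψ x = 0) :
    ∃ n₀, ∀ n ≥ n₀, ∃ K, ∀ᶠ y in 𝓝[≠] x, ‖ψ y ^ n * g y‖ ≤ K := by
  obtain ⟨n₀, hn₀⟩ := hg x
  refine ⟨n₀, fun n hn => ?_⟩
  have h1 : (1 : ℕ∞) ≤ analyticOrderAt (inChart x ψ) (chartAt ℂ x x) := by
    rw [Order.one_le_iff_ne_zero, AnalyticAt.analyticOrderAt_ne_zero hψ, inChart_apply_self, h0]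
  obtain ⟨u, hu, e⟩ := (natCast_le_analyticOrderAt hψ (n := 1)).1 h1
  set G : ℂ → ℂ := fun z => inChart x ψ z ^ (n - n₀) * u z ^ n₀ *
    ((z - chartAt ℂ x x) ^ n₀ • inChart x g z)
  have hG : AnalyticAt ℂ G (chartAt ℂ x x) := ((AnalyticAt.pow hψ _).mul (hu.pow _)).mul hn₀
  refine ⟨‖G (chartAt ℂ x x)‖ + 1, ?_⟩
  rw [eventually_ne_iff_inChart]
  refine nhdsWithin_le_nhds ?_
  filter_upwards [e, hG.continuousAt.norm.eventually_lt continuousAt_const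
    (show ‖G (chartAt ℂ x x)‖ < ‖G (chartAt ℂ x x)‖ + 1 by linarith)] with z hz hlt
  refine le_trans (le_of_eq ?_) hlt.le
  congr 1
  change inChart x ψ z ^ n * inChart x g z = _
  simp only [G]
  rw [show n = (n - n₀) + n₀ by omega, pow_add, Nat.add_sub_cancel]
  nth_rw 2 [hz]
  simp only [pow_one, smul_eq_mul, mul_pow]
  ring

theorem exists_norm_eval_le (q : Polynomial ℂ) :
    ∃ K, 0 ≤ K ∧ ∀ z, ‖q.eval z‖ ≤ K * (1 + ‖z‖) ^ q.natDegree := by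
  refine ⟨∑ i ∈ Finset.range (q.natDegree + 1), ‖q.coeff i‖,
    Finset.sum_nonneg fun i _ => norm_nonneg _, fun z => ?_⟩
  rw [Polynomial.eval_eq_sum_range, Finset.sum_mul]
  refine (norm_sum_le _ _).trans (Finset.sum_le_sum fun i hi => ?_)
  rw [norm_mul, norm_pow]
  gcongr
  calc ‖z‖ ^ i ≤ (1 + ‖z‖) ^ i := by gcongr; linarith
    _ ≤ _ := pow_le_pow_right₀ (by linarith [norm_nonneg z])
      (Nat.lt_succ_iff.1 (Finset.mem_range.1 hi))

variable [IsManifold 𝓘(ℂ) ω C] [CompactSpace C]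

/-- The ratio of the two sides is homogeneous of degree 0 in the lift, hence a continuous function
on a compact space, although the chosen representatives are not continuous. -/
theorem IsHolomorphic.exists_bound {n : ℕ} {φ : C → CP n} (hφ : IsHolomorphic φ)
    {a b : LinForm n} (h : ∀ x, a (φ x).rep ≠ 0 ∨ b (φ x).rep ≠ 0) (c : LinForm n) :
    ∃ K, ∀ x, ‖c (φ x).rep‖ ≤ K * (‖a (φ x).rep‖ + ‖b (φ x).rep‖) := by
  have hpos : ∀ x, 0 < ‖a (φ x).rep‖ + ‖b (φ x).rep‖ := fun x => by
    rcases h x with h | h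
    · exact add_pos_of_pos_of_nonneg (norm_pos_iff.2 h) (norm_nonneg _)
    · exact add_pos_of_nonneg_of_pos (norm_nonneg _) (norm_pos_iff.2 h)
  obtain ⟨K, hK⟩ := exists_bound_of_local
    (H := fun x => ‖c (φ x).rep‖ / (‖a (φ x).rep‖ + ‖b (φ x).rep‖)) fun x => by
    obtain ⟨s, hs⟩ := hφ.exists_isLift x
    have hcont : ContinuousAt (fun y => ‖c (s y)‖ / (‖a (s y)‖ + ‖b (s y)‖)) x := by
      refine (hs.1 c).continuousAt.norm.div
        ((hs.1 a).continuousAt.norm.add (hs.1 b).continuousAt.norm) ?_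
      obtain ⟨k, hk, e⟩ := hs.rep_eq
      have := hpos x
      rw [e, map_smul, map_smul, norm_smul, norm_smul, ← mul_add] at this
      exact (pos_of_mul_pos_right this (norm_nonneg k)).ne'
    refine ⟨‖c (s x)‖ / (‖a (s x)‖ + ‖b (s x)‖) + 1, nhdsWithin_le_nhds ?_⟩
    filter_upwards [hcont.eventually_lt continuousAt_const (lt_add_one _), hs.2]
      with y hy ⟨k, hk, e⟩
    refine le_trans (le_of_eq ?_) hy.le
    rw [e, map_smul, map_smul, map_smul, norm_smul, norm_smul, norm_smul, ← mul_add,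
      mul_div_mul_left _ _ (norm_ne_zero_iff.2 hk)]
  exact ⟨K, fun x => (div_le_iff₀ (hpos x)).1 (hK x)⟩

end Bounds

/-! ### From growth conditions to homogeneous equations. -/

section Equations

variable {C : Type*} [TopologicalSpace C] [ChartedSpace ℂ C] [IsManifold 𝓘(ℂ) ω C]
  [T2Space C] [CompactSpace C] [ConnectedSpace C] {f : C → CP 1} {ν : C → CP 2}

theorem eval_fibPoly_eq_zero (hf : IsHolomorphic f) (hn : Nonconstant f) {l₁ l₂ : LinForm 1}
    (hl : NoCommonZero l₁ l₂) {h : C → ℂ} {b : ℂ} {x : C} (hx : x ∈ fib l₁ l₂ f b) :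
    (fibPoly l₁ l₂ f h b).eval (h x) = 0 := by
  rw [fibPoly, finprod_mem_eq_finite_toFinset_prod _ (finite_fib hf hn hl b),
    Polynomial.eval_prod]
  exact Finset.prod_eq_zero ((finite_fib hf hn hl b).mem_toFinset.2 hx) (by simp)

/-- The equation of a plane model, from a growth condition on an affine coordinate. -/
theorem exists_form_of_growth (hf : IsHolomorphic f) (hn : Nonconstant f) (hν : IsHolomorphic ν)
    {l₁ l₂ : LinForm 1} (hl : NoCommonZero l₁ l₂) {L₁ L₂ W : LinForm 2}
    (hsurj : ∀ a b c, ∃ v, L₁ v = a ∧ L₂ v = b ∧ W v = c) {Z : Set C} (hZ : Z.Finite)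
    (hquot : ∀ x ∉ Z, l₂ (f x).rep ≠ 0 →
      L₂ (ν x).rep ≠ 0 ∧ quot L₁ L₂ ν x = quot l₁ l₂ f x)
    {q : Polynomial ℂ} (hq : q ≠ 0) {N M : ℕ} {K : ℝ}
    (hK : ∀ x, l₂ (f x).rep ≠ 0 → ‖q.eval (quot l₁ l₂ f x) * quot W L₂ ν x‖ ≤
      K * (1 + ‖quot l₁ l₂ f x‖) ^ N)
    (hM : ∀ k ≤ degree f, k + (N * (degree f - k) + k * q.natDegree) ≤ M) :
    ∃ F : MvPolynomial (Fin 3) ℂ, F ≠ 0 ∧ F.IsHomogeneous M ∧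
      ∀ x, MvPolynomial.eval (ν x).rep F = 0 := by
  obtain ⟨B₁, hB₁, hBd⟩ := exists_finite_degree_fib hf hn hl
  set φ := quot l₁ l₂ f
  set h : C → ℂ := fun x => q.eval (φ x) * quot W L₂ ν x
  set B : Set ℂ := B₁ ∪ φ '' Z
  have hB : B.Finite := hB₁.union (hZ.image _)
  have hφ : ∀ b, ∀ x ∈ fib l₁ l₂ f b, φ x = b := fun b x hx =>
    (mem_fib_iff (hl.ne_zero_of_mem_fib hx)).1 hx
  have hBZ : ∀ b ∉ B, ∀ x ∈ fib l₁ l₂ f b, x ∉ Z := fun b hb x hx hxZ =>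
    hb (Or.inr ⟨x, hxZ, hφ b x hx⟩)
  obtain ⟨E, hEd, hEdeg, hE⟩ := exists_charPoly hf hn hl (h := h) hB (d := degree f) (N := N)
    (K := K) (fun b hb => (hBd b fun h => hb (Or.inl h)).1)
    (fun b hb => (hBd b fun h => hb (Or.inl h)).2)
    (fun b hb x hx => by
      have h2 := hl.ne_zero_of_mem_fib hx
      exact ((hf.holAt_quot l₁ h2).eval_polynomial q).mul
        (hν.holAt_quot W (hquot x (hBZ b hb x hx) h2).1))
    (fun b hb x hx => by
      rw [← hφ b x hx]
      exact hK x (hl.ne_zero_of_mem_fib hx))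
  -- The characteristic polynomial is that of q(φ) · W/L₂. Rewritten in W/L₂ its k-th coefficient
  -- becomes `E k * q ^ k`, of degree at most N (d - k) + k deg q.
  obtain ⟨F, hF0, hF, hFe⟩ := exists_form (E := fun k => E k * q ^ k) (d := degree f) (M := M)
    (fun k hk => by
      refine le_trans ?_ (hM k hk)
      have h1 := Polynomial.natDegree_mul_le (p := E k) (q := q ^ k)
      have h2 := Polynomial.natDegree_pow_le (p := q) (n := k)
      have h3 := hEdeg k
      omega) (by rw [hEd, one_mul]; exact pow_ne_zero _ hq) L₁ L₂ W hsurj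
  refine ⟨F, hF0, hF, hν.eval_eq_zero hF ?_⟩
  refine ((finite_zeros hf hn (l := l₂) ?_).union
    (hZ.union (hB.biUnion fun b _ => finite_fib hf hn hl b))).subset fun x hx => ?_
  · rintro rfl
    exact hl.symm.sub_smul_ne_zero 0 (by simp)
  · by_contra hbad
    rw [mem_union, mem_union, not_or, not_or] at hbad
    obtain ⟨h1, h2, h3⟩ := hbad
    have hxf : x ∈ fib l₁ l₂ f (φ x) := (mem_fib_iff h1).2 rfl
    have hb : φ x ∉ B := fun hb => h3 (mem_biUnion hb hxf)
    obtain ⟨h4, h5⟩ := hquot x h2 h1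
    refine hx ?_
    have := eval_fibPoly_eq_zero hf hn hl (h := h) hxf
    rw [hE _ hb, Polynomial.eval_finsetSum] at this
    rw [hFe _ h4, mul_eq_zero]
    right
    rw [← this]
    refine Finset.sum_congr rfl fun k _ => ?_
    change (E k * q ^ k).eval (quot L₁ L₂ ν x) * quot W L₂ ν x ^ k = _
    rw [h5]
    simp only [Polynomial.eval_mul, Polynomial.eval_pow, Polynomial.eval_C, Polynomial.eval_X, h,
      mul_pow, φ]
    ring

/-- The coordinates on `ℂ³` adapted to a projection. -/
theorem exists_adapted_coordinates {T : (Fin 3 → ℂ) →ₗ[ℂ] (Fin 2 → ℂ)}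
    (hT : Function.Surjective T) : ∃ W : LinForm 2, (∀ a b c, ∃ v,
      (LinearMap.proj 0 ∘ₗ T) v = a ∧ (LinearMap.proj 1 ∘ₗ T) v = b ∧ W v = c) ∧
      ∀ v, T v = 0 → W v = 0 → v = 0 := by
  obtain ⟨k, R, W, hk, hTk, hW, hR, hk1⟩ := exists_kernel_vector hT
  refine ⟨W, fun a b c => ⟨R ![a, b] + (c - W (R ![a, b])) • k, ?_, ?_, ?_⟩, fun v hv hWv => ?_⟩
  · simp [hR, hTk]
  · simp [hR, hTk]
  · simp [hW]
  · obtain ⟨c, rfl⟩ := hk1 v hv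
    simp only [map_smul, hW, smul_eq_mul, mul_one] at hWv
    rw [hWv, zero_smul]

theorem noCommonZero_proj : NoCommonZero (LinearMap.proj 0) (LinearMap.proj 1) := by
  intro w h1 h2
  ext i; fin_cases i
  · exact h1
  · exact h2

theorem quot_comp_eq {T : (Fin 3 → ℂ) →ₗ[ℂ] (Fin 2 → ℂ)}
    (hTf : ∀ (x : C) (h : T (ν x).rep ≠ 0), f x = Projectivization.mk ℂ (T (ν x).rep) h)
    (l₁ l₂ : LinForm 1) {x : C} (hx : T (ν x).rep ≠ 0) (h2 : l₂ (f x).rep ≠ 0) :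
    (l₂ ∘ₗ T) (ν x).rep ≠ 0 ∧ quot (l₁ ∘ₗ T) (l₂ ∘ₗ T) ν x = quot l₁ l₂ f x := by
  obtain ⟨c, hc, e⟩ := exists_rep_eq_of_projection hTf hx
  rw [quot, quot, e, map_smul, map_smul, LinearMap.comp_apply, LinearMap.comp_apply, smul_eq_mul,
    smul_eq_mul, mul_div_mul_left _ _ hc]
  rw [e, map_smul] at h2
  exact ⟨right_ne_zero_of_smul h2, rfl⟩

/-- If the center of projection does not lie on the curve, the curve has an equation of degree
`degree f`. -/
theorem exists_form_of_forall_ne (hf : IsHolomorphic f) (hn : Nonconstant f) (hν : IsHolomorphic ν)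
    {T : (Fin 3 → ℂ) →ₗ[ℂ] (Fin 2 → ℂ)} (hT : Function.Surjective T)
    (hTf : ∀ (x : C) (h : T (ν x).rep ≠ 0), f x = Projectivization.mk ℂ (T (ν x).rep) h)
    (h0 : ∀ x, T (ν x).rep ≠ 0) :
    ∃ F : MvPolynomial (Fin 3) ℂ, F ≠ 0 ∧ F.IsHomogeneous (degree f) ∧
      ∀ x, MvPolynomial.eval (ν x).rep F = 0 := by
  obtain ⟨W, hW, -⟩ := exists_adapted_coordinates hT
  obtain ⟨K, hK⟩ := hν.exists_bound (a := LinearMap.proj 0 ∘ₗ T) (b := LinearMap.proj 1 ∘ₗ T)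
    (fun x => by
      by_contra! h
      exact h0 x (noCommonZero_proj _ h.1 h.2)) W
  -- With the centre off the curve there are no poles to clear, so q = 1. The third coordinate grows
  -- linearly, so N = 1, and k + (d - k) = d is the degree of the form.
  refine exists_form_of_growth hf hn hν noCommonZero_proj hW (Z := ∅) finite_empty
    (fun x _ h2 => quot_comp_eq hTf _ _ (h0 x) h2) (q := 1) one_ne_zero (N := 1) (K := K)
    (fun x hx => ?_) (fun k hk => by simp; omega)
  obtain ⟨h2, e⟩ := quot_comp_eq hTf (LinearMap.proj 0) (LinearMap.proj 1) (h0 x) hx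
  rw [Polynomial.eval_one, one_mul, pow_one, ← e, quot, quot, norm_div, norm_div,
    div_le_iff₀ (norm_pos_iff.2 h2), mul_assoc]
  refine (hK x).trans (le_of_eq ?_)
  congr 1
  have := norm_ne_zero_iff.2 h2
  field_simp
  ring

/-- Every plane model has an equation. -/
theorem exists_form_of_model (hf : IsHolomorphic f) (hn : Nonconstant f) (hν : IsHolomorphic ν)
    (hb : IsBirationalOntoImage ν) {T : (Fin 3 → ℂ) →ₗ[ℂ] (Fin 2 → ℂ)}
    (hT : Function.Surjective T)
    (hTf : ∀ (x : C) (h : T (ν x).rep ≠ 0), f x = Projectivization.mk ℂ (T (ν x).rep) h) :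
    ∃ (M : ℕ) (F : MvPolynomial (Fin 3) ℂ), F ≠ 0 ∧ F.IsHomogeneous M ∧
      ∀ x, MvPolynomial.eval (ν x).rep F = 0 := by
  obtain ⟨W, hW, -⟩ := exists_adapted_coordinates hT
  set l₁ : LinForm 1 := LinearMap.proj 0
  set l₂ : LinForm 1 := LinearMap.proj 1
  have hl : NoCommonZero l₁ l₂ := noCommonZero_proj
  have hl2 : l₂ ≠ 0 := by
    intro h
    have := hl.symm.sub_smul_ne_zero 0
    simp [h] at this
  set Z : Set C := {x | T (ν x).rep = 0}
  have hZ : Z.Finite := finite_center hν hb hT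
  set g := quot W (l₂ ∘ₗ T) ν
  have hg : Mero g := hν.mero_quot _ _
  set φ := quot l₁ l₂ f
  have hP := finite_zeros hf hn hl2
  -- local coordinates on the line, pulled back to `C`
  have hpow : ∀ x, ∃ n₀, ∀ n ≥ n₀, ∃ K, ∀ᶠ y in 𝓝[≠] x,
      ‖(if l₂ (f x).rep = 0 then quot l₂ l₁ f y else φ y - φ x) ^ n * g y‖ ≤ K := by
    intro x
    by_cases hx : l₂ (f x).rep = 0
    · simp only [hx, if_true]
      have h1 : l₁ (f x).rep ≠ 0 := fun h => (f x).rep_nonzero (hl _ h hx)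
      exact hg.exists_pow_bound (hf.holAt_quot l₂ h1) (by simp [quot, hx])
    · simp only [hx, if_false]
      exact hg.exists_pow_bound ((hf.holAt_quot l₁ hx).sub (HolAt.const _)) (by simp [φ])
  choose n₀ hn₀ using hpow
  have hR : (Z ∪ {x | l₂ (f x).rep = 0}).Finite := hZ.union hP
  -- The order `n` kills all poles of `g` over the centre or over infinity. The polynomial `q`
  -- clears those at finite distance; points of `Z` with `l₂ = 0` only add a harmless factor,
  -- because φ has value 0 there by convention.
  obtain ⟨n, hnR⟩ := (hR.image n₀).bddAbove
  set q : Polynomial ℂ := ∏ x ∈ hZ.toFinset, (Polynomial.X - Polynomial.C (φ x)) ^ n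
  have hq : q ≠ 0 := Finset.prod_ne_zero_iff.2 fun x _ =>
    pow_ne_zero _ (Polynomial.X_sub_C_ne_zero _)
  obtain ⟨Kq, hKq0, hKq⟩ := exists_norm_eval_le q
  -- Over infinity, φ⁻¹ is a local coordinate of the line, and the factor (1 + |φ|) ^ n makes up for
  -- the pole of `g` there.
  obtain ⟨K, hK⟩ := exists_bound_of_local
    (H := fun y => if l₂ (f y).rep = 0 then 0 else
      ‖q.eval (φ y) * g y‖ / (1 + ‖φ y‖) ^ (q.natDegree + n)) fun x => by
    have h1 : ∀ y, 1 ≤ 1 + ‖φ y‖ := fun y => by linarith [norm_nonneg (φ y)]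
    by_cases hx : l₂ (f x).rep = 0
    · obtain ⟨K, hK⟩ := hn₀ x n (hnR ⟨x, Or.inr hx, rfl⟩)
      simp only [hx, if_true] at hK
      refine ⟨Kq * max K 0, ?_⟩
      have h2 : ∀ᶠ y in 𝓝[≠] x, l₂ (f y).rep ≠ 0 := eventually_nhdsNE_of_finite hP x
      have h3 : l₁ (f x).rep ≠ 0 := fun h => (f x).rep_nonzero (hl _ h hx)
      filter_upwards [hK, h2, nhdsWithin_le_nhds ((hf.isOpen_ne l₁).mem_nhds h3)] with y hy h2 h3
      have h3' : l₁ (f y).rep ≠ 0 := h3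
      rw [if_neg h2, norm_mul, div_le_iff₀ (pow_pos (by linarith [h1 y]) _), pow_add]
      have e : quot l₂ l₁ f y = (φ y)⁻¹ := by simp only [quot, φ, inv_div]
      have hφ0 : φ y ≠ 0 := div_ne_zero h3' h2
      have hg' : ‖g y‖ ≤ max K 0 * (1 + ‖φ y‖) ^ n := by
        rw [e, norm_mul, norm_pow, norm_inv, inv_pow,
          inv_mul_le_iff₀ (pow_pos (norm_pos_iff.2 hφ0) _)] at hy
        calc ‖g y‖ ≤ ‖φ y‖ ^ n * K := hy
          _ ≤ ‖φ y‖ ^ n * max K 0 :=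
            mul_le_mul_of_nonneg_left (le_max_left _ _) (by positivity)
          _ ≤ (1 + ‖φ y‖) ^ n * max K 0 :=
            mul_le_mul_of_nonneg_right (pow_le_pow_left₀ (norm_nonneg _) (by linarith) n)
              (le_max_right _ _)
          _ = _ := mul_comm _ _
      calc ‖q.eval (φ y)‖ * ‖g y‖ ≤ (Kq * (1 + ‖φ y‖) ^ q.natDegree) *
            (max K 0 * (1 + ‖φ y‖) ^ n) := by
            have := hKq (φ y)
            gcongr
        _ = _ := by ring
    · have hloc : ∃ K, ∀ᶠ y in 𝓝[≠] x, ‖q.eval (φ y) * g y‖ ≤ K := by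
        have hφx : HolAt φ x := hf.holAt_quot l₁ hx
        by_cases hxZ : x ∈ Z
        · obtain ⟨K, hK⟩ := hn₀ x n (hnR ⟨x, Or.inl hxZ, rfl⟩)
          simp only [hx, if_false] at hK
          classical
          have e : q = (Polynomial.X - Polynomial.C (φ x)) ^ n *
              ∏ x ∈ hZ.toFinset.erase x, (Polynomial.X - Polynomial.C (φ x)) ^ n :=
            (Finset.mul_prod_erase _ _ (hZ.mem_toFinset.2 hxZ)).symm
          obtain ⟨K', hK'⟩ := (hφx.eval_polynomial
            (∏ x ∈ hZ.toFinset.erase x, (Polynomial.X - Polynomial.C (φ x)) ^ n)).exists_bound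
          refine ⟨K' * K, ?_⟩
          filter_upwards [hK, hK'] with y h1 h2
          have e2 : q.eval (φ y) * g y = (∏ x ∈ hZ.toFinset.erase x,
              (Polynomial.X - Polynomial.C (φ x)) ^ n).eval (φ y) * ((φ y - φ x) ^ n * g y) := by
            rw [e, Polynomial.eval_mul, Polynomial.eval_pow, Polynomial.eval_sub,
              Polynomial.eval_X, Polynomial.eval_C]
            ring
          rw [e2, norm_mul]
          exact mul_le_mul h2 h1 (norm_nonneg _) ((norm_nonneg _).trans h2)
        · exact ((hφx.eval_polynomial q).mul
            (hν.holAt_quot W (quot_comp_eq hTf l₁ l₂ hxZ hx).1)).exists_bound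
      obtain ⟨K, hK⟩ := hloc
      refine ⟨K, ?_⟩
      filter_upwards [hK] with y hy
      have hK0 : 0 ≤ K := (norm_nonneg _).trans hy
      split_ifs
      · exact hK0
      · exact (div_le_self (norm_nonneg _) (one_le_pow₀ (h1 y))).trans hy
  obtain ⟨F, hF0, hF, hFν⟩ := exists_form_of_growth hf hn hν hl hW hZ
    (fun x hx h2 => quot_comp_eq hTf l₁ l₂ hx h2) hq (N := q.natDegree + n) (K := K)
    -- A generous degree: only the existence of some equation matters here.
    (M := degree f + ((q.natDegree + n) * degree f + degree f * q.natDegree)) (fun x hx => by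
      have := hK x
      rw [if_neg hx, div_le_iff₀ (pow_pos (by linarith [norm_nonneg (φ x)]) _)] at this
      exact this) (fun k hk => by
      gcongr
      exact Nat.sub_le _ _)
  exact ⟨_, F, hF0, hF, hFν⟩

end Equations

end Planarity

end

noncomputable section

namespace Planarity

/-! ### Sections of `f^* 𝒪(1)` -/

variable {C : Type*} [TopologicalSpace C] [ChartedSpace ℂ C] {f : C → CP 1}

theorem rep_mem_submodule (a : CP 1) : a.rep ∈ a.submodule := by
  rw [a.submodule_eq]
  exact Submodule.mem_span_singleton_self _

/-- The value of a section of `f^* 𝒪(1)` on the chosen representatives. -/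
def secVal (f : C → CP 1) : (∀ x : C, Module.Dual ℂ (f x).submodule) →ₗ[ℂ] C → ℂ where
  toFun σ x := σ x ⟨(f x).rep, rep_mem_submodule _⟩
  map_add' _ _ := rfl
  map_smul' _ _ := rfl

theorem apply_eq_mul_secVal (σ : ∀ x : C, Module.Dual ℂ (f x).submodule) {x : C} {w : Fin 2 → ℂ}
    (hw : w ∈ (f x).submodule) {l : LinForm 1} (hl : l (f x).rep ≠ 0) :
    σ x ⟨w, hw⟩ = l w * (secVal f σ x / l (f x).rep) := by
  have h := hw
  rw [Projectivization.submodule_eq] at h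
  obtain ⟨c, rfl⟩ := Submodule.mem_span_singleton.1 h
  have e : (⟨c • (f x).rep, hw⟩ : (f x).submodule) = c • ⟨(f x).rep, rep_mem_submodule _⟩ := rfl
  rw [e, map_smul, map_smul]
  change c * secVal f σ x = c * l _ * _
  field_simp

theorem secVal_injective : Function.Injective (secVal f) := by
  intro σ τ h
  funext x
  ext ⟨w, hw⟩
  rw [apply_eq_mul_secVal σ hw (innerForm_self_ne_zero _),
    apply_eq_mul_secVal τ hw (innerForm_self_ne_zero _), h]

/-- The section of `f^* 𝒪(1)` with given values on the chosen representatives. -/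
def ofVal (f : C → CP 1) : (C → ℂ) →ₗ[ℂ] (∀ x : C, Module.Dual ℂ (f x).submodule) where
  toFun v x := (v x / innerForm (f x) (f x).rep) • (innerForm (f x) ∘ₗ (f x).submodule.subtype)
  map_add' v w := by
    funext x
    simp only [Pi.add_apply, add_div, add_smul]
  map_smul' c v := by
    funext x
    simp only [Pi.smul_apply, smul_eq_mul, mul_div_assoc, mul_smul, RingHom.id_apply]

theorem secVal_ofVal (v : C → ℂ) : secVal f (ofVal f v) = v := by
  funext x
  have := innerForm_self_ne_zero (f x)
  simp [secVal, ofVal, this]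

theorem mdifferentiableAt_pi {n : ℕ} {s : C → (Fin n → ℂ)} {x : C}
    (h : ∀ i, MDifferentiableAt 𝓘(ℂ) 𝓘(ℂ) (fun y => s y i) x) :
    MDifferentiableAt 𝓘(ℂ) 𝓘(ℂ, Fin n → ℂ) s x := by
  simp only [mdifferentiableAt_iff] at h ⊢
  exact ⟨continuousAt_pi.2 fun i => (h i).1, differentiableWithinAt_pi.2 fun i => (h i).2⟩

variable [IsManifold 𝓘(ℂ) ω C]

/-- The chosen representatives need not vary holomorphically, but divided by their value under `l`
they form a holomorphic frame of f^*𝒪(-1), on which the section may be evaluated. -/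
theorem holAt_secVal_div (hf : IsHolomorphic f) {σ : ∀ x : C, Module.Dual ℂ (f x).submodule}
    (hσ : σ ∈ globalSections f) {l : LinForm 1} {x : C} (hx : l (f x).rep ≠ 0) :
    HolAt (fun y => secVal f σ y / l (f y).rep) x := by
  let U : Opens C := ⟨{y | l (f y).rep ≠ 0}, hf.isOpen_ne l⟩
  have h := hσ U (fun y => (l (f y).rep)⁻¹ • (f y).rep) (fun y =>
    mdifferentiableAt_subtype_iff (g := fun y => (l (f y).rep)⁻¹ • (f y).rep).2
      (mdifferentiableAt_pi fun i => by
        have := (hf.holAt_quot (LinearMap.proj i) y.2).mdifferentiableAt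
        refine this.congr_of_eventuallyEq (Eventually.of_forall fun z => ?_)
        simp [quot, div_eq_inv_mul]))
    (fun y => Submodule.smul_mem _ _ (rep_mem_submodule _))
  refine mdifferentiable_subtype_iff (U := U).1 ?_ x hx
  convert! h using 2 with y
  have hy : l (f y).rep ≠ 0 := y.2
  rw [apply_eq_mul_secVal σ _ hy, map_smul, smul_eq_mul, inv_mul_cancel₀ hy, one_mul]

theorem mem_globalSections (hf : IsHolomorphic f) {σ : ∀ x : C, Module.Dual ℂ (f x).submodule}
    (h : ∀ x, ∃ l : LinForm 1, l (f x).rep ≠ 0 ∧ HolAt (fun y => secVal f σ y / l (f y).rep) x) :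
    σ ∈ globalSections f := by
  intro U s hs hsf x
  obtain ⟨l, hl, hσ⟩ := h x
  have h1 : MDifferentiableAt 𝓘(ℂ) 𝓘(ℂ) (fun y : U => l (s y)) x :=
    (l.toContinuousLinearMap.mdifferentiableAt (x := s x)).comp (I' := 𝓘(ℂ, Fin 2 → ℂ)) x (hs x)
  have h2 := h1.mul (mdifferentiableAt_subtype_iff.2 hσ.mdifferentiableAt)
  refine h2.congr_of_eventuallyEq ?_
  have : ∀ᶠ y : U in 𝓝 x, l (f y).rep ≠ 0 :=
    continuous_subtype_val.continuousAt.eventually ((hf.isOpen_ne l).mem_nhds hl)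
  filter_upwards [this] with y hy
  exact apply_eq_mul_secVal σ (hsf y) hy

/-- The sections of `f^* 𝒪(1)` given by the two homogeneous coordinates of `f`. -/
theorem exists_linSection (hf : IsHolomorphic f) :
    ∃ S : LinForm 1 →ₗ[ℂ] globalSections f, ∀ l, secVal f (S l) = fun x => l (f x).rep := by
  let S₀ : LinForm 1 →ₗ[ℂ] (∀ x : C, Module.Dual ℂ (f x).submodule) :=
    { toFun := fun l => ofVal f fun x => l (f x).rep
      map_add' := fun a b => (ofVal f).map_add _ _
      map_smul' := fun c a => (ofVal f).map_smul c _ }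
  refine ⟨S₀.codRestrict _ fun l => mem_globalSections hf fun x =>
    ⟨innerForm (f x), innerForm_self_ne_zero _, ?_⟩, fun l => secVal_ofVal _⟩
  simp only [S₀, LinearMap.coe_mk, AddHom.coe_mk, secVal_ofVal]
  exact hf.holAt_quot l (innerForm_self_ne_zero _)

theorem three_le_h0_iff : 3 ≤ h0 f ↔ 3 ≤ Module.rank ℂ (globalSections f) :=
  Cardinal.natCast_le_toENat (n := 3)

theorem three_le_h0 {v : Fin 3 → globalSections f} (h : LinearIndependent ℂ v) : 3 ≤ h0 f := by
  rw [three_le_h0_iff]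
  simpa using h.cardinal_lift_le_rank

theorem exists_section_notMem (h : 3 ≤ h0 f) (S : LinForm 1 →ₗ[ℂ] globalSections f) :
    ∃ σ, ∀ l, S l ≠ σ := by
  by_contra! hS
  -- Linear forms contribute dimension 2 only. `ULift` brings both modules into one universe for the
  -- comparison of ranks.
  have h1 := LinearMap.rank_le_of_surjective (M := ULift.{_, 0} (LinForm 1))
    (S ∘ₗ ULift.moduleEquiv.toLinearMap) fun σ => by
      obtain ⟨l, hl⟩ := hS σ
      exact ⟨⟨l⟩, hl⟩
  have h2 : Module.rank ℂ (LinForm 1) = 2 := by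
    rw [← Module.finrank_eq_rank]
    simp
  have h3 := (three_le_h0_iff.1 h).trans h1
  rw [rank_ulift, h2] at h3
  norm_num at h3

variable [T2Space C] [CompactSpace C] [ConnectedSpace C] {ν : C → CP 2}

/-- A plane model whose centre of projection is off the curve gives three independent sections. -/
theorem three_le_h0_of_model (hf : IsHolomorphic f) (hν : IsHolomorphic ν)
    {T : (Fin 3 → ℂ) →ₗ[ℂ] (Fin 2 → ℂ)}
    (hTf : ∀ (x : C) (h : T (ν x).rep ≠ 0), f x = Projectivization.mk ℂ (T (ν x).rep) h)
    (hc : ∀ x, T (ν x).rep ≠ 0) (hl : ∀ L : LinForm 2, (∀ x, L (ν x).rep = 0) → L = 0) :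
    3 ≤ h0 f := by
  -- The factor `c x` matches the representative of `ν x` with that of `f x`. Such a factor exists
  -- at every `x` because the centre is off the curve.
  choose c hc0 hcT using fun x => exists_rep_eq_of_projection hTf (hc x)
  let S₀ : LinForm 2 →ₗ[ℂ] (∀ x : C, Module.Dual ℂ (f x).submodule) :=
    { toFun := fun L => ofVal f fun x => c x * L (ν x).rep
      map_add' := fun a b => by
        rw [← map_add]
        congr 1
        funext x
        exact mul_add _ _ _
      map_smul' := fun r a => by
        rw [← map_smul]
        congr 1
        funext x
        exact mul_left_comm _ _ _ }
  let S : LinForm 2 →ₗ[ℂ] globalSections f :=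
    S₀.codRestrict _ fun L => mem_globalSections hf fun x =>
      ⟨innerForm (f x), innerForm_self_ne_zero _, by
        simp only [S₀, LinearMap.coe_mk, AddHom.coe_mk, secVal_ofVal]
        have h1 := innerForm_self_ne_zero (f x)
        rw [hcT x, map_smul, smul_eq_mul] at h1
        refine (hν.holAt_quot L (b := innerForm (f x) ∘ₗ T) (right_ne_zero_of_mul h1)).congr
          (Eventually.of_forall fun y => ?_)
        simp only [quot, hcT y, map_smul, smul_eq_mul, LinearMap.comp_apply]
        rw [mul_div_mul_left _ _ (hc0 y)]⟩
  have hS : Function.Injective S := by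
    rw [injective_iff_map_eq_zero]
    intro L hL
    refine hl L fun x => ?_
    have h1 : ofVal f (fun x => c x * L (ν x).rep) = 0 := congrArg Subtype.val hL
    have h2 := congrFun (secVal_ofVal (f := f) fun x => c x * L (ν x).rep) x
    rw [h1, map_zero] at h2
    exact (mul_eq_zero.1 h2.symm).resolve_left (hc0 x)
  let b := Module.finBasisOfFinrankEq ℂ (LinForm 2) (n := 3) (by simp)
  exact three_le_h0 (b.linearIndependent.map' S (LinearMap.ker_eq_bot.2 hS))

end Planarity

end

noncomputable section

namespace Planarity

/-! ### Separating the points of a fibre -/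

theorem exists_tendsto_div {a b : ℂ → ℂ} {z : ℂ} (ha : AnalyticAt ℂ a z) (hb : AnalyticAt ℂ b z)
    (hb' : analyticOrderAt b z ≠ ⊤) (h : analyticOrderAt b z ≤ analyticOrderAt a z) :
    ∃ c, Tendsto (fun w => a w / b w) (𝓝[≠] z) (𝓝 c) := by
  obtain ⟨g, hg, hg0, hgb⟩ := hb.analyticOrderAt_ne_top.1 hb'
  rw [← Nat.cast_analyticOrderNatAt hb'] at h
  obtain ⟨k, hk, hka⟩ := (natCast_le_analyticOrderAt ha).1 h
  refine ⟨k z / g z, ((hk.continuousAt.div hg.continuousAt hg0).tendsto.mono_left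
    nhdsWithin_le_nhds).congr' ?_⟩
  filter_upwards [nhdsWithin_le_nhds hgb, nhdsWithin_le_nhds hka, self_mem_nhdsWithin]
    with w h1 h2 h3
  have : w - z ≠ 0 := sub_ne_zero.2 h3
  simp only [h1, h2, smul_eq_mul, Pi.div_apply]
  rw [mul_div_mul_left _ _ (pow_ne_zero _ this)]

variable {C : Type*} [TopologicalSpace C] [ChartedSpace ℂ C] [IsManifold 𝓘(ℂ) ω C]
  {f : C → CP 1}

/-- A quotient of two differentials is a function: the derivative of the chart change cancels. -/
theorem derivAt_div_derivAt {h φ : C → ℂ} {x y : C} (hy : y ∈ (chartAt ℂ x).source)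
    (hh : DifferentiableAt ℂ (inChart x h) (chartAt ℂ x y))
    (hφ : DifferentiableAt ℂ (inChart x φ) (chartAt ℂ x y)) :
    derivAt h y / derivAt φ y =
      deriv (inChart x h) (chartAt ℂ x y) / deriv (inChart x φ) (chartAt ℂ x y) := by
  rw [derivAt, derivAt, deriv_inChart hy hh, deriv_inChart hy hφ,
    mul_div_mul_right _ _ (deriv_transition_ne_zero hy)]

theorem eventually_differentiableAt_inChart {g : C → ℂ} {x : C} (hg : HolAt g x) :
    ∀ᶠ y in 𝓝 x, DifferentiableAt ℂ (inChart x g) (chartAt ℂ x y) :=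
  (tendsto_chart x).eventually (hg.eventually_analyticAt.mono fun _ h => h.differentiableAt)

variable [T2Space C] [CompactSpace C] [ConnectedSpace C]

/-- If the differential of `s / l₂` vanishes wherever the differential of `l₁ / l₂` does, the
quotient of these differentials is a holomorphic function. -/
theorem exists_div_derivAt (hf : IsHolomorphic f) (hn : Nonconstant f) {l₁ l₂ : LinForm 1}
    (hl : NoCommonZero l₁ l₂) {s : C → ℂ}
    (hs : ∀ (l : LinForm 1) (x : C), l (f x).rep ≠ 0 → HolAt (fun y => s y / l (f y).rep) x)
    (hram : ∀ x, l₂ (f x).rep ≠ 0 → mult f x ≠ 1 →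
      mult f x = 2 ∧ derivAt (fun y => s y / l₂ (f y).rep) x = 0) (x : C) :
    ∃ M : ℂ → ℂ, MeromorphicAt M (chartAt ℂ x x) ∧
      (∃ c, Tendsto M (𝓝[≠] (chartAt ℂ x x)) (𝓝 c)) ∧ ∀ᶠ y in 𝓝[≠] x,
        derivAt (fun y => s y / l₂ (f y).rep) y / derivAt (quot l₁ l₂ f) y =
          M (chartAt ℂ x y) := by
  by_cases hx : l₂ (f x).rep = 0
  · have hx1 : l₁ (f x).rep ≠ 0 := fun h => (f x).rep_nonzero (hl _ h hx)
    have hl2 : l₂ ≠ 0 := fun h => hl.symm.sub_smul_ne_zero 0 (by simp [h])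
    have hu : HolAt (quot l₂ l₁ f) x := hf.holAt_quot l₂ hx1
    have hg := hs l₁ x hx1
    set u := quot l₂ l₁ f with hudef
    set g := fun y => s y / l₁ (f y).rep with hgdef
    have hux : u x = 0 := by simp [hudef, quot, hx]
    have hm := natCast_mult_eq_deriv hf hn hl.symm hx1
    have htop : analyticOrderAt (deriv (inChart x u)) (chartAt ℂ x x) ≠ ⊤ := fun h => by
      rw [h] at hm
      simp at hm
    have hord : analyticOrderAt (deriv (inChart x u)) (chartAt ℂ x x) ≤
        analyticOrderAt (inChart x u) (chartAt ℂ x x) := by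
      have := ordAt_sub hu
      simp only [hux, sub_zero] at this
      rw [show analyticOrderAt (inChart x u) (chartAt ℂ x x) = ordAt u x from rfl]
      change ordAt u x = _ at this
      rw [this]
      exact le_self_add
    obtain ⟨c, hc⟩ := exists_tendsto_div hu hu.deriv htop hord
    -- Over infinity put u = 1/φ and g = s/l₁, so that h = g/u and dh/dφ = g - g' u/u'. The last
    -- quotient is regular because u vanishes to higher order than u'.
    refine ⟨fun w => inChart x g w - deriv (inChart x g) w *
      (inChart x u w / deriv (inChart x u) w), ?_, ?_, ?_⟩
    · exact hg.meromorphicAt.sub (hg.deriv.meromorphicAt.mul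
        (hu.meromorphicAt.div hu.deriv.meromorphicAt))
    · exact ⟨_, (AnalyticAt.continuousAt hg |>.tendsto.mono_left nhdsWithin_le_nhds).sub
        ((hg.deriv.continuousAt.tendsto.mono_left nhdsWithin_le_nhds).mul hc)⟩
    · have e1 : ∀ᶠ y in 𝓝[≠] x, ∀ᶠ w in 𝓝 y, l₂ (f w).rep ≠ 0 :=
        eventually_nhdsNE_nhds (eventually_nhdsNE_of_finite (finite_zeros hf hn hl2) x)
      have e2 : ∀ᶠ y in 𝓝[≠] x, ∀ᶠ w in 𝓝 y, l₁ (f w).rep ≠ 0 :=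
        nhdsWithin_le_nhds (eventually_eventually_nhds.2 ((hf.isOpen_ne l₁).mem_nhds hx1))
      have e3 : ∀ᶠ y in 𝓝[≠] x, deriv (inChart x u) (chartAt ℂ x y) ≠ 0 :=
        (tendsto_chart_ne x).eventually
          ((hu.deriv.eventually_eq_zero_or_eventually_ne_zero).resolve_left fun h =>
            htop (analyticOrderAt_eq_top.2 h))
      have e4 : ∀ᶠ y in 𝓝[≠] x, y ∈ (chartAt ℂ x).source :=
        nhdsWithin_le_nhds (eventually_mem_source x)
      filter_upwards [e1, e2, e3, e4, nhdsWithin_le_nhds (eventually_differentiableAt_inChart hu),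
        nhdsWithin_le_nhds (eventually_differentiableAt_inChart hg)] with y h2 h1 hd hy du dg
      have hcont : Tendsto (chartAt ℂ x).symm (𝓝 (chartAt ℂ x y)) (𝓝 y) := by
        have := (chartAt ℂ x).continuousAt_symm ((chartAt ℂ x).map_source hy)
        rwa [ContinuousAt, (chartAt ℂ x).left_inv hy] at this
      have hu0 : inChart x u (chartAt ℂ x y) ≠ 0 := by
        rw [inChart_apply_chart x u hy]
        exact div_ne_zero h2.self_of_nhds h1.self_of_nhds
      have hφ : HasDerivAt (inChart x (quot l₁ l₂ f)) _ (chartAt ℂ x y) :=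
        (du.hasDerivAt.inv hu0).congr_of_eventuallyEq
          ((hcont.eventually (h1.and h2)).mono fun w hw => by
            simp [inChart, hudef, quot])
      have hh : HasDerivAt (inChart x fun y => s y / l₂ (f y).rep) _ (chartAt ℂ x y) :=
        (dg.hasDerivAt.div du.hasDerivAt hu0).congr_of_eventuallyEq
          ((hcont.eventually (h1.and h2)).mono fun w hw => by
            have h1 := hw.1
            have h2 := hw.2
            simp only [inChart, hudef, quot, hgdef, Pi.div_apply]
            field_simp)
      rw [derivAt_div_derivAt hy hh.differentiableAt hφ.differentiableAt, hh.deriv, hφ.deriv]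
      field_simp
      ring
  · have hφ : HolAt (quot l₁ l₂ f) x := hf.holAt_quot l₁ hx
    have hh := hs l₂ x hx
    have hm := natCast_mult_eq_deriv hf hn hl hx
    have htop : analyticOrderAt (deriv (inChart x (quot l₁ l₂ f))) (chartAt ℂ x x) ≠ ⊤ :=
      fun h => by
        rw [h] at hm
        simp at hm
    refine ⟨_, hh.deriv.meromorphicAt.div hφ.deriv.meromorphicAt,
      exists_tendsto_div hh.deriv hφ.deriv htop ?_, nhdsWithin_le_nhds ?_⟩
    -- At finite distance dφ vanishes to order `mult f x - 1`, which is at most 1, and where it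
    -- vanishes so does dh by hypothesis.
    · by_cases h1 : mult f x = 1
      · have := (mult_eq_one_iff hf hn hl hx).1 h1
        rw [hφ.deriv.analyticOrderAt_eq_zero.2 this]
        exact zero_le
      · obtain ⟨h2, h0⟩ := hram x hx h1
        rw [h2] at hm
        have : analyticOrderAt (deriv (inChart x (quot l₁ l₂ f))) (chartAt ℂ x x) = 1 := by
          rw [← Nat.cast_analyticOrderNatAt htop] at hm ⊢
          norm_cast at hm ⊢
          omega
        rw [this, Order.one_le_iff_ne_zero]
        exact hh.deriv.analyticOrderAt_ne_zero.2 h0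
    · filter_upwards [eventually_mem_source x, eventually_differentiableAt_inChart hφ,
        eventually_differentiableAt_inChart hh] with y hy d1 d2
      exact derivAt_div_derivAt hy d2 d1

/-- If the differential of `s / l₂` vanishes wherever the differential of `l₁ / l₂` does, then `s`
is a linear form in the homogeneous coordinates of `f`. -/
theorem exists_eq_linForm (hf : IsHolomorphic f) (hn : Nonconstant f) {l₁ l₂ : LinForm 1}
    (hl : NoCommonZero l₁ l₂) {s : C → ℂ}
    (hs : ∀ (l : LinForm 1) (x : C), l (f x).rep ≠ 0 → HolAt (fun y => s y / l (f y).rep) x)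
    (hram : ∀ x, l₂ (f x).rep ≠ 0 → mult f x ≠ 1 →
      mult f x = 2 ∧ derivAt (fun y => s y / l₂ (f y).rep) x = 0) :
    ∃ l : LinForm 1, ∀ x, s x = l (f x).rep := by
  have hloc := exists_div_derivAt hf hn hl hs hram
  set h := fun y => s y / l₂ (f y).rep with hh
  set φ := quot l₁ l₂ f with hφ
  have hl2 : l₂ ≠ 0 := fun h => hl.symm.sub_smul_ne_zero 0 (by simp [h])
  have hchart : ∀ (x : C) (M : ℂ → ℂ), (∀ᶠ y in 𝓝[≠] x, derivAt h y / derivAt φ y =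
      M (chartAt ℂ x y)) → inChart x (fun y => derivAt h y / derivAt φ y) =ᶠ[
        𝓝[≠] (chartAt ℂ x x)] M := fun x M he => by
    have hT := eventually_ne_iff_inChart.1 he
    filter_upwards [hT, nhdsWithin_le_nhds ((chartAt ℂ x).open_target.mem_nhds
      (mem_chart_target ℂ x))] with w hw hw'
    rw [(chartAt ℂ x).right_inv hw'] at hw
    exact hw
  -- The quotient dh/dφ has no poles on a compact surface, so it is constant off a finite set. What
  -- follows integrates dh = c dφ near one good point and extends the result by the identity
  -- theorem.
  obtain ⟨c, hc⟩ := Mero.exists_eq_const (D := fun y => derivAt h y / derivAt φ y)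
    (fun x => by
      obtain ⟨M, hM, -, he⟩ := hloc x
      exact hM.congr (hchart x M he).symm)
    (fun x => by
      obtain ⟨M, -, ⟨c, hM⟩, he⟩ := hloc x
      exact ⟨c, (hM.comp (tendsto_chart_ne x)).congr' (he.mono fun y hy => hy.symm)⟩)
  have hfin := hc.union ((finite_ramified hf hn).union (finite_zeros hf hn hl2))
  obtain ⟨x₁, hx₁⟩ : ∃ x, x ∉ {x | derivAt h x / derivAt φ x ≠ c} ∪
      ({x | ¬ mult f x = 1} ∪ {x | l₂ (f x).rep = 0}) := by
    have := infinite_of_riemannSurface (C := C)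
    exact hfin.infinite_compl.nonempty
  have hx2 : l₂ (f x₁).rep ≠ 0 := fun h => hx₁ (Or.inr (Or.inr h))
  have hφ₁ : HolAt φ x₁ := hf.holAt_quot l₁ hx2
  have hh₁ : HolAt h x₁ := hs l₂ x₁ hx2
  set G := fun y => h y - c * φ y
  have hG : HolAt G x₁ := hh₁.sub ((HolAt.const c).mul hφ₁)
  have hder : ∀ᶠ w in 𝓝[≠] (chartAt ℂ x₁ x₁), deriv (inChart x₁ G) w = 0 := by
    have e1 := eventually_ne_iff_inChart.1 (eventually_nhdsNE_of_finite hfin x₁)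
    filter_upwards [e1, nhdsWithin_le_nhds ((chartAt ℂ x₁).open_target.mem_nhds
      (mem_chart_target ℂ x₁)), nhdsWithin_le_nhds hφ₁.eventually_analyticAt,
      nhdsWithin_le_nhds hh₁.eventually_analyticAt] with w hw hw' d1 d2
    have hd : HasDerivAt (inChart x₁ G) _ w :=
      d2.differentiableAt.hasDerivAt.sub (d1.differentiableAt.hasDerivAt.const_mul c)
    rw [hd.deriv]
    set y := (chartAt ℂ x₁).symm w with hy
    have hys : y ∈ (chartAt ℂ x₁).source := (chartAt ℂ x₁).map_target hw'
    have hyw : chartAt ℂ x₁ y = w := (chartAt ℂ x₁).right_inv hw'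
    have hyD : derivAt h y / derivAt φ y = c := by
      by_contra hne
      exact hw (Or.inl hne)
    have hy2 : l₂ (f y).rep ≠ 0 := fun h => hw (Or.inr (Or.inr h))
    have hym : derivAt φ y ≠ 0 := (mult_eq_one_iff hf hn hl hy2).1 (by
      by_contra hne
      exact hw (Or.inr (Or.inl hne)))
    have hφw : deriv (inChart x₁ φ) w ≠ 0 := by
      rw [derivAt, deriv_inChart hys (hyw ▸ d1.differentiableAt), hyw] at hym
      exact left_ne_zero_of_mul hym
    rw [derivAt_div_derivAt hys (hyw ▸ d2.differentiableAt) (hyw ▸ d1.differentiableAt), hyw,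
      div_eq_iff hφw] at hyD
    rw [hyD, sub_self]
  have hzero : ∀ᶠ y in 𝓝 x₁, G y - G x₁ = 0 := by
    rw [← ordAt_eq_top, ordAt_sub hG, analyticOrderAt_eq_top.2, top_add]
    exact hG.deriv.frequently_zero_iff_eventually_zero.1 hder.frequently
  have hGM : Mero fun y => G y - G x₁ := by
    refine (Mero.sub ?_ ((Mero.const c).mul (hf.mero_quot l₁ l₂))).sub (Mero.const _)
    refine mero_div_of_local fun x => ?_
    refine ⟨_, _, hs _ x (innerForm_self_ne_zero (f x)),
      hf.holAt_quot l₂ (innerForm_self_ne_zero (f x)), nhdsWithin_le_nhds ?_⟩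
    filter_upwards [(hf.isOpen_ne _).mem_nhds (innerForm_self_ne_zero (f x))] with y hy
    have hy : innerForm (f x) (f y).rep ≠ 0 := hy
    rw [quot, div_div_div_cancel_right₀ hy]
  have hfin2 := hGM.finite_ne_of_frequently (x := x₁)
    (show ∀ᶠ y in 𝓝[≠] x₁, G y - G x₁ = 0 from nhdsWithin_le_nhds hzero).frequently
  refine ⟨c • l₁ + G x₁ • l₂, fun x => ?_⟩
  have hx := innerForm_self_ne_zero (f x)
  have hz := ((hs _ x hx).sub (hf.holAt_quot (c • l₁ + G x₁ • l₂) hx)).eq_zero_of_eventually (by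
    filter_upwards [eventually_nhdsNE_of_finite (hfin2.union (finite_zeros hf hn hl2)) x] with y hy
    have hy2 : l₂ (f y).rep ≠ 0 := fun h => hy (Or.inr h)
    have hy1 : G y - G x₁ = 0 := by
      by_contra hne
      exact hy (Or.inl hne)
    have : s y = (c • l₁ + G x₁ • l₂) (f y).rep := by
      rw [← sub_eq_zero.1 hy1]
      simp only [G, hh, hφ, quot, LinearMap.add_apply, LinearMap.smul_apply, smul_eq_mul]
      field_simp
      ring
    rw [quot, this, sub_self])
  rw [quot, ← sub_div] at hz
  exact sub_eq_zero.1 ((div_eq_zero_iff.1 hz).resolve_right hx)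

end Planarity

end

noncomputable section

/-! ### From a ramification point to almost all fibres. -/

namespace Planarity

variable {C : Type*} [TopologicalSpace C] [ChartedSpace ℂ C] [IsManifold 𝓘(ℂ) ω C]
  {f : C → CP 1}

theorem HolAt.eventually_nhdsNE_ne {g : C → ℂ} {x : C} (hg : HolAt g x) (hd : derivAt g x ≠ 0)
    (c : ℂ) : ∀ᶠ y in 𝓝[≠] x, g y ≠ c :=
  eventually_ne_iff_inChart.2
    ((AnalyticAt.differentiableAt hg).hasDerivAt.eventually_ne hd)

theorem mfderiv_ne_zero {g : C → ℂ} {x : C} (hg : HolAt g x) (hd : derivAt g x ≠ 0) :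
    mfderiv 𝓘(ℂ) 𝓘(ℂ) g x ≠ 0 := by
  intro h
  apply hd
  have h1 := hg.mdifferentiableAt.hasMFDerivAt
  rw [h] at h1
  have h2 : HasFDerivWithinAt (inChart x g) (0 : ℂ →L[ℂ] ℂ) univ (chartAt ℂ x x) := by
    have h3 := h1.2
    simp only [modelWithCornersSelf_coe, range_id] at h3
    exact h3
  rw [hasFDerivWithinAt_univ] at h2
  have h4 : deriv (inChart x g) (chartAt ℂ x x) = 0 := by simpa using h2.hasDerivAt.deriv
  exact h4

variable [T2Space C] [CompactSpace C] [ConnectedSpace C]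

/-- Near a ramification point at which `h` is a local coordinate, and such that the other points of
the fibre are unramified, `h` separates the points of the fibres. -/
theorem eventually_separates (hf : IsHolomorphic f) (hn : Nonconstant f) {l₁ l₂ : LinForm 1}
    (hl : NoCommonZero l₁ l₂) {h : C → ℂ} (hh : ∀ x, l₂ (f x).rep ≠ 0 → HolAt h x) {x₀ : C}
    (hx : l₂ (f x₀).rep ≠ 0) (hram : derivAt (quot l₁ l₂ f) x₀ = 0) (hder : derivAt h x₀ ≠ 0)
    (hother : ∀ y, f y = f x₀ → y ≠ x₀ → mult f y = 1) :
    ∀ᶠ x in 𝓝[≠] x₀, ∀ y, y ≠ x → f y = f x → h y ≠ h x := by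
  set φ := quot l₁ l₂ f with hφdef
  have hφ : HolAt φ x₀ := hf.holAt_quot l₁ hx
  -- It is enough to treat pairs (x, y) near (x₀, y₀) for each `y₀`: compactness in `y` then gives
  -- one neighbourhood of `x₀`. If `y₀ = x₀`, local injectivity of `h` settles the matter.
  have key : ∀ y₀ ∈ (univ : Set C), ∀ᶠ z : C × C in 𝓝 x₀ ×ˢ 𝓝 y₀,
      z.1 ≠ x₀ → z.2 ≠ z.1 → f z.2 = f z.1 → h z.2 ≠ h z.1 := by
    intro y₀ _
    by_cases hfy : f y₀ = f x₀
    · by_cases hy : y₀ = x₀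
      · subst hy
        obtain ⟨N', -, hN'o, hN', γ, -, hγ, -⟩ :=
          (hh y₀ hx).exists_local_inverse hder (N := univ) univ_mem
        have hc := (hh y₀ hx).continuousAt.tendsto.eventually hγ
        have hN : ∀ᶠ y in 𝓝 y₀, y ∈ N' := hN'o.mem_nhds hN'
        filter_upwards [(hN.and hc).prod_mk hN]
        rintro ⟨x, y⟩ ⟨⟨h1, h2⟩, h3⟩ - hyx - he
        exact hyx (((h2.2 y h3).1 he).trans ((h2.2 x h1).1 rfl).symm)
      · have hy2 : l₂ (f y₀).rep ≠ 0 := hfy ▸ hx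
        have hφy : HolAt φ y₀ := hf.holAt_quot l₁ hy2
        have hdy := (mult_eq_one_iff hf hn hl hy2).1 (hother y₀ hfy hy)
        obtain ⟨N', -, hN'o, hN', γ, hγ0, hγ, hγa⟩ :=
          hφy.exists_local_inverse hdy (N := univ) univ_mem
        have hv : φ x₀ = φ y₀ := by simp only [hφdef, quot, hfy]
        have ha : AnalyticAt ℂ (fun b => h (γ b)) (φ x₀) := hv ▸ hγa h (hh y₀ hy2)
        have ha' : AnalyticAt ℂ (fun b => h (γ b)) (inChart x₀ φ (chartAt ℂ x₀ x₀)) := by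
          rwa [inChart_apply_self]
        have hcomp : AnalyticAt ℂ ((fun b => h (γ b)) ∘ inChart x₀ φ) (chartAt ℂ x₀ x₀) :=
          ha'.comp hφ
        have hG : HolAt (fun x => h x - h (γ (φ x))) x₀ := (hh x₀ hx).sub hcomp
        -- The point of another sheet in the fibre of `x` is γ(φ x). As dφ = 0 at `x₀`, this
        -- difference has the derivative of `h` there, so its zeros near `x₀` are confined to `x₀`.
        have hGd : derivAt (fun x => h x - h (γ (φ x))) x₀ ≠ 0 := by
          have h1 : HasDerivAt (inChart x₀ fun x => h x - h (γ (φ x))) _ (chartAt ℂ x₀ x₀) :=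
            (AnalyticAt.differentiableAt (hh x₀ hx)).hasDerivAt.sub
              (HasDerivAt.comp (chartAt ℂ x₀ x₀) (h₂ := fun b => h (γ b))
                ha'.differentiableAt.hasDerivAt
                (AnalyticAt.differentiableAt hφ).hasDerivAt)
          rw [derivAt, h1.deriv]
          change derivAt h x₀ - _ * derivAt φ x₀ ≠ 0
          rwa [hram, mul_zero, sub_zero]
        have e1 := hG.eventually_nhdsNE_ne hGd 0
        rw [eventually_nhdsWithin_iff] at e1
        have e2 := hφ.continuousAt.tendsto.eventually (hv ▸ hγ)
        have hN : ∀ᶠ y in 𝓝 y₀, y ∈ N' := hN'o.mem_nhds hN'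
        filter_upwards [(e1.and e2).prod_mk hN]
        rintro ⟨x, y⟩ ⟨⟨h1, h2⟩, h3⟩ hxx - hyx he
        have hφe : φ y = φ x := by simp only [hφdef, quot, hyx]
        have := (h2.2 y h3).1 hφe
        refine h1 hxx ?_
        change h x - h (γ (φ x)) = 0
        rw [← this, he, sub_self]
    · set m := vanForm (f x₀)
      have hm : m (f y₀).rep ≠ 0 := fun h => hfy (eq_of_vanForm_eq_zero h)
      have c1 := (hf.holAt_quot m hx).continuousAt.tendsto
      have c2 := (hf.holAt_quot l₂ hm).continuousAt.tendsto
      -- If f y = f x near (x₀, y₀), the product (m/l₂)(x) · (l₂/m)(y) would be 1, but it tends to 0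
      -- because m vanishes at `f x₀`.
      have c3 := (c1.comp tendsto_fst).mul (c2.comp (tendsto_snd (f := 𝓝 x₀)))
      have h0 : quot m l₂ f x₀ * quot l₂ m f y₀ = 0 := by
        simp [quot, m, vanForm_self]
      rw [h0] at c3
      have e1 := c3.eventually_ne (zero_ne_one (α := ℂ))
      have e2 : ∀ᶠ y in 𝓝 x₀, l₂ (f y).rep ≠ 0 := (hf.isOpen_ne l₂).mem_nhds hx
      have e3 : ∀ᶠ y in 𝓝 y₀, m (f y).rep ≠ 0 := (hf.isOpen_ne m).mem_nhds hm
      filter_upwards [e1, e2.prod_mk e3]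
      rintro ⟨x, y⟩ h1 ⟨h2, h3⟩ - - hyx
      refine absurd ?_ h1
      simp only at h2 h3 hyx
      simp only [Function.comp_apply, quot, hyx] at h3 ⊢
      field_simp
  rw [eventually_nhdsWithin_iff]
  simp only [← nhds_prod_eq] at key
  filter_upwards [isCompact_univ.eventually_forall_of_forall_eventually
    (P := fun x y => x ≠ x₀ → y ≠ x → f y = f x → h y ≠ h x) key] with x hx hxx y
  exact hx y (mem_univ y) hxx

/-- If `h` separates the points of some fibres, it separates the points of almost all fibres. -/
theorem exists_finite_separates (hf : IsHolomorphic f) (hn : Nonconstant f) {l₁ l₂ : LinForm 1}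
    (hl : NoCommonZero l₁ l₂) {h : C → ℂ} (hM : Mero h) (hh : ∀ x, l₂ (f x).rep ≠ 0 → HolAt h x)
    {K : ℝ} (hK : ∀ x, l₂ (f x).rep ≠ 0 → ‖h x‖ ≤ K * (1 + ‖quot l₁ l₂ f x‖)) {x₀ : C}
    (hsep : ∀ᶠ x in 𝓝[≠] x₀, ∀ y, y ≠ x → f y = f x → h y ≠ h x) :
    ∃ S : Set C, S.Finite ∧ ∀ x ∉ S, l₂ (f x).rep ≠ 0 ∧ mult f x = 1 ∧
      ∀ y, y ≠ x → f y = f x → h y ≠ h x := by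
  classical
  have hl2 : l₂ ≠ 0 := fun h => hl.symm.sub_smul_ne_zero 0 (by simp [h])
  obtain ⟨B, hB, hBd⟩ := exists_finite_degree_fib hf hn hl
  set φ := quot l₁ l₂ f with hφdef
  have hφ : ∀ b, ∀ x ∈ fib l₁ l₂ f b, φ x = b := fun b x hx =>
    (mem_fib_iff (hl.ne_zero_of_mem_fib hx)).1 hx
  obtain ⟨E, -, -, hE⟩ := exists_charPoly hf hn hl (h := h) hB (d := degree f) (N := 1) (K := K)
    (fun b hb => (hBd b hb).1) (fun b hb => (hBd b hb).2)
    (fun b hb x hx => hh x (hl.ne_zero_of_mem_fib hx))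
    (fun b hb x hx => by
      rw [← hφ b x hx, pow_one]
      exact hK x (hl.ne_zero_of_mem_fib hx))
  have hfibf : ∀ x y, l₂ (f x).rep ≠ 0 → (y ∈ fib l₁ l₂ f (φ x) ↔ f y = f x) := by
    intro x y hx
    obtain ⟨a, -, ha⟩ := hl.exists_fib_eq (C := C) (φ x)
    have h1 : x ∈ fib l₁ l₂ f (φ x) := (mem_fib_iff hx).2 rfl
    rw [ha] at h1 ⊢
    rw [mem_preimage, mem_singleton_iff] at h1 ⊢
    rw [h1]
  -- The derivative of the characteristic polynomial at its root `h x`. Off the exceptional fibres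
  -- it is the product of h x - h y over the other points y of the fibre; written with the
  -- polynomials `E k`, it is visibly meromorphic on `C`.
  set Δ : C → ℂ := fun x => ∑ k ∈ Finset.range (degree f + 1),
    (E k).eval (φ x) * (k * h x ^ (k - 1)) with hΔ
  have hΔM : Mero Δ := Mero.sum _ fun k _ =>
    ((hf.mero_quot l₁ l₂).eval_polynomial _).mul ((Mero.const _).mul (hM.pow _))
  have hΔe : ∀ x, l₂ (f x).rep ≠ 0 → φ x ∉ B →
      (Δ x ≠ 0 ↔ ∀ y, y ≠ x → f y = f x → h y ≠ h x) := by
    intro x hx hxB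
    have hfin := finite_fib hf hn hl (φ x)
    have hmem : x ∈ hfin.toFinset := hfin.mem_toFinset.2 ((mem_fib_iff hx).2 rfl)
    have h1 : (Polynomial.derivative (fibPoly l₁ l₂ f h (φ x))).eval (h x) = Δ x := by
      rw [hE _ hxB, Polynomial.derivative_sum, Polynomial.eval_finsetSum]
      refine Finset.sum_congr rfl fun k _ => ?_
      simp [Polynomial.derivative_X_pow]
    rw [← h1, fibPoly, finprod_mem_eq_finite_toFinset_prod _ hfin,
      ← Finset.mul_prod_erase _ _ hmem, Polynomial.derivative_mul]
    simp only [Polynomial.derivative_sub, Polynomial.derivative_X, Polynomial.derivative_C,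
      sub_zero, one_mul, Polynomial.eval_add, Polynomial.eval_mul, Polynomial.eval_sub,
      Polynomial.eval_X, Polynomial.eval_C, sub_self, zero_mul, add_zero, Polynomial.eval_prod]
    rw [Finset.prod_ne_zero_iff]
    simp only [Finset.mem_erase, hfin.mem_toFinset, hfibf x _ hx, sub_ne_zero, ne_comm, and_imp]
  have hfin1 : {x | Δ x = 0}.Finite := by
    refine hΔM.finite_eq_of_frequently (x := x₀) (Eventually.frequently ?_)
    have hfinB : {x | φ x ∈ B ∧ l₂ (f x).rep ≠ 0}.Finite :=
      (hB.biUnion fun b _ => finite_fib hf hn hl b).subset fun x hx =>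
        mem_iUnion₂.2 ⟨φ x, hx.1, (mem_fib_iff hx.2).2 rfl⟩
    filter_upwards [hsep, eventually_nhdsNE_of_finite (finite_zeros hf hn hl2) x₀,
      eventually_nhdsNE_of_finite hfinB x₀] with x h1 h2 h3
    exact (hΔe x h2 fun hxB => h3 ⟨hxB, h2⟩).2 h1
  refine ⟨{x | Δ x = 0} ∪ ({x | l₂ (f x).rep = 0} ∪ ({x | ¬ mult f x = 1} ∪
    ⋃ b ∈ B, fib l₁ l₂ f b)), hfin1.union ((finite_zeros hf hn hl2).union
      ((finite_ramified hf hn).union (hB.biUnion fun b _ => finite_fib hf hn hl b))),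
    fun x hx => ?_⟩
  simp only [mem_union, not_or, mem_ofPred_eq, not_not, mem_iUnion, not_exists] at hx
  obtain ⟨h1, h2, h3, h4⟩ := hx
  exact ⟨h2, h3, (hΔe x h2 fun hxB => h4 _ hxB ((mem_fib_iff h2).2 rfl)).1 h1⟩

end Planarity

end

noncomputable section

namespace Planarity

/-! ### Plane models without a point over the center of projection -/

variable {C : Type*} [TopologicalSpace C] [ChartedSpace ℂ C] [IsManifold 𝓘(ℂ) ω C]
  [T2Space C] [CompactSpace C] [ConnectedSpace C] {f : C → CP 1}

/-- The projection of `ℂ³` to its first two coordinates. -/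
def firstTwo : (Fin 3 → ℂ) →ₗ[ℂ] (Fin 2 → ℂ) :=
  LinearMap.pi ![LinearMap.proj 0, LinearMap.proj 1]

theorem firstTwo_apply (w : Fin 2 → ℂ) (c : ℂ) : firstTwo ![w 0, w 1, c] = w := by
  ext i
  fin_cases i <;> simp [firstTwo]

/-- The map to the plane given by the homogeneous coordinates of `f` and a third function. -/
def planeMap (f : C → CP 1) (s : C → ℂ) (x : C) : CP 2 :=
  Projectivization.mk ℂ ![(f x).rep 0, (f x).rep 1, s x] fun h => (f x).rep_nonzero (by
    rw [← firstTwo_apply (f x).rep (s x), h, map_zero])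

theorem exists_rep_planeMap (f : C → CP 1) (s : C → ℂ) (x : C) :
    ∃ c : ℂ, c ≠ 0 ∧ (planeMap f s x).rep = c • ![(f x).rep 0, (f x).rep 1, s x] :=
  exists_rep_eq_smul _ rfl

theorem firstTwo_rep_planeMap (f : C → CP 1) (s : C → ℂ) (x : C) :
    ∃ c : ℂ, c ≠ 0 ∧ firstTwo (planeMap f s x).rep = c • (f x).rep ∧
      (planeMap f s x).rep 2 = c * s x := by
  obtain ⟨c, hc, h⟩ := exists_rep_planeMap f s x
  exact ⟨c, hc, by rw [h, map_smul, firstTwo_apply], by rw [h]; simp⟩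

theorem firstTwo_surjective : Function.Surjective firstTwo := fun w =>
  ⟨![w 0, w 1, 0], firstTwo_apply w 0⟩

theorem firstTwo_planeMap_ne_zero (f : C → CP 1) (s : C → ℂ) (x : C) :
    firstTwo (planeMap f s x).rep ≠ 0 := by
  obtain ⟨c, hc, h, -⟩ := firstTwo_rep_planeMap f s x
  rw [h]
  exact smul_ne_zero hc (f x).rep_nonzero

theorem eq_mk_firstTwo_planeMap (f : C → CP 1) (s : C → ℂ) (x : C)
    (h : firstTwo (planeMap f s x).rep ≠ 0) :
    f x = Projectivization.mk ℂ (firstTwo (planeMap f s x).rep) h := by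
  obtain ⟨c, hc, e, -⟩ := firstTwo_rep_planeMap f s x
  refine eq_mk_of_rep_eq_smul h (c := c⁻¹) ?_
  rw [e, inv_smul_smul₀ hc]

theorem isHolomorphic_planeMap (hf : IsHolomorphic f) {s : C → ℂ}
    (hs : ∀ (l : LinForm 1) (x : C), l (f x).rep ≠ 0 → HolAt (fun y => s y / l (f y).rep) x) :
    IsHolomorphic (planeMap f s) := by
  intro x
  set l := innerForm (f x)
  let v : C → (Fin 3 → ℂ) := fun y => (l (f y).rep)⁻¹ • ![(f y).rep 0, (f y).rep 1, s y]
  refine ⟨⟨{y | l (f y).rep ≠ 0}, hf.isOpen_ne l⟩, innerForm_self_ne_zero _, fun y => v y,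
    fun y => mdifferentiableAt_subtype_iff.2 (mdifferentiableAt_pi fun i => ?_), fun y => ?_⟩
  · have hy : l (f y).rep ≠ 0 := y.2
    have h0 := hf.holAt_quot (LinearMap.proj 0) hy
    have h1 := hf.holAt_quot (LinearMap.proj 1) hy
    have h2 := hs l y hy
    refine HolAt.mdifferentiableAt ?_
    fin_cases i
    · exact h0.congr (Eventually.of_forall fun z => by simp [v, quot, div_eq_inv_mul])
    · exact h1.congr (Eventually.of_forall fun z => by simp [v, quot, div_eq_inv_mul])
    · exact h2.congr (Eventually.of_forall fun z => by simp [v, div_eq_inv_mul])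
  · have hy : l (f y).rep ≠ 0 := y.2
    obtain ⟨c, hc, h⟩ := exists_rep_planeMap f s y
    have e : (planeMap f s y).rep = (c * l (f y).rep) • v y := by
      rw [h, smul_smul, mul_assoc, mul_inv_cancel₀ hy, mul_one]
    have hv : v y ≠ 0 := fun h0 => (planeMap f s y).rep_nonzero (by rw [e, h0, smul_zero])
    exact ⟨hv, eq_mk_of_rep_eq_smul hv e⟩

/-- A ramified point forces its value to be a branch point, hence a simple one, and must be the
unique double point of the fibre. -/
theorem isSimpleBranchPoint_of_mult_ne_one (hf : IsHolomorphic f) (hn : Nonconstant f) {x : C}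
    (hx : ¬ IsComplicatedBranchPoint f (f x)) (hm : mult f x ≠ 1) :
    mult f x = 2 ∧ ∀ y, f y = f x → y ≠ x → mult f y = 1 := by
  have h0 := mult_ne_zero hf hn x
  have hb : IsSimpleBranchPoint f (f x) := by
    by_contra h
    exact hx ⟨⟨x, rfl, by omega⟩, h⟩
  obtain ⟨x', hx', h2, h1⟩ := hb
  obtain rfl : x = x' := by
    by_contra hne
    exact hm (h1 x rfl hne)
  exact ⟨h2, h1⟩

/-- A section of `f^* 𝒪(1)` which is not a linear form in the homogeneous coordinates of `f` gives a
plane model. -/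
theorem isPlaneModel_planeMap (hf : IsHolomorphic f) (hn : Nonconstant f)
    (hbranch : {a | IsComplicatedBranchPoint f a}.Subsingleton) {s : C → ℂ}
    (hs : ∀ (l : LinForm 1) (x : C), l (f x).rep ≠ 0 → HolAt (fun y => s y / l (f y).rep) x)
    (hne : ∀ l : LinForm 1, ¬ ∀ x, s x = l (f x).rep) : IsPlaneModel f (planeMap f s) := by
  have hν := isHolomorphic_planeMap hf hs
  have hproj := eq_mk_firstTwo_planeMap f s
  refine ⟨hν, ?_, firstTwo, firstTwo_surjective, hproj⟩
  obtain ⟨a₀, ha₀⟩ : ∃ a₀, ∀ a, a ≠ a₀ → ¬ IsComplicatedBranchPoint f a := by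
    by_cases h : ∃ a, IsComplicatedBranchPoint f a
    · obtain ⟨a₀, h₀⟩ := h
      exact ⟨a₀, fun a ha h => ha (hbranch h h₀)⟩
    · exact ⟨infinity, fun a _ h' => h ⟨a, h'⟩⟩
  set l₁ := innerForm a₀
  -- The possibly complicated branch point becomes the point at infinity of l₁/l₂. All ramification
  -- at finite distance is then simple.
  set l₂ := vanForm a₀ with hl₂
  have hl : NoCommonZero l₁ l₂ := (noCommonZero_vanForm_innerForm a₀).symm
  have ha : ∀ x, l₂ (f x).rep ≠ 0 → f x ≠ a₀ := by
    rintro x hx rfl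
    exact hx (vanForm_self _)
  set h := fun y => s y / l₂ (f y).rep with hh
  have hhq : ∀ y, h y = quot (LinearMap.proj 2) (l₂ ∘ₗ firstTwo) (planeMap f s) y := fun y => by
    obtain ⟨c, hc, h1, h2⟩ := firstTwo_rep_planeMap f s y
    simp only [quot, LinearMap.comp_apply, LinearMap.proj_apply, h1, h2, map_smul, smul_eq_mul]
    rw [mul_div_mul_left _ _ hc]
  -- Without such a point dh would vanish wherever dφ does, and the section would be a linear form.
  obtain ⟨x₀, hx₀, hm, hd⟩ : ∃ x, l₂ (f x).rep ≠ 0 ∧ mult f x ≠ 1 ∧ derivAt h x ≠ 0 := by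
    by_contra! hcon
    obtain ⟨l, hl⟩ := exists_eq_linForm hf hn hl hs fun x hx hm =>
      ⟨(isSimpleBranchPoint_of_mult_ne_one hf hn (ha₀ _ (ha x hx)) hm).1, hcon x hx hm⟩
    exact hne l hl
  have hram : derivAt (quot l₁ l₂ f) x₀ = 0 := by
    by_contra h
    exact hm ((mult_eq_one_iff hf hn hl hx₀).2 h)
  have hsep := eventually_separates hf hn hl (h := h) (hs l₂) hx₀ hram hd
    (isSimpleBranchPoint_of_mult_ne_one hf hn (ha₀ _ (ha x₀ hx₀)) hm).2
  have hq : ∀ x, l₂ (f x).rep ≠ 0 → _ := fun x hx =>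
    quot_comp_eq (fun x h => hproj x h) l₁ l₂ (firstTwo_planeMap_ne_zero f s x) hx
  obtain ⟨K, hK⟩ := hν.exists_bound (a := l₁ ∘ₗ firstTwo) (b := l₂ ∘ₗ firstTwo) (fun x => by
    by_contra! h
    exact firstTwo_planeMap_ne_zero f s x (hl _ h.1 h.2)) (LinearMap.proj 2)
  have hhM : Mero h := by
    rw [funext hhq]
    exact hν.mero_quot _ _
  obtain ⟨S, hS, hSx⟩ := exists_finite_separates hf hn hl (h := h) (K := K) hhM (hs l₂)
    (fun x hx => by
      obtain ⟨h1, h2⟩ := hq x hx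
      rw [hhq, ← h2, quot, quot, norm_div, norm_div, div_le_iff₀ (norm_pos_iff.2 h1)]
      refine (hK x).trans (le_of_eq ?_)
      have := norm_ne_zero_iff.2 h1
      field_simp
      ring) hsep
  refine ⟨S, hS, fun x hx => ?_⟩
  obtain ⟨h2, hm1, hsx⟩ := hSx x hx
  refine ⟨fun y hyx hνe => ?_, l₁ ∘ₗ firstTwo, l₂ ∘ₗ firstTwo, (hq x h2).1, ?_⟩
  · refine hsx y hyx ?_ ?_
    · rw [hproj y (firstTwo_planeMap_ne_zero f s y), hproj x (firstTwo_planeMap_ne_zero f s x)]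
      simp only [hνe]
    · rw [hhq, hhq, quot, quot, hνe]
  -- At unramified points the coordinate of `f` itself already shows that ν is an immersion.
  · have e : (fun y => (l₁ ∘ₗ firstTwo) (planeMap f s y).rep / (l₂ ∘ₗ firstTwo)
        (planeMap f s y).rep) = quot l₁ l₂ f := by
      funext y
      obtain ⟨c, hc, h1, -⟩ := firstTwo_rep_planeMap f s y
      simp only [quot, LinearMap.comp_apply, h1, map_smul, smul_eq_mul]
      rw [mul_div_mul_left _ _ hc]
    rw [e]
    exact mfderiv_ne_zero (hf.holAt_quot l₁ h2) ((mult_eq_one_iff hf hn hl h2).1 hm1)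

/-- The infimum of the empty set would be 0; the existence of some equation ensures that the degree
of the curve is attained by an actual form. -/
theorem exists_form_planeCurveDegree (hf : IsHolomorphic f) (hn : Nonconstant f) {ν : C → CP 2}
    (hν : IsPlaneModel f ν) : ∃ F : MvPolynomial (Fin 3) ℂ, F ≠ 0 ∧
      F.IsHomogeneous (planeCurveDegree (range ν)) ∧ ∀ x, MvPolynomial.eval (ν x).rep F = 0 := by
  obtain ⟨h1, h2, T, hT, hTf⟩ := hν
  obtain ⟨M, F, hF0, hF, hFν⟩ := exists_form_of_model hf hn h1 h2 hT hTf
  obtain ⟨G, hG0, hG, hGν⟩ := Nat.sInf_mem (s := {n : ℕ | ∃ F : MvPolynomial (Fin 3) ℂ, F ≠ 0 ∧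
    F.IsHomogeneous n ∧ ∀ q ∈ range ν, MvPolynomial.eval q.rep F = 0})
    ⟨M, F, hF0, hF, forall_mem_range.2 hFν⟩
  exact ⟨G, hG0, hG, fun x => hGν _ (mem_range_self x)⟩

theorem degree_le_planeCurveDegree (hf : IsHolomorphic f) (hn : Nonconstant f) {ν : C → CP 2}
    (hν : IsPlaneModel f ν) : degree f ≤ planeCurveDegree (range ν) := by
  obtain ⟨F, hF0, hF, hFν⟩ := exists_form_planeCurveDegree hf hn hν
  obtain ⟨h1, h2, T, hT, hTf⟩ := hν
  exact (degree_add_le_of_form hf hn h1 h2 hT hTf hF0 hF hFν).1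

/-- The planarity defect vanishes if and only if there is a third section of `f^* 𝒪(1)`. -/
theorem hasPlanarityDefect_zero_iff (hf : IsHolomorphic f) (hd : 2 ≤ degree f)
    (hbranch : {a | IsComplicatedBranchPoint f a}.Subsingleton) :
    HasPlanarityDefect f 0 ↔ 3 ≤ h0 f := by
  have hn : Nonconstant f := nonconstant_of_degree_ne_zero (by omega)
  constructor
  · rintro ⟨⟨ν, hν, h0⟩, -⟩
    have hdeg : planeCurveDegree (range ν) = degree f := by omega
    obtain ⟨F, hF0, hF, hFν⟩ := exists_form_planeCurveDegree hf hn hν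
    obtain ⟨h1, h2, T, hT, hTf⟩ := hν
    refine three_le_h0_of_model hf h1 hTf (fun x hx => ?_) fun L hL => ?_
    · have := (degree_add_le_of_form hf hn h1 h2 hT hTf hF0 hF hFν).2 x hx
      omega
    -- A linear relation would be an equation of degree 1, below `degree f`.
    · by_contra hL0
      have := (degree_add_le_of_form hf hn h1 h2 hT hTf (F := linPoly L) (m := 1) (fun h => hL0
        (LinearMap.ext fun v => by rw [← eval_linPoly, h]; simp)) (isHomogeneous_linPoly L)
        fun x => by rw [eval_linPoly, hL x]).1
      omega
  · intro h
    obtain ⟨S, hS⟩ := exists_linSection hf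
    obtain ⟨σ, hσ⟩ := exists_section_notMem h S
    set s := secVal f σ
    have hν := isPlaneModel_planeMap hf hn hbranch (s := s)
      (fun l x hx => holAt_secVal_div hf σ.2 hx) fun l hl =>
      hσ l (Subtype.ext (secVal_injective (by rw [hS l]; exact (funext hl).symm)))
    obtain ⟨F, hF0, hF, hFν⟩ := exists_form_of_forall_ne hf hn hν.1 firstTwo_surjective
      (eq_mk_firstTwo_planeMap f s) (firstTwo_planeMap_ne_zero f s)
    have h1 : planeCurveDegree (range (planeMap f s)) ≤ degree f :=
      Nat.sInf_le ⟨F, hF0, hF, forall_mem_range.2 hFν⟩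
    refine ⟨⟨_, hν, ?_⟩, ?_⟩
    · have := degree_le_planeCurveDegree hf hn hν
      omega
    · rintro m ⟨ν', hν', rfl⟩
      have := degree_le_planeCurveDegree hf hn hν'
      omega

end Planarity

end

noncomputable section

namespace Planarity

/-! ### Sections with prescribed values on a fibre -/

variable {C : Type*} [TopologicalSpace C] [ChartedSpace ℂ C] [T1Space C]

/-- The covering by the complements of `P \ {x}`. -/
def puncturedCover {P : Set C} (hP : P.Finite) : PointedCover C where
  nhd x := ⟨(P \ {x})ᶜ, (hP.subset sdiff_subset).isClosed.isOpen_compl⟩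
  mem_nhd _ := fun h => h.2 rfl

theorem eq_of_mem_puncturedCover {P : Set C} (hP : P.Finite) {x p : C} (hp : p ∈ P)
    (hx : p ∈ (puncturedCover hP).nhd x) : p = x := by
  by_contra hne
  exact hx ⟨hp, hne⟩

variable [IsManifold 𝓘(ℂ) ω C]

/-- The cocycle given by the principal parts `c x • Q`. -/
def principalCocycle {P : Set C} (hP : P.Finite) {Q : C → ℂ} (hQ : ∀ x ∉ P, HolAt Q x) :
    (C → ℂ) →ₗ[ℂ] cocycles (puncturedCover hP) where
  toFun c := ⟨fun x y p => (c y - c x) * Q p, fun x y => by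
      by_cases hxy : x = y
      · subst hxy
        simp only [sub_self, zero_mul]
        exact Submodule.zero_mem _
      · refine mdifferentiable_subtype_iff (g := fun p => (c y - c x) * Q p).2 fun p hp =>
          (HolAt.const _).mul (hQ p fun hpP => hxy ?_)
        rw [← eq_of_mem_puncturedCover hP hpP hp.1, ← eq_of_mem_puncturedCover hP hpP hp.2],
    fun x y z p _ _ _ => by ring⟩
  map_add' a b := by
    ext x y p
    simp only [Pi.add_apply, Submodule.coe_add]
    ring
  map_smul' r a := by
    ext x y p
    simp only [Pi.smul_apply, Submodule.coe_smul, smul_eq_mul, RingHom.id_apply]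
    ring

open Classical in
/-- The class in `H¹(C, 𝒪)` of the principal parts `c x • Q`. -/
def principalClass {P : Set C} (hP : P.Finite) {Q : C → ℂ} (hQ : ∀ x ∉ P, HolAt Q x) :
    (C → ℂ) →ₗ[ℂ] H1 C :=
  Module.DirectLimit.of ℂ (PointedCover C) (coverH1 (C := C)) coverH1Map (puncturedCover hP) ∘ₗ
    Submodule.mkQ _ ∘ₗ principalCocycle hP hQ

/-- An element of the direct limit vanishes only if it does so at a finite stage, that is, if the
cocycle is a coboundary on some refinement. -/
theorem exists_holFun_of_principalClass_eq_zero {P : Set C} (hP : P.Finite) {Q : C → ℂ}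
    (hQ : ∀ x ∉ P, HolAt Q x) {c : C → ℂ} (hc : principalClass hP hQ c = 0) :
    ∃ V : PointedCover C, puncturedCover hP ≤ V ∧ ∃ h : C → C → ℂ,
      (∀ x, ∀ p ∈ V.nhd x, HolAt (h x) p) ∧
      ∀ x y p, p ∈ V.nhd x → p ∈ V.nhd y → (c y - c x) * Q p = h y p - h x p := by
  classical
  obtain ⟨V, hV, h0⟩ := Module.DirectLimit.of.zero_exact hc
  obtain ⟨h, hh, he⟩ := (Submodule.Quotient.mk_eq_zero _).1 h0
  refine ⟨V, hV, fun x p => if hp : p ∈ V.nhd x then h x ⟨p, hp⟩ else 0, fun x => ?_, ?_⟩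
  · refine mdifferentiable_subtype_iff.1 ?_
    convert! hh x using 2 with p
    exact dif_pos p.2
  · intro x y p hx hy
    simp only [dif_pos hx, dif_pos hy]
    exact he x y p hx hy

/-- Principal parts with zero class in `H¹(C, 𝒪)` come from a section of `f^* 𝒪(1)`. -/
theorem exists_section_of_principalClass_eq_zero {f : C → CP 1} (hf : IsHolomorphic f) {a : CP 1}
    (hP : (f ⁻¹' {a}).Finite)
    (hQ : ∀ x ∉ f ⁻¹' {a}, HolAt (quot (innerForm a) (vanForm a) f) x) {c : C → ℂ}
    (hc : principalClass hP hQ c = 0) :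
    ∃ σ ∈ globalSections f, ∀ x, f x = a → secVal f σ x = c x * innerForm a (f x).rep := by
  obtain ⟨V, hV, h, hh, he⟩ := exists_holFun_of_principalClass_eq_zero hP hQ hc
  -- The relation says that c x · Q - h x does not depend on `x`. These functions glue to one with
  -- simple principal parts c x · Q; multiplying by `vanForm a` turns it into a section, and the
  -- index may be taken to be the point `p` itself.
  refine ⟨ofVal f fun p => c p * innerForm a (f p).rep - h p p * vanForm a (f p).rep,
    mem_globalSections hf fun x => ?_, fun x hx => ?_⟩
  · have hx := innerForm_self_ne_zero (f x)
    refine ⟨_, hx, ?_⟩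
    have h1 := ((HolAt.const (c x)).mul (hf.holAt_quot (innerForm a) hx)).sub
      ((hh x x (V.mem_nhd x)).mul (hf.holAt_quot (vanForm a) hx))
    refine h1.congr ?_
    filter_upwards [(V.nhd x).isOpen.mem_nhds (V.mem_nhd x)] with p hp
    simp only [secVal_ofVal, quot]
    by_cases hpa : f p = a
    · obtain rfl : p = x := eq_of_mem_puncturedCover hP hpa (hV x hp)
      ring
    · have hv : vanForm a (f p).rep ≠ 0 := fun h => hpa (eq_of_vanForm_eq_zero h)
      have h2 := he x p p hp (V.mem_nhd p)
      rw [quot, mul_div_assoc', div_eq_iff hv] at h2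
      linear_combination (-1 / innerForm (f x) (f p).rep) * h2
  · rw [secVal_ofVal, hx, vanForm_self, mul_zero, sub_zero]

variable [T2Space C] [CompactSpace C] [ConnectedSpace C]

theorem exists_ncard_preimage_eq_degree {f : C → CP 1} (hf : IsHolomorphic f)
    (hn : Nonconstant f) : ∃ a : CP 1, (f ⁻¹' {a}).ncard = degree f := by
  obtain ⟨B, hB, hBd⟩ := exists_finite_degree hf hn
  have := infinite_of_riemannSurface (C := C)
  obtain ⟨x, hx⟩ := (hB.biUnion fun b _ => finite_preimage hf hn b).infinite_compl.nonempty
  exact ⟨f x, (hBd (f x) fun h => hx (mem_iUnion₂.2 ⟨f x, h, rfl⟩)).1⟩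

/-- Rank and nullity: the kernel has dimension at least n - dim W ≥ 2. The target is only required
to be an additive monoid; its negatives come from the scalar -1. -/
theorem exists_linearIndependent_pair_ker {n : ℕ} {V W : Type*} [AddCommGroup V] [Module ℂ V]
    [AddCommMonoid W] [Module ℂ W] [FiniteDimensional ℂ V] (hV : Module.finrank ℂ V = n)
    (hW : Cardinal.toENat (Module.rank ℂ W) + 2 ≤ (n : ℕ∞)) (Φ : V →ₗ[ℂ] W) :
    ∃ v w : V, Φ v = 0 ∧ Φ w = 0 ∧ ∀ r s : ℂ, r • v + s • w = 0 → r = 0 ∧ s = 0 := by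
  let := Module.addCommMonoidToAddCommGroup ℂ (M := W)
  -- An infinite dimension would have value ⊤ in `ℕ∞`, exceeding the finite bound.
  have h1 : Module.rank ℂ W < Cardinal.aleph0 := by
    rw [← Cardinal.toENat_ne_top]
    intro h
    rw [h, top_add] at hW
    exact absurd hW (by simp)
  have : Module.Finite ℂ W := Module.rank_lt_aleph0_iff.1 h1
  rw [← Module.finrank_eq_rank, Cardinal.toENat_nat] at hW
  have h2 : Module.finrank ℂ W + 2 ≤ n := by exact_mod_cast hW
  have h3 := Φ.finrank_range_add_finrank_ker
  have h4 := Φ.range.finrank_le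
  have h5 : 1 < Module.finrank ℂ (LinearMap.ker Φ) := by omega
  have : Nontrivial (LinearMap.ker Φ) := Module.nontrivial_of_finrank_pos (R := ℂ) (by omega)
  obtain ⟨v, hv⟩ := exists_ne (0 : LinearMap.ker Φ)
  obtain ⟨w, hw⟩ := exists_linearIndependent_pair_of_one_lt_finrank h5 hv
  rw [LinearIndependent.pair_iff] at hw
  exact ⟨v, w, v.2, w.2, fun r s h => hw r s (Subtype.ext h)⟩

/-- Riemann's inequality for an unramified fibre. Two independent families of principal parts have
zero class and give sections with independent values on the fibre; `vanForm a` vanishes on the fibre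
but not identically, so it is independent of both. -/
theorem three_le_h0_of_genus {f : C → CP 1} (hf : IsHolomorphic f) (hd : 2 ≤ degree f)
    (hg : genus C + 2 ≤ (degree f : ℕ∞)) : 3 ≤ h0 f := by
  have hn : Nonconstant f := nonconstant_of_degree_ne_zero (by omega)
  obtain ⟨a, ha⟩ := exists_ncard_preimage_eq_degree hf hn
  have hP := finite_preimage hf hn a
  have hQ : ∀ x ∉ f ⁻¹' {a}, HolAt (quot (innerForm a) (vanForm a) f) x := fun x hx =>
    hf.holAt_quot _ fun h => hx (eq_of_vanForm_eq_zero h)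
  have := hP.fintype
  have hinj : Function.Injective (Subtype.val : f ⁻¹' {a} → C) := Subtype.val_injective
  obtain ⟨v, w, hv, hw, hvw⟩ := exists_linearIndependent_pair_ker (V := f ⁻¹' {a} → ℂ) (W := H1 C)
    (n := degree f) (by rw [Module.finrank_fintype_fun_eq_card, ← ha, Set.ncard_eq_toFinset_card'];
                        simp) hg
    (principalClass hP hQ ∘ₗ Function.ExtendByZero.linearMap ℂ Subtype.val)
  obtain ⟨σ, hσ, hσv⟩ := exists_section_of_principalClass_eq_zero hf hP hQ hv
  obtain ⟨τ, hτ, hτw⟩ := exists_section_of_principalClass_eq_zero hf hP hQ hw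
  obtain ⟨S, hS⟩ := exists_linSection hf
  refine three_le_h0 (v := ![⟨σ, hσ⟩, ⟨τ, hτ⟩, S (vanForm a)]) ?_
  rw [Fintype.linearIndependent_iff]
  intro g h
  simp only [Fin.sum_univ_three, Matrix.cons_val_zero, Matrix.cons_val_one, Matrix.cons_val] at h
  have hval : ∀ x, g 0 * secVal f σ x + g 1 * secVal f τ x + g 2 * vanForm a (f x).rep = 0 := by
    intro x
    have h1 := congrFun (congrArg (fun s : globalSections f => secVal f s) h) x
    simp only [Submodule.coe_add, Submodule.coe_smul, map_add, map_smul, hS] at h1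
    simpa using h1
  obtain ⟨h0, h1⟩ := hvw (g 0) (g 1) (funext fun x => by
    have hx : f x = a := x.2
    have := hval x
    rw [hσv x hx, hτw x hx, hx, vanForm_self, mul_zero, add_zero] at this
    simp only [Function.ExtendByZero.linearMap_apply, hinj.extend_apply] at this
    have hi := innerForm_self_ne_zero a
    have h2 : (g 0 * v x + g 1 * w x) * innerForm a a.rep = 0 := by linear_combination this
    exact (mul_eq_zero.1 h2).resolve_right hi)
  obtain ⟨x, hx⟩ := hn _ (vanForm_ne_zero a)
  have h2 := hval x
  rw [h0, h1, zero_mul, zero_mul, zero_add, zero_add] at h2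
  have h2 := (mul_eq_zero.1 h2).resolve_right hx
  intro i
  fin_cases i
  exacts [h0, h1, h2]

end Planarity

end
-- The criterion and its consequence for large degree.
theorem mainTheorem10 {C : Type*} [TopologicalSpace C] [T2Space C] [CompactSpace C]
    [ConnectedSpace C] [ChartedSpace ℂ C] [IsManifold 𝓘(ℂ) ω C]
    (f : C → Planarity.CP 1) (hf : Planarity.IsHolomorphic f) (hd : 2 ≤ Planarity.degree f)
    (hbranch : {a | Planarity.IsComplicatedBranchPoint f a}.Subsingleton) :
    (Planarity.HasPlanarityDefect f 0 ↔ 3 ≤ Planarity.h0 f) ∧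
      (Planarity.genus C + 2 ≤ (Planarity.degree f : ℕ∞) → Planarity.HasPlanarityDefect f 0) := by
  have h := Planarity.hasPlanarityDefect_zero_iff hf hd hbranch
  exact ⟨h, fun hg => h.2 (Planarity.three_le_h0_of_genus hf hd hg)⟩
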